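/- Let $\Omega=\mathbb R^3\setminus\bar B(0,1)$ be the exterior of the closed unit ball, and let functions be complex valued. The radial space $\dot H^1_0(\Omega)$ is the closure of the radial functions in $C_c^\infty(\Omega)$ in the norm $\|\nabla f\|_{L^2(\Omega)}$, realized by Sobolev embedding as a space of functions in $L^6(\Omega)$ with weak gradient in $L^2(\Omega)$. For a radial $f\in C_c^\infty(\Omega)$, written $f=f(r)$ with $r=|x|$, put $$\mathcal F_0 f(\lambda)=\sqrt{\tfrac2\pi}\int_1^\infty \frac{\sin\lambda(s-1)}{s}\,f(s)\,s^2\,ds,\qquad \lambda>0.$$ The map $\mathcal F_0$ extends by continuity to an isomorphism of radial $L^2(\Omega)$ onto $L^2((0,\infty),d\lambda)$, and of radial $\dot H^1_0(\Omega)$ onto the functions $k$ on $(0,\infty)$ with $\lambda k(\lambda)\in L^2((0,\infty),d\lambda)$. For radial $f\in\dot H^1_0(\Omega)$, with $\Delta_D$ the Dirichlet Laplacian of $\Omega$, $(-\Delta_D)^{1/2}f$ denotes the radial function in $L^2(\Omega)$ with $$\mathcal F_0\big((-\Delta_D)^{1/2}f\big)(\lambda)=\lambda\,\mathcal F_0f(\lambda)\quad\text{for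 a.e. }\lambda>0.$$ **Proposition.** Let $1<p<3$. Then there is a constant $0<C_p<\infty$, depending only on $p$, such that for every radial $f\in\dot H^1_0(\Omega)$ the weak gradient $\nabla f$ and the function $(-\Delta_D)^{1/2}f$ are well defined up to null sets and belong to $L^2(\Omega)$, and $$C_p^{-1}\,\|\nabla f\|_{L^p(\Omega)}\le\|(-\Delta_D)^{1/2}f\|_{L^p(\Omega)}\le C_p\,\|\nabla f\|_{L^p(\Omega)},$$ where the norms take values in $[0,\infty]$ (so one is finite if and only if the other is). -/

import Mathlib

open MeasureTheory Set Filter Topology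
open scoped ContDiff ENNReal

noncomputable section

namespace ExteriorBall

/-- Euclidean space `ℝ³`. -/
abbrev E3 : Type := EuclideanSpace ℝ (Fin 3)

/-- `Ω = ℝ³ ∖ B̄(0,1)`. -/
def Omega : Set E3 := (Metric.closedBall (0 : E3) 1)ᶜ

/-- Lebesgue measure on `Ω`. -/
def volOmega : Measure E3 := volume.restrict Omega

/-- The pointwise (classical) gradient of a complex-valued function on `ℝ³`; its norm is
`(∑ᵢ |∂ᵢφ|²)^(1/2)`. -/
def grad (φ : E3 → ℂ) (x : E3) : EuclideanSpace ℂ (Fin 3) :=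
  WithLp.toLp 2 fun i => fderiv ℝ φ x (EuclideanSpace.single i 1)

/-- `G` is the weak (distributional) gradient of `f` on `Ω`:
`∫_Ω f ∂ᵢψ = - ∫_Ω Gᵢ ψ` for all real-valued `ψ ∈ C_c^∞(Ω)` and `i = 1, 2, 3`. -/
structure HasWeakGrad (f : E3 → ℂ) (G : E3 → EuclideanSpace ℂ (Fin 3)) : Prop where
  locallyIntegrableOn : LocallyIntegrableOn f Omega volume
  locallyIntegrableOn_grad : LocallyIntegrableOn G Omega volume
  integral_eq : ∀ ψ : E3 → ℝ, ContDiff ℝ ∞ ψ → HasCompactSupport ψ → tsupport ψ ⊆ Omega →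
    ∀ i : Fin 3,
      ∫ x in Omega, fderiv ℝ ψ x (EuclideanSpace.single i 1) • f x
        = - ∫ x in Omega, ψ x • G x i

/-- `u ∈ C_c^∞((1,∞))`: the radial profiles of the radial functions in `C_c^∞(Ω)`. -/
structure IsTestProfile (u : ℝ → ℂ) : Prop where
  contDiff : ContDiff ℝ ∞ u
  hasCompactSupport : HasCompactSupport u
  tsupport_subset : tsupport u ⊆ Ioi 1

/-- The radial function `x ↦ u(|x|)` on `ℝ³` with profile `u`. -/
def lift (u : ℝ → ℂ) (x : E3) : ℂ := u ‖x‖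

/-- The radial functions `x ↦ uₙ(|x|)` converge to `f` in the norm `‖∇ · ‖_{L²(Ω)}`. -/
def TendstoGrad (u : ℕ → ℝ → ℂ) (f : E3 → ℂ) : Prop :=
  ∃ G : E3 → EuclideanSpace ℂ (Fin 3), HasWeakGrad f G ∧
    Tendsto (fun n => eLpNorm (fun x => grad (lift (u n)) x - G x) 2 volOmega) atTop (𝓝 0)

/-- The radial space `Ḣ¹₀(Ω)`: the closure of the radial functions in `C_c^∞(Ω)` in the norm
`‖∇f‖_{L²(Ω)}`, realized (Sobolev embedding) as a space of functions in `L⁶(Ω)`.  Its members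
are automatically radial, up to null sets. -/
def MemRadialH10 (f : E3 → ℂ) : Prop :=
  MemLp f 6 volOmega ∧
    ∃ u : ℕ → ℝ → ℂ, (∀ n, IsTestProfile (u n)) ∧ TendstoGrad u f

/-- The transform that diagonalizes the radial Dirichlet Laplacian of `Ω`, on profiles:
`ℱ₀u(l) = √(2/π) ∫₁^∞ (sin l(s-1) / s) u(s) s² ds`. Here `r ↦ sin l(r-1) / r` is the radial
generalized Dirichlet eigenfunction, with eigenvalue `-l²`. -/
def radialTransform (u : ℝ → ℂ) (l : ℝ) : ℂ :=
  (Real.sqrt (2 / Real.pi) : ℂ) *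
    ∫ s in Ioi (1 : ℝ), ((Real.sin (l * (s - 1)) / s : ℝ) : ℂ) * u s * ((s ^ 2 : ℝ) : ℂ)

/-- `ℱ₀ g = k`, where `ℱ₀` is extended by continuity from radial `C_c^∞(Ω)` to a map
from radial `L²(Ω)` to `L²((0,∞), dl)`. -/
def IsTransformL2 (g : E3 → ℂ) (k : ℝ → ℂ) : Prop :=
  MemLp g 2 volOmega ∧ MemLp k 2 (volume.restrict (Ioi 0)) ∧
    ∃ u : ℕ → ℝ → ℂ, (∀ n, IsTestProfile (u n)) ∧
      Tendsto (fun n => eLpNorm (fun x => lift (u n) x - g x) 2 volOmega) atTop (𝓝 0) ∧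
      Tendsto (fun n => eLpNorm (fun l => radialTransform (u n) l - k l) 2
        (volume.restrict (Ioi 0))) atTop (𝓝 0)

/-- `ℱ₀ f = k`, where `ℱ₀` is extended by continuity from radial `C_c^∞(Ω)` to a map from
radial `Ḣ¹₀(Ω)` to the functions `k` on `(0,∞)` with `l k(l)` in `L²((0,∞), dl)`. -/
def IsTransformH10 (f : E3 → ℂ) (k : ℝ → ℂ) : Prop :=
  MemRadialH10 f ∧ MemLp (fun l : ℝ => (l : ℂ) * k l) 2 (volume.restrict (Ioi 0)) ∧
    ∃ u : ℕ → ℝ → ℂ, (∀ n, IsTestProfile (u n)) ∧ TendstoGrad u f ∧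
      Tendsto (fun n => eLpNorm (fun l : ℝ => (l : ℂ) * (radialTransform (u n) l - k l)) 2
        (volume.restrict (Ioi 0))) atTop (𝓝 0)

/-- `g = (-Δ_D)^(1/2) f` for radial `f ∈ Ḣ¹₀(Ω)`, by the functional calculus
`m(√(-Δ_D)) f = ℱ₀⁻¹ (m ℱ₀ f)` with `m(l) = l`: `g` is the radial function in `L²(Ω)` with
`ℱ₀ g (l) = l ℱ₀ f (l)`. -/
def IsSqrtDirichletLaplacian (f g : E3 → ℂ) : Prop :=
  ∃ k : ℝ → ℂ, IsTransformH10 f k ∧ IsTransformL2 g (fun l => (l : ℂ) * k l)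

end ExteriorBall

end

noncomputable section

namespace ExteriorBall

/-! For a radial `f` with profile `u` put t = r - 1, v(t) = (1+t) u(1+t), V = v' and φ(t) = (1+t)
u'(1+t), so that V = φ + u. Up to a rescaling of the frequency, the transform of `f` is the sine
transform of v on (0, ∞). As v vanishes at t = 0, multiplication by the frequency turns it into the
cosine transform of V. Hence r (-Δ_D)^(1/2) f is h = `sinOp (cosOp V)`, while r |∇f| is |φ|. In
polar coordinates L^p norms over Ω become L^p norms over (0, ∞) with the weight (1+t)^(2/p-1), and
the theorem is a two-sided weighted comparison of φ and h: `exists_eLpNorm_sinOp_cosOp_le` and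
`exists_eLpNorm_gradPair_le`.

Abel summation turns `sinOp ∘ cosOp` into an integral operator with kernel (Q(t-s) + Q(t+s))/π,
where Q(x) = x/(x²+ε²). In V = φ + u the term u is integrated by parts against the primitive L of
Q(t-s) + Q(t+s) in s, so h is a limit of operators applied to φ, with kernel Q(t-s) + Q(t+s) -
L/(1+s) up to the factor 1/π. Since u vanishes at both ends, ∫ φ/(1+s) = ∫ u' = 0. This allows
subtracting 2/((1+t)(1+s)), the leading term of the kernel as t → ∞, and the decay so gained is what
the weight demands when p is close to 1. Conversely V = `cosOp (sinOp h)`, because both transforms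
are involutions, and φ(s) is V(s) minus (1+s)⁻¹ ∫₀ˢ V. The same kernel appears transposed, and needs
no correction.

After conjugation with the weight, both kernels are ± Q(x-y) plus an error of Hardy type
(`IsHilbertPerturbation.abs_conj_sub_le`). The error is handled by Schur's test with power weights,
which requires p < 3. The main term is the Hilbert transform: for a nonnegative function its Cauchy
integral F maps the upper half-plane to the right half-plane, F^p is holomorphic with vanishing
horizontal integrals, and a trigonometric inequality valid for 1 < p < 3 bounds |Im F|^p by (Re F)^p
modulo Re F^p. The whole range is reached without interpolation or duality. All bounds are uniform
in ε, and Fatou's lemma removes the regularization (`exists_eLpNorm_weighted_le`,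
`eLpNorm_smul_le_of_ae_tendsto`).

Hardy's identity, the equality of the L²(0, ∞) norms of (ru)' and ru', carries the construction from
test profiles to the closure, and `isSqrtDirichletLaplacian_iff` identifies (-Δ_D)^(1/2) f there. -/

/-! ### The Fourier transform of the line on L¹ ∩ L². -/

open FourierTransform SchwartzMap in
/-- On `L¹ ∩ L²` the Fourier transform of `L²` is given by the Fourier integral. -/
theorem fourier_toLp_ae_eq {f : ℝ → ℂ} (h1 : Integrable f) (h2 : MemLp f 2) :
    (𝓕 (h2.toLp f) : Lp (α := ℝ) ℂ 2 volume) =ᵐ[volume] 𝓕 f := by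
  have hcont : Continuous (𝓕 f) :=
    VectorFourier.fourierIntegral_continuous Real.continuous_fourierChar
      (by exact continuous_inner) h1
  apply ae_eq_of_integral_contDiff_smul_eq
  · exact (Lp.memLp (𝓕 (h2.toLp f) : Lp (α := ℝ) ℂ 2 volume)).locallyIntegrable (by norm_num)
  · exact hcont.locallyIntegrable
  intro g hg1 hg2
  have hg1' : ContDiff ℝ ∞ (fun x => (g x : ℂ)) := Complex.ofRealCLM.contDiff.comp hg1
  have hg2' : HasCompactSupport (fun x => (g x : ℂ)) := hg2.comp_left (g := ((↑) : ℝ → ℂ)) rfl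
  -- The L² transform agrees with the transform of tempered distributions. Tested against a bump
  -- function it is therefore governed by the same multiplication formula as the Fourier integral.
  have key := congrArg (fun T => T (hg2'.toSchwartzMap hg1'))
    (Lp.fourier_toTemperedDistribution_eq (h2.toLp f))
  simp only [TemperedDistribution.fourier_apply, Lp.toTemperedDistribution_apply] at key
  calc ∫ x, g x • (𝓕 (h2.toLp f) : Lp (α := ℝ) ℂ 2 volume) x
      = ∫ x, (hg2'.toSchwartzMap hg1') x • (𝓕 (h2.toLp f) : Lp (α := ℝ) ℂ 2 volume) x := by
        refine integral_congr_ae (Eventually.of_forall fun x => ?_)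
        simp
    _ = ∫ x, 𝓕 (hg2'.toSchwartzMap hg1') x • (h2.toLp f) x := key.symm
    _ = ∫ x, 𝓕 (hg2'.toSchwartzMap hg1') x • f x := by
        refine integral_congr_ae ?_
        filter_upwards [h2.coeFn_toLp] with x hx
        rw [hx]
    _ = ∫ x, (hg2'.toSchwartzMap hg1') x • 𝓕 f x := by
        have := VectorFourier.integral_fourierIntegral_smul_eq_flip (e := Real.fourierChar)
          (L := innerₗ ℝ) (μ := volume) (ν := volume) Real.continuous_fourierChar
          (by exact continuous_inner) (hg2'.toSchwartzMap hg1').integrable h1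
        rw [flip_innerₗ] at this
        rw [SchwartzMap.fourier_coe]
        exact this
    _ = _ := by
        refine integral_congr_ae (Eventually.of_forall fun x => ?_)
        simp

open FourierTransform in
theorem eLpNorm_fourier_eq {f : ℝ → ℂ} (h1 : Integrable f) (h2 : MemLp f 2) :
    eLpNorm (𝓕 f) 2 volume = eLpNorm f 2 volume := by
  rw [← eLpNorm_congr_ae (fourier_toLp_ae_eq h1 h2)]
  have := Lp.norm_fourier_eq (h2.toLp f)
  rw [Lp.norm_toLp, Lp.norm_def] at this
  exact (ENNReal.toReal_eq_toReal_iff' (Lp.eLpNorm_ne_top _) h2.eLpNorm_ne_top).mp this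

theorem lintegral_eq_lintegral_Ioi_add_neg {F : ℝ → ℝ≥0∞} (hF : AEMeasurable F) :
    ∫⁻ x, F x = ∫⁻ x in Ioi 0, (F x + F (-x)) := by
  have h1 : ∫⁻ x in Iic 0, F x = ∫⁻ x in Ioi 0, F (-x) := by
    have hm : MeasurePreserving (fun x : ℝ => -x) (volume.restrict (Ici 0))
        (volume.restrict (Iic 0)) := by
      have := (Measure.measurePreserving_neg (volume : Measure ℝ)).restrict_preimage
        (measurableSet_Iic (a := (0 : ℝ)))
      simpa using this
    rw [← hm.map_eq, lintegral_map' (by rw [hm.map_eq]; exact hF.restrict) hm.measurable.aemeasurable]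
    exact (setLIntegral_congr Ioi_ae_eq_Ici).symm
  rw [← lintegral_add_compl F measurableSet_Ioi (A := Ioi 0), compl_Ioi, h1,
    ← lintegral_add_left' hF.restrict]

theorem integral_eq_integral_Ioi_add_neg {F : ℝ → ℂ} (hF : Integrable F) :
    ∫ x, F x = ∫ x in Ioi 0, (F x + F (-x)) := by
  rw [integral_add hF.restrict hF.comp_neg.restrict, integral_comp_neg_Ioi, neg_zero,
    ← integral_add_compl (measurableSet_Ioi (a := (0:ℝ))) hF, compl_Ioi]

/-! ### Sine and cosine transforms of the half-line. -/

/-- A kernel which is, up to a unimodular factor, `2 cos` or `2 sin`. -/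
structure IsTrigKernel (e : ℝ → ℝ) (c σ : ℂ) : Prop where
  norm_c : ‖c‖ = 1
  sign : σ = 1 ∨ σ = -1
  eq : ∀ θ : ℝ, c * e θ = Complex.exp (-θ * Complex.I) + σ * Complex.exp (θ * Complex.I)

namespace IsTrigKernel

variable {e : ℝ → ℝ} {c σ : ℂ}

theorem abs_le (h : IsTrigKernel e c σ) (θ : ℝ) : |e θ| ≤ 2 := by
  have h1 : ‖c * e θ‖ = |e θ| := by simp [h.norm_c]
  rw [← h1, h.eq]
  refine (norm_add_le _ _).trans ?_
  have h2 : ‖Complex.exp (-θ * Complex.I)‖ = 1 := by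
    have := Complex.norm_exp_ofReal_mul_I (-θ)
    push_cast at this; exact this
  have h3 : ‖σ‖ = 1 := by rcases h.sign with h | h <;> simp [h]
  rw [norm_mul, h2, h3, Complex.norm_exp_ofReal_mul_I]; norm_num

theorem continuous (h : IsTrigKernel e c σ) : Continuous e := by
  have hc : c ≠ 0 := by intro h0; simpa [h0] using h.norm_c
  have : e = fun θ : ℝ => (c⁻¹ * (Complex.exp (-θ * Complex.I) + σ * Complex.exp (θ * Complex.I))).re := by
    ext θ
    rw [← h.eq, inv_mul_cancel_left₀ hc, Complex.ofReal_re]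
  rw [this]
  fun_prop

end IsTrigKernel

theorem isTrigKernel_cos : IsTrigKernel (fun θ => 2 * Real.cos θ) 1 1 where
  norm_c := by simp
  sign := Or.inl rfl
  eq θ := by push_cast; rw [Complex.cos]; ring

theorem isTrigKernel_sin : IsTrigKernel (fun θ => 2 * Real.sin θ) (-Complex.I) (-1) where
  norm_c := by simp
  sign := Or.inr rfl
  eq θ := by
    push_cast; rw [Complex.sin]
    linear_combination (-Complex.exp (-θ * Complex.I) + Complex.exp (θ * Complex.I)) * Complex.I_mul_I

/-- The half-line transform `ξ ↦ ∫₀^∞ e(2πxξ) f(x) dx`. -/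
def halfTransform (e : ℝ → ℝ) (f : ℝ → ℂ) (ξ : ℝ) : ℂ :=
  ∫ x in Ioi (0 : ℝ), (e (2 * Real.pi * x * ξ) : ℂ) * f x

/-- Lebesgue measure on `(0, ∞)`. -/
abbrev volPos : Measure ℝ := volume.restrict (Ioi 0)

section Plancherel

variable {e : ℝ → ℝ} {c σ : ℂ}

theorem integrable_trig_mul (h : IsTrigKernel e c σ) {f : ℝ → ℂ} (hf : Integrable f volPos) (ξ : ℝ) :
    Integrable (fun x => (e (2 * Real.pi * x * ξ) : ℂ) * f x) volPos := by
  have := h.continuous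
  refine hf.bdd_mul (c := 2) ?_ (Eventually.of_forall fun x => ?_)
  · fun_prop
  · simpa using h.abs_le _

/-- The extension of a function on the half-line with parity `σ`. -/
def parityExt (σ : ℂ) (f : ℝ → ℂ) (x : ℝ) : ℂ := if 0 < x then f x else σ * f (-x)

theorem parityExt_of_pos (f : ℝ → ℂ) {x : ℝ} (hx : 0 < x) : parityExt σ f x = f x := if_pos hx
theorem parityExt_neg (f : ℝ → ℂ) {x : ℝ} (hx : 0 < x) : parityExt σ f (-x) = σ * f x := by
  rw [parityExt, if_neg (by linarith), neg_neg]

theorem aestronglyMeasurable_parityExt {f : ℝ → ℂ} (hf : AEStronglyMeasurable f volPos) :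
    AEStronglyMeasurable (parityExt σ f) volume := by
  have h1 : AEStronglyMeasurable (parityExt σ f) (volume.restrict (Ioi 0)) :=
    hf.congr <| by
      filter_upwards [self_mem_ae_restrict measurableSet_Ioi] with x hx
      rw [parityExt_of_pos f hx]
  have h2 : AEStronglyMeasurable (parityExt σ f) (volume.restrict (Iio 0)) := by
    have hm : MeasurePreserving (fun x : ℝ => -x) (volume.restrict (Iio 0))
        (volume.restrict (Ioi 0)) := by
      have := (Measure.measurePreserving_neg (volume : Measure ℝ)).restrict_preimage
        (measurableSet_Ioi (a := (0 : ℝ)))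
      simpa using this
    refine ((hf.comp_measurePreserving hm).const_mul σ).congr ?_
    filter_upwards [self_mem_ae_restrict measurableSet_Iio] with x hx
    rw [parityExt, if_neg (not_lt.mpr (le_of_lt hx))]; rfl
  have h3 : AEStronglyMeasurable (parityExt σ f) (volume.restrict (Iic 0)) := by
    rwa [← restrict_Iio_eq_restrict_Iic]
  have := aestronglyMeasurable_union_iff.mpr ⟨h1, h3⟩
  rwa [Ioi_union_Iic, Measure.restrict_univ] at this

theorem eLpNorm_two_eq_of_even {F : ℝ → ℂ} (hF : AEStronglyMeasurable F)
    (h : ∀ x, 0 < x → ‖F (-x)‖ = ‖F x‖) :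
    eLpNorm F 2 volume = 2 ^ (1 / 2 : ℝ) * eLpNorm F 2 volPos := by
  rw [eLpNorm_eq_lintegral_rpow_enorm_toReal (by norm_num) (by norm_num),
    eLpNorm_eq_lintegral_rpow_enorm_toReal (by norm_num) (by norm_num),
    lintegral_eq_lintegral_Ioi_add_neg (hF.enorm.pow_const _), ENNReal.toReal_ofNat,
    ← ENNReal.mul_rpow_of_nonneg _ _ (by norm_num)]
  congr 1
  rw [← lintegral_const_mul' _ _ (by norm_num)]
  refine setLIntegral_congr_fun measurableSet_Ioi fun x hx => ?_
  have : ‖F (-x)‖ₑ = ‖F x‖ₑ := by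
    rw [← ofReal_norm, h x hx, ofReal_norm]
  simp only [this]
  ring

theorem integrable_parityExt (hσ : σ = 1 ∨ σ = -1) {f : ℝ → ℂ} (hf : Integrable f volPos) :
    Integrable (parityExt σ f) volume := by
  have hm := aestronglyMeasurable_parityExt (σ := σ) hf.1
  refine ⟨hm, ?_⟩
  rw [HasFiniteIntegral, lintegral_eq_lintegral_Ioi_add_neg hm.enorm]
  have : ∫⁻ x in Ioi 0, (‖parityExt σ f x‖ₑ + ‖parityExt σ f (-x)‖ₑ) = ∫⁻ x in Ioi 0, 2 * ‖f x‖ₑ := by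
    refine setLIntegral_congr_fun measurableSet_Ioi fun x hx => ?_
    simp only [parityExt_of_pos f hx, parityExt_neg f hx]
    rcases hσ with h | h <;> simp [h, two_mul]
  rw [this, lintegral_const_mul' _ _ (by norm_num)]
  exact ENNReal.mul_lt_top (by norm_num) hf.2

theorem eLpNorm_parityExt (hσ : σ = 1 ∨ σ = -1) {f : ℝ → ℂ} (hf : AEStronglyMeasurable f volPos) :
    eLpNorm (parityExt σ f) 2 volume = 2 ^ (1 / 2 : ℝ) * eLpNorm f 2 volPos := by
  rw [eLpNorm_two_eq_of_even (aestronglyMeasurable_parityExt hf)]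
  · congr 1
    refine eLpNorm_congr_ae ?_
    filter_upwards [self_mem_ae_restrict measurableSet_Ioi] with x hx
    exact parityExt_of_pos f hx
  · intro x hx
    rw [parityExt_of_pos f hx, parityExt_neg f hx]
    rcases hσ with h | h <;> simp [h]

open FourierTransform in
-- Folding the Fourier integral at the origin pairs x with -x, and the parity sign combines the two
-- exponentials into the trigonometric kernel. Plancherel on the line then passes to the half-line.
theorem fourier_parityExt (h : IsTrigKernel e c σ) {f : ℝ → ℂ} (hf : Integrable f volPos) (ξ : ℝ) :
    𝓕 (parityExt σ f) ξ = c * halfTransform e f ξ := by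
  have hi := integrable_parityExt h.sign hf
  rw [Real.fourier_eq', integral_eq_integral_Ioi_add_neg, halfTransform, ← integral_const_mul]
  · refine setIntegral_congr_fun measurableSet_Ioi fun x hx => ?_
    simp only [parityExt_of_pos f hx, parityExt_neg f hx]
    rw [← mul_assoc, h.eq]
    simp only [RCLike.inner_apply, conj_trivial, smul_eq_mul]
    push_cast
    rw [show -2 * (Real.pi:ℂ) * (ξ * x) * Complex.I = -(2 * Real.pi * x * ξ) * Complex.I by ring,
      show -2 * (Real.pi:ℂ) * (ξ * -x) * Complex.I = (2 * Real.pi * x * ξ) * Complex.I by ring]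
    ring
  · have := (Real.fourierIntegral_convergent_iff (f := parityExt σ f) (μ := volume) ξ).2 hi
    refine this.congr (Eventually.of_forall fun x => ?_)
    simp only [Circle.smul_def, Real.fourierChar_apply, smul_eq_mul]
    congr 3
    push_cast
    ring

theorem continuous_halfTransform (h : IsTrigKernel e c σ) {f : ℝ → ℂ} (hf : Integrable f volPos) :
    Continuous (halfTransform e f) := by
  have hc := h.continuous
  refine continuous_of_dominated (bound := fun x => 2 * ‖f x‖) ?_ ?_ ?_ ?_
  · intro ξ; exact (integrable_trig_mul h hf ξ).1
  · intro ξ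
    refine Eventually.of_forall fun x => ?_
    rw [norm_mul]
    gcongr
    simpa using h.abs_le _
  · exact hf.norm.const_mul 2
  · exact Eventually.of_forall fun x => by fun_prop

/-- Plancherel's theorem for the sine and cosine transforms of the half-line. -/
theorem eLpNorm_halfTransform (h : IsTrigKernel e c σ) {f : ℝ → ℂ} (hf : Integrable f volPos)
    (hf2 : MemLp f 2 volPos) : eLpNorm (halfTransform e f) 2 volPos = eLpNorm f 2 volPos := by
  have hi := integrable_parityExt h.sign hf
  have h2 : MemLp (parityExt σ f) 2 volume := by
    refine ⟨hi.1, ?_⟩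
    rw [eLpNorm_parityExt h.sign hf.1]
    exact ENNReal.mul_lt_top (ENNReal.rpow_lt_top_of_nonneg (by norm_num) (by norm_num)) hf2.2
  have h3 := eLpNorm_fourier_eq hi h2
  rw [eLpNorm_parityExt h.sign hf.1] at h3
  have h4 : eLpNorm (FourierTransform.fourier (parityExt σ f)) 2 volume
      = eLpNorm (halfTransform e f) 2 volume := by
    refine eLpNorm_congr_norm_ae (Eventually.of_forall fun ξ => ?_)
    rw [fourier_parityExt h hf, norm_mul, h.norm_c, one_mul]
  -- The transform inherits the parity of the extension, so both sides carry the same factor √2,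
  -- which cancels.
  rw [h4, eLpNorm_two_eq_of_even (continuous_halfTransform h hf).aestronglyMeasurable] at h3
  · exact (ENNReal.mul_right_inj (by simp) (by simp)).mp h3
  · intro ξ _
    have hev : ∀ η, ‖halfTransform e f η‖ = ‖FourierTransform.fourier (parityExt σ f) η‖ := by
      intro η
      rw [fourier_parityExt h hf, norm_mul, h.norm_c, one_mul]
    have hs : halfTransform e f (-ξ) = σ * halfTransform e f ξ := by
      rw [halfTransform, halfTransform, ← integral_const_mul]
      refine setIntegral_congr_fun measurableSet_Ioi fun x hx => ?_
      have hc : c ≠ 0 := by intro h0; simpa [h0] using h.norm_c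
      have h4 : σ * σ = 1 := by rcases h.sign with h | h <;> simp [h]
      have h5 : ∀ θ : ℝ, (e (-θ) : ℂ) = σ * e θ := by
        intro θ
        refine mul_left_cancel₀ hc ?_
        rw [h.eq, mul_left_comm, h.eq]
        push_cast
        rw [mul_add, ← mul_assoc, h4, neg_neg]; ring
      rw [show 2 * Real.pi * x * -ξ = -(2 * Real.pi * x * ξ) by ring, h5]; ring
    rw [hs, norm_mul]
    rcases h.sign with h | h <;> simp [h]

end Plancherel

/-! ### The transforms as unitary involutions of L²(0, ∞). -/

section HalfOperator

variable {e : ℝ → ℝ} {c σ : ℂ}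

theorem memLp_halfTransform (h : IsTrigKernel e c σ) {f : ℝ → ℂ} (hf : Integrable f volPos)
    (hf2 : MemLp f 2 volPos) : MemLp (halfTransform e f) 2 volPos :=
  ⟨(continuous_halfTransform h hf).aestronglyMeasurable, by
    rw [eLpNorm_halfTransform h hf hf2]; exact hf2.2⟩

theorem halfTransform_congr_ae {f g : ℝ → ℂ} (hfg : f =ᵐ[volPos] g) :
    halfTransform e f = halfTransform e g := by
  ext ξ
  refine integral_congr_ae ?_
  filter_upwards [hfg] with x hx
  rw [hx]

/-- The integrable functions in `L²(0, ∞)`. -/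
def integrableSubmodule : Submodule ℂ (Lp ℂ 2 volPos) where
  carrier := {f | Integrable f volPos}
  add_mem' := by
    intro f g hf hg
    exact (Integrable.add hf hg).congr (Lp.coeFn_add f g).symm
  zero_mem' := (integrable_zero ℝ ℂ volPos).congr (Lp.coeFn_zero ℂ 2 volPos).symm
  smul_mem' := by
    intro a f hf
    exact (Integrable.smul a hf).congr (Lp.coeFn_smul a f).symm

/-- Simple functions are dense in L², and those in L² live on sets of finite measure, hence are
integrable. -/
theorem denseRange_integrableSubmodule : DenseRange integrableSubmodule.subtype := by
  have h : Dense (integrableSubmodule : Set (Lp ℂ 2 volPos)) := by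
    refine (Lp.simpleFunc.dense (E := ℂ) (μ := volPos) (p := 2) (by norm_num)).mono ?_
    intro f hf
    let g : Lp.simpleFunc ℂ 2 volPos := ⟨f, hf⟩
    have h1 := Lp.simpleFunc.memLp g
    exact ((SimpleFunc.memLp_iff_integrable (by norm_num) (by norm_num)).mp h1).congr
      (Lp.simpleFunc.toSimpleFunc_eq_toFun g)
  simpa [DenseRange] using h

/-- The half-line transform on `L¹ ∩ L²`. -/
def halfTransformₗ (h : IsTrigKernel e c σ) : integrableSubmodule →ₗ[ℂ] Lp ℂ 2 volPos where
  toFun f := (memLp_halfTransform h f.2 (Lp.memLp f.1)).toLp _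
  map_add' f g := by
    rw [← MemLp.toLp_add]
    congr 1
    ext ξ
    rw [show ((f + g : integrableSubmodule) : Lp ℂ 2 volPos) = f.1 + g.1 from rfl,
      halfTransform_congr_ae (e := e) (Lp.coeFn_add f.1 g.1), Pi.add_apply]
    unfold halfTransform
    rw [← integral_add (integrable_trig_mul h f.2 ξ) (integrable_trig_mul h g.2 ξ)]
    refine integral_congr_ae (Eventually.of_forall fun x => ?_)
    simp only [Pi.add_apply]; ring
  map_smul' a f := by
    rw [RingHom.id_apply, ← MemLp.toLp_const_smul]
    congr 1
    ext ξ
    rw [show ((a • f : integrableSubmodule) : Lp ℂ 2 volPos) = a • f.1 from rfl,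
      halfTransform_congr_ae (e := e) (Lp.coeFn_smul a f.1), Pi.smul_apply]
    unfold halfTransform
    rw [← integral_smul]
    refine integral_congr_ae (Eventually.of_forall fun x => ?_)
    simp only [Pi.smul_apply, smul_eq_mul]; ring

theorem norm_halfTransformₗ (h : IsTrigKernel e c σ) (f : integrableSubmodule) :
    ‖halfTransformₗ h f‖ = ‖integrableSubmodule.subtype f‖ := by
  change ‖(memLp_halfTransform h f.2 (Lp.memLp f.1)).toLp _‖ = ‖f.1‖
  rw [Lp.norm_toLp, eLpNorm_halfTransform h f.2 (Lp.memLp f.1), Lp.norm_def]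

/-- The sine or cosine transform as an operator of `L²(0, ∞)`. -/
def halfOp (h : IsTrigKernel e c σ) : Lp ℂ 2 volPos →L[ℂ] Lp ℂ 2 volPos :=
  (halfTransformₗ h).extendOfNorm integrableSubmodule.subtype

theorem halfOp_apply (h : IsTrigKernel e c σ) (f : integrableSubmodule) :
    halfOp h f.1 = halfTransformₗ h f :=
  LinearMap.extendOfNorm_eq denseRange_integrableSubmodule
    ⟨1, fun x => by rw [one_mul, norm_halfTransformₗ]⟩ f

theorem halfOp_toLp (h : IsTrigKernel e c σ) {f : ℝ → ℂ} (hf : Integrable f volPos)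
    (hf2 : MemLp f 2 volPos) :
    halfOp h (hf2.toLp f) = (memLp_halfTransform h hf hf2).toLp _ := by
  have hmem : Integrable (hf2.toLp f) volPos := hf.congr hf2.coeFn_toLp.symm
  rw [halfOp_apply h ⟨hf2.toLp f, hmem⟩]
  change (memLp_halfTransform h hmem (Lp.memLp _)).toLp _ = _
  congr 1
  exact halfTransform_congr_ae hf2.coeFn_toLp

theorem norm_halfOp (h : IsTrigKernel e c σ) (f : Lp ℂ 2 volPos) : ‖halfOp h f‖ = ‖f‖ := by
  refine denseRange_integrableSubmodule.induction_on (p := fun f => ‖halfOp h f‖ = ‖f‖) f ?_ ?_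
  · exact isClosed_eq (by fun_prop) (by fun_prop)
  · intro f
    have := norm_halfTransformₗ h f
    rwa [← halfOp_apply] at this

/-- The kernel is real and symmetric in its two variables. Being bounded, it leaves the product of
two integrable functions integrable, so Fubini applies. -/
theorem inner_halfTransform (h : IsTrigKernel e c σ) {f g : ℝ → ℂ} (hf : Integrable f volPos)
    (hg : Integrable g volPos) :
    ∫ x in Ioi 0, inner ℂ (halfTransform e f x) (g x)
      = ∫ x in Ioi 0, inner ℂ (f x) (halfTransform e g x) := by
  have hc := h.continuous
  have hint : Integrable (fun p : ℝ × ℝ => (e (2 * Real.pi * p.2 * p.1) : ℂ)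
      * (starRingEnd ℂ (f p.2) * g p.1)) (volPos.prod volPos) := by
    have h1 : Integrable (fun p : ℝ × ℝ => starRingEnd ℂ (f p.2) * g p.1) (volPos.prod volPos) := by
      have hf' : Integrable (fun x => starRingEnd ℂ (f x)) volPos :=
        (LinearIsometryEquiv.integrable_comp_iff (RCLike.conjLIE (K := ℂ))).mpr hf
      have := hg.mul_prod hf'
      refine this.congr (Eventually.of_forall fun p => ?_)
      simp only; ring
    refine h1.bdd_mul (c := 2) ?_ (Eventually.of_forall fun p => ?_)
    · exact (by fun_prop : Continuous fun p : ℝ × ℝ => (e (2 * Real.pi * p.2 * p.1) : ℂ)).aestronglyMeasurable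
    · simpa using h.abs_le _
  calc ∫ x in Ioi 0, inner ℂ (halfTransform e f x) (g x)
      = ∫ x in Ioi 0, ∫ y in Ioi 0,
          (e (2 * Real.pi * y * x) : ℂ) * (starRingEnd ℂ (f y) * g x) := by
        refine integral_congr_ae (Eventually.of_forall fun x => ?_)
        simp only [RCLike.inner_apply, halfTransform]
        rw [← integral_conj, ← integral_const_mul]
        refine integral_congr_ae (Eventually.of_forall fun y => ?_)
        simp only [map_mul, Complex.conj_ofReal]; ring
    _ = ∫ y in Ioi 0, ∫ x in Ioi 0,
          (e (2 * Real.pi * y * x) : ℂ) * (starRingEnd ℂ (f y) * g x) := integral_integral_swap hint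
    _ = _ := by
        refine integral_congr_ae (Eventually.of_forall fun y => ?_)
        simp only [RCLike.inner_apply, halfTransform]
        rw [← integral_mul_const]
        refine integral_congr_ae (Eventually.of_forall fun x => ?_)
        simp only
        rw [show 2 * Real.pi * y * x = 2 * Real.pi * x * y by ring]; ring

theorem inner_halfOp (h : IsTrigKernel e c σ) (f g : Lp ℂ 2 volPos) :
    inner ℂ (halfOp h f) g = inner ℂ f (halfOp h g) := by
  refine denseRange_integrableSubmodule.induction_on
    (p := fun f => inner ℂ (halfOp h f) g = inner ℂ f (halfOp h g)) f ?_ ?_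
  · exact isClosed_eq (by fun_prop) (by fun_prop)
  intro f
  refine denseRange_integrableSubmodule.induction_on
    (p := fun g => inner ℂ (halfOp h (integrableSubmodule.subtype f)) g
      = inner ℂ (integrableSubmodule.subtype f) (halfOp h g)) g ?_ ?_
  · exact isClosed_eq (by fun_prop) (by fun_prop)
  intro g
  simp only [Submodule.subtype_apply]
  rw [halfOp_apply, halfOp_apply, L2.inner_def, L2.inner_def]
  have e1 : ∀ f : integrableSubmodule,
      halfTransformₗ h f =ᵐ[volPos] halfTransform e f.1 := fun f =>
    (memLp_halfTransform h f.2 (Lp.memLp f.1)).coeFn_toLp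
  rw [integral_congr_ae (g := fun x => inner ℂ (halfTransform e f.1 x) (g.1 x)),
    inner_halfTransform h f.2 g.2]
  · refine integral_congr_ae ?_
    filter_upwards [e1 g] with x hx
    rw [hx]
  · filter_upwards [e1 f] with x hx
    rw [hx]

theorem inner_halfOp_halfOp (h : IsTrigKernel e c σ) (f g : Lp ℂ 2 volPos) :
    inner ℂ (halfOp h f) (halfOp h g) = inner ℂ f g :=
  (LinearMap.norm_map_iff_inner_map_map (halfOp h)).mp (norm_halfOp h) f g

/-- A symmetric isometry is an involution, so the inversion formula costs nothing beyond Plancherel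
and Fubini. -/
theorem halfOp_halfOp (h : IsTrigKernel e c σ) (f : Lp ℂ 2 volPos) :
    halfOp h (halfOp h f) = f := by
  refine ext_inner_right ℂ fun g => ?_
  rw [inner_halfOp, inner_halfOp_halfOp]

end HalfOperator

/-! ### Schur's test. -/

/-- Schur's test with a power weight. -/
theorem lintegral_rpow_le_of_schur {α : Type*} [MeasurableSpace α] {μ : Measure α} [SFinite μ]
    {p q : ℝ} (hpq : p.HolderConjugate q) {k : α → α → ℝ≥0∞}
    (hk : Measurable (Function.uncurry k)) {w : α → ℝ≥0∞} (hw : Measurable w)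
    (hw0 : ∀ᵐ x ∂μ, w x ≠ 0) (hwt : ∀ᵐ x ∂μ, w x ≠ ⊤) {A B : ℝ≥0∞}
    (h1 : ∀ᵐ x ∂μ, ∫⁻ y, k x y * w y ^ q ∂μ ≤ A * w x ^ q)
    (h2 : ∀ᵐ y ∂μ, ∫⁻ x, k x y * w x ^ p ∂μ ≤ B * w y ^ p)
    {f : α → ℝ≥0∞} (hf : AEMeasurable f μ) :
    ∫⁻ x, (∫⁻ y, k x y * f y ∂μ) ^ p ∂μ ≤ A ^ (p / q) * B * ∫⁻ x, f x ^ p ∂μ := by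
  have hp := hpq.pos
  have hq := hpq.symm.pos
  have hpt : ∀ᵐ x ∂μ, (∫⁻ y, k x y * f y ∂μ) ^ p
      ≤ A ^ (p / q) * ∫⁻ y, (w x ^ p * k x y) * (f y ^ p * (w y)⁻¹ ^ p) ∂μ := by
    filter_upwards [h1] with x hx
    have hkx : Measurable (k x) := hk.of_uncurry_left
    -- Hölder is applied to k f = (k^(1/q) w) · (k^(1/p) f / w); the first factor is controlled by
    -- `h1`, the second by `h2` after Tonelli.
    have e1 : ∫⁻ y, k x y * f y ∂μ
        = ∫⁻ y, ((fun y => k x y ^ (1 / q) * w y) * fun y => k x y ^ (1 / p) * (f y * (w y)⁻¹)) y ∂μ := by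
      refine lintegral_congr_ae ?_
      filter_upwards [hw0, hwt] with y hy0 hyt
      have : k x y = k x y ^ (1 / q) * k x y ^ (1 / p) := by
        rw [← ENNReal.rpow_add_of_nonneg _ _ (by positivity) (by positivity), one_div, one_div,
          hpq.symm.inv_add_inv_eq_one, ENNReal.rpow_one]
      simp only [Pi.mul_apply]
      calc k x y * f y = (k x y ^ (1 / q) * k x y ^ (1 / p)) * (f y * (w y * (w y)⁻¹)) := by
            rw [← this, ENNReal.mul_inv_cancel hy0 hyt, mul_one]
        _ = _ := by ring
    have e2 := ENNReal.lintegral_mul_le_Lp_mul_Lq μ hpq.symm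
      (f := fun y => k x y ^ (1 / q) * w y) (g := fun y => k x y ^ (1 / p) * (f y * (w y)⁻¹))
      ((hkx.pow_const _).mul hw).aemeasurable
      ((hkx.pow_const _).aemeasurable.mul (hf.mul hw.inv.aemeasurable))
    have e3 : ∫⁻ y, (k x y ^ (1 / q) * w y) ^ q ∂μ = ∫⁻ y, k x y * w y ^ q ∂μ := by
      refine lintegral_congr fun y => ?_
      rw [ENNReal.mul_rpow_of_nonneg _ _ hq.le, ← ENNReal.rpow_mul, one_div_mul_cancel hq.ne',
        ENNReal.rpow_one]
    have e4 : ∫⁻ y, (k x y ^ (1 / p) * (f y * (w y)⁻¹)) ^ p ∂μ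
        = ∫⁻ y, k x y * (f y ^ p * (w y)⁻¹ ^ p) ∂μ := by
      refine lintegral_congr fun y => ?_
      rw [ENNReal.mul_rpow_of_nonneg _ _ hp.le, ENNReal.mul_rpow_of_nonneg _ _ hp.le,
        ← ENNReal.rpow_mul, one_div_mul_cancel hp.ne', ENNReal.rpow_one]
    rw [e1]
    rw [e3, e4] at e2
    calc _ ≤ ((∫⁻ y, k x y * w y ^ q ∂μ) ^ (1 / q)
          * (∫⁻ y, k x y * (f y ^ p * (w y)⁻¹ ^ p) ∂μ) ^ (1 / p)) ^ p := by gcongr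
      _ = (∫⁻ y, k x y * w y ^ q ∂μ) ^ (p / q)
          * ∫⁻ y, k x y * (f y ^ p * (w y)⁻¹ ^ p) ∂μ := by
        rw [ENNReal.mul_rpow_of_nonneg _ _ hp.le, ← ENNReal.rpow_mul, ← ENNReal.rpow_mul,
          one_div_mul_cancel hp.ne', ENNReal.rpow_one, one_div_mul_eq_div]
      _ ≤ (A * w x ^ q) ^ (p / q) * ∫⁻ y, k x y * (f y ^ p * (w y)⁻¹ ^ p) ∂μ := by gcongr
      _ = A ^ (p / q) * (w x ^ p * ∫⁻ y, k x y * (f y ^ p * (w y)⁻¹ ^ p) ∂μ) := by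
        rw [ENNReal.mul_rpow_of_nonneg _ _ (by positivity), ← ENNReal.rpow_mul,
          mul_div_cancel₀ _ hq.ne', mul_assoc]
      _ = _ := by
        have hm : AEMeasurable (fun y => k x y * (f y ^ p * (w y)⁻¹ ^ p)) μ :=
          hkx.aemeasurable.mul ((hf.pow_const _).mul (hw.inv.pow_const _).aemeasurable)
        rw [← lintegral_const_mul'' _ hm]
        simp only [mul_assoc]
  have hjm : AEMeasurable (fun z : α × α => (w z.1 ^ p * k z.1 z.2) * (f z.2 ^ p * (w z.2)⁻¹ ^ p))
      (μ.prod μ) := by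
    refine AEMeasurable.mul ?_ ?_
    · exact (((hw.comp measurable_fst).pow_const p).mul hk).aemeasurable
    · exact (hf.comp_snd.pow_const p).mul ((hw.comp measurable_snd).inv.pow_const p).aemeasurable
  calc ∫⁻ x, (∫⁻ y, k x y * f y ∂μ) ^ p ∂μ
      ≤ ∫⁻ x, A ^ (p / q) * ∫⁻ y, (w x ^ p * k x y) * (f y ^ p * (w y)⁻¹ ^ p) ∂μ ∂μ :=
        lintegral_mono_ae hpt
    _ = A ^ (p / q) * ∫⁻ y, ∫⁻ x, (w x ^ p * k x y) * (f y ^ p * (w y)⁻¹ ^ p) ∂μ ∂μ := by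
        rw [lintegral_const_mul'' _ hjm.lintegral_prod_right', lintegral_lintegral_swap hjm]
    _ ≤ A ^ (p / q) * ∫⁻ y, B * f y ^ p ∂μ := by
        gcongr 1
        refine lintegral_mono_ae ?_
        filter_upwards [h2, hw0, hwt] with y hy hy0 hyt
        have hky : Measurable fun x => k x y := hk.of_uncurry_right
        have hm : Measurable fun x => w x ^ p * k x y := (hw.pow_const _).mul hky
        rw [lintegral_mul_const _ hm]
        calc (∫⁻ x, w x ^ p * k x y ∂μ) * (f y ^ p * (w y)⁻¹ ^ p)
            = (∫⁻ x, k x y * w x ^ p ∂μ) * (f y ^ p * (w y)⁻¹ ^ p) := by simp only [mul_comm]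
          _ ≤ (B * w y ^ p) * (f y ^ p * (w y)⁻¹ ^ p) := by gcongr
          _ = B * f y ^ p * (w y * (w y)⁻¹) ^ p := by
            rw [ENNReal.mul_rpow_of_nonneg _ _ hp.le]; ring
          _ = B * f y ^ p := by rw [ENNReal.mul_inv_cancel hy0 hyt, ENNReal.one_rpow, mul_one]
    _ = _ := by rw [lintegral_const_mul'' _ (hf.pow_const p), mul_assoc]

/-! ### Poisson and conjugate Poisson kernels. -/

/-- The Poisson kernel of the half-plane, up to the factor `1 / π`. -/
def poisson (ε x : ℝ) : ℝ := ε / (x ^ 2 + ε ^ 2)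

/-- The conjugate Poisson kernel of the half-plane, up to the factor `1 / π`. -/
def conjPoisson (ε x : ℝ) : ℝ := x / (x ^ 2 + ε ^ 2)

theorem sq_add_sq_pos {ε : ℝ} (hε : 0 < ε) (x : ℝ) : 0 < x ^ 2 + ε ^ 2 := by positivity

theorem continuous_poisson {ε : ℝ} (hε : 0 < ε) : Continuous (poisson ε) := by
  unfold poisson
  exact continuous_const.div (by fun_prop) fun x => (sq_add_sq_pos hε x).ne'

theorem continuous_conjPoisson {ε : ℝ} (hε : 0 < ε) : Continuous (conjPoisson ε) := by
  unfold conjPoisson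
  exact continuous_id.div (by fun_prop) fun x => (sq_add_sq_pos hε x).ne'

theorem poisson_nonneg {ε : ℝ} (hε : 0 < ε) (x : ℝ) : 0 ≤ poisson ε x := by
  unfold poisson; positivity

theorem poisson_eq {ε : ℝ} (hε : 0 < ε) (x : ℝ) : poisson ε x = ε⁻¹ * (1 + (x / ε) ^ 2)⁻¹ := by
  unfold poisson
  have := sq_add_sq_pos hε x
  field_simp
  ring

theorem integrable_poisson {ε : ℝ} (hε : 0 < ε) : Integrable (poisson ε) := by
  have := (integrable_inv_one_add_sq.comp_div hε.ne').const_mul ε⁻¹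
  exact this.congr (Eventually.of_forall fun x => (poisson_eq hε x).symm)

theorem integral_poisson {ε : ℝ} (hε : 0 < ε) : ∫ x, poisson ε x = Real.pi := by
  simp_rw [poisson_eq hε]
  rw [integral_const_mul, Measure.integral_comp_div (fun x => (1 + x ^ 2)⁻¹), abs_of_pos hε,
    integral_univ_inv_one_add_sq, smul_eq_mul, inv_mul_cancel_left₀ hε.ne']

theorem lintegral_poisson {ε : ℝ} (hε : 0 < ε) :
    ∫⁻ x, ENNReal.ofReal (poisson ε x) = ENNReal.ofReal Real.pi := by
  rw [← integral_poisson hε, ofReal_integral_eq_lintegral_ofReal (integrable_poisson hε)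
    (Eventually.of_forall (poisson_nonneg hε))]

/-- Young's inequality for a kernel of mass π, read off from Schur's test with the weight 1. The
constant does not depend on ε. -/
theorem lintegral_poisson_conv_rpow_le {p : ℝ} (hp : 1 < p) {ε : ℝ} (hε : 0 < ε)
    {f : ℝ → ℝ≥0∞} (hf : AEMeasurable f) :
    ∫⁻ x, (∫⁻ y, ENNReal.ofReal (poisson ε (x - y)) * f y) ^ p
      ≤ ENNReal.ofReal Real.pi ^ p * ∫⁻ x, f x ^ p := by
  have hpq := Real.HolderConjugate.conjExponent hp
  have := lintegral_rpow_le_of_schur (μ := volume) hpq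
    (k := fun x y => ENNReal.ofReal (poisson ε (x - y))) (w := fun _ => 1)
    (A := ENNReal.ofReal Real.pi) (B := ENNReal.ofReal Real.pi)
    (by
      have := continuous_poisson hε
      exact (ENNReal.continuous_ofReal.comp
        (by fun_prop : Continuous fun z : ℝ × ℝ => poisson ε (z.1 - z.2))).measurable)
    measurable_const (Eventually.of_forall fun x => one_ne_zero)
    (Eventually.of_forall fun x => ENNReal.one_ne_top)
    (Eventually.of_forall fun x => by
      simp only [ENNReal.one_rpow, mul_one]
      rw [lintegral_sub_left_eq_self (fun y => ENNReal.ofReal (poisson ε y)) x, lintegral_poisson hε])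
    (Eventually.of_forall fun y => by
      simp only [ENNReal.one_rpow, mul_one]
      rw [lintegral_sub_right_eq_self (fun y => ENNReal.ofReal (poisson ε y)) y, lintegral_poisson hε])
    hf
  -- Schur's constant π^(p/q) π is π^p, since p/q + 1 = p.
  refine this.trans_eq ?_
  congr 1
  nth_rewrite 2 [← ENNReal.rpow_one (ENNReal.ofReal Real.pi)]
  rw [← ENNReal.rpow_add_of_nonneg _ _ (div_nonneg hpq.nonneg hpq.symm.nonneg) zero_le_one]
  congr 1
  have := hpq.pos
  have := hpq.symm.pos
  have := hpq.inv_add_inv_eq_one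
  field_simp at this ⊢
  linarith

/-! ### The L^p bound for the Hilbert transform, by powers of the Cauchy integral. -/

/-- The trigonometric inequality behind the `L^p` bound for the Hilbert transform. -/
theorem exists_abs_sin_rpow_le {p : ℝ} (hp1 : 1 < p) (hp3 : p < 3) :
    ∃ A B : ℝ, 0 ≤ A ∧ ∀ θ : ℝ, |θ| ≤ Real.pi / 2 →
      |Real.sin θ| ^ p ≤ A * Real.cos θ ^ p - B * Real.cos (p * θ) := by
  have hpi := Real.pi_pos
  -- The range of p enters here: 1 < p < 3 puts pπ/2 strictly between π/2 and 3π/2.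
  have hc0 : Real.cos (p * (Real.pi / 2)) < 0 :=
    Real.cos_neg_of_pi_div_two_lt_of_lt (by nlinarith) (by nlinarith)
  set c := -Real.cos (p * (Real.pi / 2)) with hc
  have hcp : 0 < c := by rw [hc]; linarith
  have hev : ∀ᶠ θ in 𝓝 (Real.pi / 2), Real.cos (p * θ) < -(c / 2) := by
    have : Continuous fun θ => Real.cos (p * θ) := by fun_prop
    exact this.continuousAt.eventually_lt continuousAt_const (by simp only [hc]; linarith)
  obtain ⟨δ, hδ, hδ'⟩ := Metric.eventually_nhds_iff.mp hev
  set δ' := min (δ / 2) (Real.pi / 4)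
  have hδ'0 : 0 < δ' := by positivity
  have hδ'1 : δ' ≤ Real.pi / 4 := min_le_right _ _
  have hδ'2 : δ' < δ := (min_le_left _ _).trans_lt (by linarith)
  set m := Real.cos (Real.pi / 2 - δ')
  have hm : 0 < m := Real.cos_pos_of_mem_Ioo ⟨by linarith, by linarith⟩
  refine ⟨(1 + 2 / c) / m ^ p, 2 / c, by positivity, fun θ hθ => ?_⟩
  have hs : |Real.sin θ| ^ p ≤ 1 :=
    Real.rpow_le_one (abs_nonneg _) (Real.abs_sin_le_one θ) (by linarith)
  rw [← Real.cos_abs θ, ← Real.cos_abs (p * θ), abs_mul, abs_of_pos (by linarith : 0 < p)]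
  have hcos : 0 ≤ Real.cos |θ| :=
    Real.cos_nonneg_of_mem_Icc ⟨by linarith [abs_nonneg θ], hθ⟩
  -- Away from ±π/2 the cosine is at least m, and A is chosen to pay for both the bound 1 of the
  -- sine and the largest value 2/c of B cos(pθ). Near ±π/2, cos(pθ) is below -c/2 and the B term
  -- alone contributes at least 1.
  rcases le_total |θ| (Real.pi / 2 - δ') with h | h
  · have h1 : m ≤ Real.cos |θ| :=
      Real.cos_le_cos_of_nonneg_of_le_pi (abs_nonneg _) (by linarith) h
    have h2 : m ^ p ≤ Real.cos |θ| ^ p := Real.rpow_le_rpow hm.le h1 (by linarith)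
    have h3 : 1 + 2 / c ≤ (1 + 2 / c) / m ^ p * Real.cos |θ| ^ p := by
      rw [div_mul_eq_mul_div, le_div_iff₀ (by positivity)]
      gcongr
    have h4 : 2 / c * Real.cos (p * |θ|) ≤ 2 / c * 1 := by
      gcongr; exact Real.cos_le_one _
    linarith
  · have h1 : Real.cos (p * |θ|) < -(c / 2) := by
      apply hδ'
      rw [Real.dist_eq, abs_lt]; constructor <;> linarith
    have h2 : 1 ≤ -(2 / c * Real.cos (p * |θ|)) := by
      rw [← mul_neg]
      calc (1:ℝ) = 2 / c * (c / 2) := by field_simp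
        _ ≤ _ := by gcongr; linarith
    have h3 : 0 ≤ (1 + 2 / c) / m ^ p * Real.cos |θ| ^ p := by positivity
    linarith

/-- Every term is homogeneous of degree p in |w|, so only the argument matters, and it lies in
[-π/2, π/2] for w in the right half-plane. -/
theorem exists_abs_im_rpow_le {p : ℝ} (hp1 : 1 < p) (hp3 : p < 3) :
    ∃ A B : ℝ, 0 ≤ A ∧ ∀ w : ℂ, 0 < w.re →
      |w.im| ^ p ≤ A * w.re ^ p - B * (w ^ (p : ℂ)).re := by
  obtain ⟨A, B, hA, h⟩ := exists_abs_sin_rpow_le hp1 hp3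
  refine ⟨A, B, hA, fun w hw => ?_⟩
  have hw0 : w ≠ 0 := by rintro rfl; simp at hw
  have harg : |w.arg| ≤ Real.pi / 2 := Complex.abs_arg_le_pi_div_two_iff.mpr hw.le
  have hn : 0 < ‖w‖ := norm_pos_iff.mpr hw0
  have hcos : 0 ≤ Real.cos w.arg := Real.cos_nonneg_of_mem_Icc (abs_le.mp harg)
  have hre : w.re = ‖w‖ * Real.cos w.arg := (Complex.norm_mul_cos_arg w).symm
  have him : w.im = ‖w‖ * Real.sin w.arg := (Complex.norm_mul_sin_arg w).symm
  have hpow : (w ^ (p : ℂ)).re = ‖w‖ ^ p * Real.cos (p * w.arg) := by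
    rw [Complex.cpow_def_of_ne_zero hw0]
    have : Complex.log w * p = ((Real.log ‖w‖ * p : ℝ) : ℂ) + ((p * w.arg : ℝ) : ℂ) * Complex.I := by
      rw [Complex.log]; push_cast; ring
    rw [this, Complex.exp_add, ← Complex.ofReal_exp, Complex.re_ofReal_mul,
      Complex.exp_ofReal_mul_I_re, Real.rpow_def_of_pos hn]
  rw [him, hpow, hre, abs_mul, abs_of_pos hn, Real.mul_rpow hn.le (abs_nonneg _),
    Real.mul_rpow hn.le hcos]
  have := h _ harg
  have h2 : 0 ≤ ‖w‖ ^ p := by positivity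
  nlinarith

/-- The integral over a horizontal line of a decaying holomorphic function of the upper half-plane
vanishes. -/
theorem integral_horizontal_eq_zero {Φ : ℂ → ℂ} (hd : ∀ z : ℂ, 0 < z.im → DifferentiableAt ℂ Φ z)
    {p : ℝ} (hp : 1 < p)
    (hb : ∀ y₀ : ℝ, 0 < y₀ → ∃ K : ℝ, ∀ z : ℂ, y₀ ≤ z.im → ‖Φ z‖ ≤ K * (1 + |z.re|) ^ (-p))
    (h0 : ∀ x : ℝ, Tendsto (fun Y : ℝ => Φ (x + Y * Complex.I)) atTop (𝓝 0))
    {ε : ℝ} (hε : 0 < ε) : ∫ x : ℝ, Φ (x + ε * Complex.I) = 0 := by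
  have hdec : Integrable (fun x : ℝ => (1 + |x|) ^ (-p)) := by
    have := integrable_one_add_norm (E := ℝ) (μ := volume) (r := p) (by simpa using hp)
    simpa using this
  have hcont : ∀ y : ℝ, 0 < y → Continuous fun x : ℝ => Φ (x + y * Complex.I) := by
    intro y hy
    rw [continuous_iff_continuousAt]
    intro x
    have h1 : ContinuousAt Φ (x + y * Complex.I) := (hd _ (by simpa using hy)).continuousAt
    exact ContinuousAt.comp (f := fun x : ℝ => (x + y * Complex.I : ℂ)) h1
      (by fun_prop)
  have hint : ∀ y : ℝ, 0 < y → Integrable fun x : ℝ => Φ (x + y * Complex.I) := by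
    intro y hy
    obtain ⟨K, hK⟩ := hb y hy
    refine (hdec.const_mul K).mono' (hcont y hy).aestronglyMeasurable (Eventually.of_forall fun x => ?_)
    have := hK (x + y * Complex.I) (by simp)
    simpa using this
  -- Cauchy's theorem on rectangles of half-width T: the vertical sides are O(T^(-p)), so the
  -- horizontal integral does not depend on the height. It is then sent to height infinity by
  -- dominated convergence.
  have heq : ∀ Y : ℝ, ε < Y →
      ∫ x : ℝ, Φ (x + ε * Complex.I) = ∫ x : ℝ, Φ (x + Y * Complex.I) := by
    intro Y hY
    have t1 : ∀ y : ℝ, 0 < y → Tendsto (fun T : ℝ => ∫ x in (-T)..T, Φ (x + y * Complex.I)) atTop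
        (𝓝 (∫ x : ℝ, Φ (x + y * Complex.I))) := fun y hy =>
      intervalIntegral_tendsto_integral (hint y hy) tendsto_neg_atTop_atBot tendsto_id
    obtain ⟨K, hK⟩ := hb ε hε
    have t3 : Tendsto (fun T : ℝ => K * (1 + T) ^ (-p) * |Y - ε|) atTop (𝓝 0) := by
      have h1 : Tendsto (fun T : ℝ => (1 + T) ^ (-p)) atTop (𝓝 0) :=
        (tendsto_rpow_neg_atTop (by linarith)).comp (tendsto_atTop_add_const_left _ 1 tendsto_id)
      simpa using (h1.const_mul K).mul_const |Y - ε|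
    have t2 : ∀ s : ℝ, |s| = 1 → Tendsto (fun T : ℝ => ∫ y in ε..Y, Φ ((s * T : ℝ) + y * Complex.I)) atTop (𝓝 0) := by
      intro s hs
      refine squeeze_zero_norm' ?_ t3
      filter_upwards [eventually_ge_atTop 0] with T hT
      refine intervalIntegral.norm_integral_le_of_norm_le_const fun y hy => ?_
      rw [uIoc_of_le hY.le] at hy
      have := hK ((s * T : ℝ) + y * Complex.I) (by simpa using hy.1.le)
      simpa [abs_mul, hs, abs_of_nonneg hT] using this
    have hrect : ∀ T : ℝ, 
        (∫ x in (-T)..T, Φ (x + ε * Complex.I)) - (∫ x in (-T)..T, Φ (x + Y * Complex.I))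
        = Complex.I * (∫ y in ε..Y, Φ (((-1) * T : ℝ) + y * Complex.I))
          - Complex.I * ∫ y in ε..Y, Φ ((1 * T : ℝ) + y * Complex.I) := by
      intro T
      have := Complex.integral_boundary_rect_eq_zero_of_differentiableOn Φ
        ((-T : ℝ) + ε * Complex.I) (T + Y * Complex.I) (by
          intro z hz
          refine (hd z ?_).differentiableWithinAt
          have h2 : z.im ∈ uIcc ε Y := by simpa using hz.2
          rw [uIcc_of_le hY.le] at h2
          exact lt_of_lt_of_le hε h2.1)
      simp at this
      simp
      linear_combination this
    have e1 := ((t1 ε hε).sub (t1 Y (hε.trans hY)))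
    have e2 := ((t2 (-1) (by simp)).const_mul Complex.I).sub ((t2 1 (by simp)).const_mul Complex.I)
    rw [mul_zero, sub_zero] at e2
    rw [funext hrect] at e1
    exact sub_eq_zero.mp (tendsto_nhds_unique e1 e2)
  have hlim : Tendsto (fun Y : ℝ => ∫ x : ℝ, Φ (x + Y * Complex.I)) atTop (𝓝 (∫ x : ℝ, (0:ℂ))) := by
    obtain ⟨K, hK⟩ := hb 1 one_pos
    refine tendsto_integral_filter_of_dominated_convergence (fun x => K * (1 + |x|) ^ (-p)) ?_ ?_ ?_ ?_
    · filter_upwards [eventually_gt_atTop 0] with Y hY using (hcont Y hY).aestronglyMeasurable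
    · filter_upwards [eventually_ge_atTop 1] with Y hY
      refine Eventually.of_forall fun x => ?_
      have := hK (x + Y * Complex.I) (by simpa using hY)
      simpa using this
    · exact hdec.const_mul K
    · exact Eventually.of_forall h0
  rw [integral_zero] at hlim
  refine tendsto_nhds_unique (tendsto_const_nhds.congr' ?_) hlim
  filter_upwards [eventually_gt_atTop ε] with Y hY using heq Y hY

/-- The Cauchy integral of a function on the line. -/
def cauchyIntegral (f : ℝ → ℝ) (z : ℂ) : ℂ := ∫ s, Complex.I / (z - s) * f s

section Cauchy

variable {f : ℝ → ℝ}

theorem im_le_norm_sub (z : ℂ) (s : ℝ) : z.im ≤ ‖z - s‖ := by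
  have := Complex.abs_im_le_norm (z - s)
  simp at this
  exact (le_abs_self _).trans this

theorem sub_ofReal_ne_zero {z : ℂ} (hz : 0 < z.im) (s : ℝ) : z - s ≠ 0 := by
  intro h
  have := im_le_norm_sub z s
  rw [h, norm_zero] at this; linarith

theorem norm_cauchyKernel_le {z : ℂ} (hz : 0 < z.im) (s : ℝ) : ‖Complex.I / (z - s)‖ ≤ 1 / z.im := by
  rw [norm_div, Complex.norm_I]
  exact one_div_le_one_div_of_le hz (im_le_norm_sub z s)

theorem continuous_cauchyKernel {z : ℂ} (hz : 0 < z.im) :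
    Continuous fun s : ℝ => Complex.I / (z - s) :=
  continuous_const.div (by fun_prop) (sub_ofReal_ne_zero hz)

theorem integrable_cauchyKernel_mul (hf : Integrable f) {z : ℂ} (hz : 0 < z.im) :
    Integrable fun s : ℝ => Complex.I / (z - s) * (f s : ℂ) :=
  hf.ofReal.bdd_mul (c := 1 / z.im) (continuous_cauchyKernel hz).aestronglyMeasurable
    (Eventually.of_forall (norm_cauchyKernel_le hz))

/-- The factor i makes the real part the Poisson kernel and the imaginary part the conjugate one:
the first is positive, and the second is the one to be bounded. -/
theorem cauchyKernel_re_im (x s : ℝ) {y : ℝ} (hy : 0 < y) :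
    Complex.I / ((x + y * Complex.I : ℂ) - s) = (poisson y (x - s) : ℂ) + conjPoisson y (x - s) * Complex.I := by
  have h1 : (x + y * Complex.I : ℂ) - s ≠ 0 := sub_ofReal_ne_zero (by simpa using hy) s
  have h2 := sq_add_sq_pos hy (x - s)
  have h3 : (((x - s) ^ 2 + y ^ 2 : ℝ) : ℂ) ≠ 0 := by exact_mod_cast h2.ne'
  rw [div_eq_iff h1, poisson, conjPoisson]
  push_cast at h3 ⊢
  field_simp
  ring_nf
  simp only [Complex.I_sq]
  ring

theorem integrable_poisson_mul (hf : Integrable f) (x : ℝ) {y : ℝ} (hy : 0 < y) :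
    Integrable fun s => poisson y (x - s) * f s := by
  refine (integrable_cauchyKernel_mul hf (z := x + y * Complex.I) (by simpa using hy)).re.congr
    (Eventually.of_forall fun s => ?_)
  simp only
  rw [cauchyKernel_re_im x s hy]; simp

theorem integrable_conjPoisson_mul (hf : Integrable f) (x : ℝ) {y : ℝ} (hy : 0 < y) :
    Integrable fun s => conjPoisson y (x - s) * f s := by
  refine (integrable_cauchyKernel_mul hf (z := x + y * Complex.I) (by simpa using hy)).im.congr
    (Eventually.of_forall fun s => ?_)
  simp only
  rw [cauchyKernel_re_im x s hy]; simp

theorem cauchyIntegral_eq (hf : Integrable f) (x : ℝ) {y : ℝ} (hy : 0 < y) :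
    cauchyIntegral f (x + y * Complex.I) = ((∫ s, poisson y (x - s) * f s : ℝ) : ℂ)
      + ((∫ s, conjPoisson y (x - s) * f s : ℝ) : ℂ) * Complex.I := by
  rw [cauchyIntegral, ← integral_complex_ofReal, ← integral_complex_ofReal, ← integral_mul_const,
    ← integral_add (integrable_poisson_mul hf x hy).ofReal
      ((integrable_conjPoisson_mul hf x hy).ofReal.mul_const _)]
  refine integral_congr_ae (Eventually.of_forall fun s => ?_)
  simp only
  rw [cauchyKernel_re_im x s hy]; push_cast; ring

/-- Strict positivity keeps the Cauchy integral off the branch cut, which makes its p-th power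
holomorphic. -/
theorem cauchyIntegral_re_pos (hf : Integrable f) (hf0 : ∀ s, 0 ≤ f s) (hpos : 0 < ∫ s, f s) {z : ℂ}
    (hz : 0 < z.im) : 0 < (cauchyIntegral f z).re := by
  have h := cauchyIntegral_eq hf z.re hz
  rw [Complex.re_add_im] at h
  rw [h]
  simp only [Complex.add_re, Complex.ofReal_re, Complex.mul_re, Complex.I_re, mul_zero,
    Complex.ofReal_im, Complex.I_im, mul_one, sub_self, add_zero]
  have hp : ∀ x, 0 < poisson z.im x := fun x => by unfold poisson; positivity
  rw [integral_pos_iff_support_of_nonneg (fun s => mul_nonneg (hp _).le (hf0 s))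
    (integrable_poisson_mul hf _ hz)]
  rw [integral_pos_iff_support_of_nonneg hf0 hf] at hpos
  convert hpos using 2
  ext s
  simp [(hp _).ne']

theorem norm_cauchyIntegral_le (hf : Integrable f) {z : ℂ} {a : ℝ}
    (ha : ∀ s, f s ≠ 0 → ‖Complex.I / (z - s)‖ ≤ a) :
    ‖cauchyIntegral f z‖ ≤ a * ∫ s, ‖f s‖ := by
  rw [cauchyIntegral, ← integral_const_mul]
  refine norm_integral_le_of_norm_le (hf.norm.const_mul a) (Eventually.of_forall fun s => ?_)
  rw [norm_mul, Complex.norm_real]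
  by_cases h : f s = 0
  · simp [h]
  · gcongr; exact ha s h

theorem differentiableAt_cauchyIntegral (hf : Integrable f) {z : ℂ} (hz : 0 < z.im) :
    DifferentiableAt ℂ (cauchyIntegral f) z := by
  have hnhds : {w : ℂ | z.im / 2 < w.im} ∈ 𝓝 z :=
    (isOpen_lt continuous_const Complex.continuous_im).mem_nhds (by simp only [mem_ofPred_eq]; linarith)
  have hpos : ∀ w ∈ {w : ℂ | z.im / 2 < w.im}, 0 < w.im := fun w hw => by
    simp only [mem_ofPred_eq] at hw; linarith
  have := hasDerivAt_integral_of_dominated_loc_of_deriv_le (𝕜 := ℂ) (μ := volume)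
    (F := fun (w : ℂ) (s : ℝ) => Complex.I / (w - s) * (f s : ℂ))
    (F' := fun (w : ℂ) (s : ℝ) => -Complex.I / (w - s) ^ 2 * (f s : ℂ)) (x₀ := z)
    (bound := fun s => (z.im / 2)⁻¹ ^ 2 * ‖f s‖) hnhds ?_ ?_ ?_ ?_ ?_ ?_
  · exact this.2.differentiableAt
  · filter_upwards [hnhds] with w hw using (integrable_cauchyKernel_mul hf (hpos w hw)).1
  · exact integrable_cauchyKernel_mul hf hz
  · refine AEStronglyMeasurable.mul ?_ hf.ofReal.1
    exact (continuous_const.div (by fun_prop)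
      fun s => pow_ne_zero 2 (sub_ofReal_ne_zero hz s)).aestronglyMeasurable
  · refine Eventually.of_forall fun s w hw => ?_
    rw [norm_mul, norm_div, norm_neg, Complex.norm_I, norm_pow, Complex.norm_real, inv_pow, ← one_div]
    have h1 : z.im / 2 ≤ ‖w - s‖ := (le_of_lt hw).trans (im_le_norm_sub w s)
    gcongr
  · exact hf.norm.const_mul _
  · refine Eventually.of_forall fun s w hw => ?_
    have h := sub_ofReal_ne_zero (hpos w hw) s
    have h2 : HasDerivAt (fun w : ℂ => Complex.I * (w - s)⁻¹ * (f s : ℂ))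
        (Complex.I * (-1 / (w - s) ^ 2) * (f s : ℂ)) w :=
      ((((hasDerivAt_id w).sub_const (s : ℂ)).inv h).const_mul Complex.I).mul_const (f s : ℂ)
    have h3 : -Complex.I / (w - s) ^ 2 * (f s : ℂ) = Complex.I * (-1 / (w - s) ^ 2) * (f s : ℂ) := by ring
    rw [h3]
    exact h2

end Cauchy

/-- For a source in a bounded interval the Cauchy integral decays like 1/(1+|x|), uniformly above
height y₀. Its p-th power is then integrable on horizontal lines because p > 1. -/
theorem norm_cauchyKernel_le_of_abs_le {R y₀ : ℝ} (hR : 0 ≤ R) (hy₀ : 0 < y₀) {z : ℂ} (hz : y₀ ≤ z.im)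
    {s : ℝ} (hs : |s| ≤ R) : ‖Complex.I / (z - s)‖ ≤ ((1 + R) / y₀ + 1) * (1 + |z.re|)⁻¹ := by
  have h1 : y₀ ≤ ‖z - s‖ := hz.trans (im_le_norm_sub z s)
  have h2 : |z.re - s| ≤ ‖z - s‖ := by
    have := Complex.abs_re_le_norm (z - s)
    simpa using this
  have h3 : 0 < ‖z - s‖ := hy₀.trans_le h1
  have h4 : |z.re| ≤ |z.re - s| + |s| := by
    have := abs_add_le (z.re - s) s
    simpa using this
  rw [norm_div, Complex.norm_I, ← div_eq_mul_inv, div_le_div_iff₀ h3 (by positivity), one_mul, add_mul,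
    one_mul]
  have h5 : 1 + R ≤ (1 + R) / y₀ * ‖z - s‖ := by
    rw [div_mul_eq_mul_div, le_div_iff₀ hy₀]
    gcongr
  linarith

/-- The `L^p` bound for the Hilbert transform of nonnegative functions, regularized by the
conjugate Poisson kernel. -/
theorem exists_lintegral_conjPoisson_le {p : ℝ} (hp1 : 1 < p) (hp3 : p < 3) :
    ∃ C : ℝ≥0∞, C ≠ ⊤ ∧ ∀ ε : ℝ, 0 < ε → ∀ (f : ℝ → ℝ) (R : ℝ), Integrable f → (∀ s, 0 ≤ f s) →
      (∀ s, R < |s| → f s = 0) →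
      ∫⁻ x, ENNReal.ofReal (|∫ s, conjPoisson ε (x - s) * f s| ^ p)
        ≤ C * ∫⁻ x, ENNReal.ofReal (f x) ^ p := by
  obtain ⟨A, B, hA, hAB⟩ := exists_abs_im_rpow_le hp1 hp3
  refine ⟨ENNReal.ofReal A * ENNReal.ofReal Real.pi ^ p,
    ENNReal.mul_ne_top ENNReal.ofReal_ne_top
      (ENNReal.rpow_ne_top_of_nonneg (by linarith) ENNReal.ofReal_ne_top), ?_⟩
  intro ε hε f R hf hf0 hR
  have hp0 : 0 < p := by linarith
  -- If `f` vanishes almost everywhere, the Cauchy integral is zero rather than in the open right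
  -- half-plane, so this case is separate.
  rcases (integral_nonneg (f := f) (μ := volume) hf0).eq_or_lt with h0 | hpos
  · have hf' : f =ᵐ[volume] 0 := (integral_eq_zero_iff_of_nonneg hf0 hf).mp h0.symm
    have : ∀ x, ∫ s, conjPoisson ε (x - s) * f s = 0 := by
      intro x
      rw [integral_eq_zero_of_ae]
      filter_upwards [hf'] with s hs
      simp [hs]
    simp [this, Real.zero_rpow hp0.ne']
  set R' := max R 0
  have hR' : ∀ s, f s ≠ 0 → |s| ≤ R' := fun s hs => by
    by_contra h
    exact hs (hR s ((le_max_left _ _).trans_lt (not_le.mp h)))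
  set F := cauchyIntegral f with hF
  set M := ∫ s, ‖f s‖
  have hM : 0 ≤ M := integral_nonneg fun _ => norm_nonneg _
  have hFre : ∀ z : ℂ, 0 < z.im → 0 < (F z).re := fun z hz => cauchyIntegral_re_pos hf hf0 hpos hz
  have hFb : ∀ y₀ : ℝ, 0 < y₀ → ∀ z : ℂ, y₀ ≤ z.im →
      ‖F z‖ ^ p ≤ (((1 + R') / y₀ + 1) * M) ^ p * (1 + |z.re|) ^ (-p) := by
    intro y₀ hy₀ z hz
    have hR0 : 0 ≤ R' := le_max_right _ _
    have := norm_cauchyIntegral_le hf fun s hs =>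
      norm_cauchyKernel_le_of_abs_le hR0 hy₀ hz (hR' s hs)
    rw [Real.rpow_neg (by positivity), ← Real.inv_rpow (by positivity),
      ← Real.mul_rpow (by positivity) (by positivity)]
    refine Real.rpow_le_rpow (norm_nonneg _) (this.trans_eq ?_) hp0.le
    ring
  have hFd : ∀ z : ℂ, 0 < z.im → DifferentiableAt ℂ F z := fun z hz =>
    differentiableAt_cauchyIntegral hf hz
  have hint0 : ∫ x : ℝ, (F (x + ε * Complex.I)) ^ (p : ℂ) = 0 := by
    refine integral_horizontal_eq_zero (Φ := fun z => F z ^ (p : ℂ)) ?_ hp1 ?_ ?_ hε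
    · intro z hz
      exact (hFd z hz).cpow_const (Or.inl (hFre z hz))
    · intro y₀ hy₀
      refine ⟨(((1 + R') / y₀ + 1) * M) ^ p, fun z hz => ?_⟩
      rw [Complex.norm_cpow_real]
      exact hFb y₀ hy₀ z hz
    · intro x
      rw [tendsto_zero_iff_norm_tendsto_zero]
      simp_rw [Complex.norm_cpow_real]
      have h1 : Tendsto (fun Y : ℝ => ‖F (x + Y * Complex.I)‖) atTop (𝓝 0) := by
        refine squeeze_zero' (Eventually.of_forall fun _ => norm_nonneg _) (g := fun Y => 1 / Y * M) ?_ ?_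
        · filter_upwards [eventually_gt_atTop 0] with Y hY
          refine norm_cauchyIntegral_le hf fun s _ => ?_
          have := norm_cauchyKernel_le (z := x + Y * Complex.I) (by simpa using hY) s
          simpa using this
        · simpa using (tendsto_inv_atTop_zero (𝕜 := ℝ)).mul_const M
      have := h1.rpow_const (p := p) (Or.inr hp0.le)
      rwa [Real.zero_rpow hp0.ne'] at this
  have hcont : Continuous fun x : ℝ => F (x + ε * Complex.I) := by
    rw [continuous_iff_continuousAt]
    intro x
    exact ContinuousAt.comp (f := fun x : ℝ => (x + ε * Complex.I : ℂ))
      (hFd _ (by simpa using hε)).continuousAt (by fun_prop)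
  have hdec : Integrable (fun x : ℝ => (((1 + R') / ε + 1) * M) ^ p * (1 + |x|) ^ (-p)) := by
    have := integrable_one_add_norm (E := ℝ) (μ := volume) (r := p) (by simpa using hp1)
    exact (by simpa using this : Integrable fun x : ℝ => (1 + |x|) ^ (-p)).const_mul _
  have hbd : ∀ x : ℝ, ‖F (x + ε * Complex.I)‖ ^ p ≤ (((1 + R') / ε + 1) * M) ^ p * (1 + |x|) ^ (-p) := by
    intro x
    have := hFb ε hε (x + ε * Complex.I) (by simp)
    simpa using this
  have i1 : Integrable fun x : ℝ => |(F (x + ε * Complex.I)).im| ^ p := by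
    refine hdec.mono' ?_ (Eventually.of_forall fun x => ?_)
    · exact (((Complex.continuous_im.comp hcont).abs).rpow_const fun _ => Or.inr hp0.le).aestronglyMeasurable
    · rw [Real.norm_of_nonneg (by positivity)]
      exact (Real.rpow_le_rpow (abs_nonneg _) (Complex.abs_im_le_norm _) hp0.le).trans (hbd x)
  have i2 : Integrable fun x : ℝ => (F (x + ε * Complex.I)).re ^ p := by
    refine hdec.mono' ?_ (Eventually.of_forall fun x => ?_)
    · exact ((Complex.continuous_re.comp hcont).rpow_const fun _ => Or.inr hp0.le).aestronglyMeasurable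
    · have h1 := hFre (x + ε * Complex.I) (by simpa using hε)
      rw [Real.norm_of_nonneg (by positivity)]
      exact (Real.rpow_le_rpow h1.le (Complex.re_le_norm _) hp0.le).trans (hbd x)
  have i3 : Integrable fun x : ℝ => (F (x + ε * Complex.I)) ^ (p : ℂ) := by
    refine hdec.mono' ?_ (Eventually.of_forall fun x => ?_)
    · refine Continuous.aestronglyMeasurable ?_
      exact hcont.cpow continuous_const fun x => Or.inl (hFre _ (by simpa using hε))
    · rw [Complex.norm_cpow_real]
      exact hbd x
  -- The B term integrates to zero by `hint0`, so the sign and size of B are irrelevant.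
  have hle : ∫ x : ℝ, |(F (x + ε * Complex.I)).im| ^ p ≤ A * ∫ x : ℝ, (F (x + ε * Complex.I)).re ^ p := by
    have h1 : ∫ x : ℝ, ((F (x + ε * Complex.I)) ^ (p : ℂ)).re = 0 := by
      have := integral_re i3
      simp only [RCLike.re_eq_complex_re] at this
      rw [this, hint0, Complex.zero_re]
    calc ∫ x : ℝ, |(F (x + ε * Complex.I)).im| ^ p
        ≤ ∫ x : ℝ, (A * (F (x + ε * Complex.I)).re ^ p - B * ((F (x + ε * Complex.I)) ^ (p : ℂ)).re) :=
          integral_mono i1 ((i2.const_mul A).sub (i3.re.const_mul B))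
            fun x => hAB _ (hFre _ (by simpa using hε))
      _ = _ := by
        have i4 : Integrable fun x : ℝ => ((F (x + ε * Complex.I)) ^ (p : ℂ)).re := i3.re
        rw [integral_sub (i2.const_mul A) (i4.const_mul B), integral_const_mul, integral_const_mul,
          h1, mul_zero, sub_zero]
  have him : ∀ x : ℝ, (F (x + ε * Complex.I)).im = ∫ s, conjPoisson ε (x - s) * f s := fun x => by
    rw [hF, cauchyIntegral_eq hf x hε]; simp
  have hre : ∀ x : ℝ, (F (x + ε * Complex.I)).re = ∫ s, poisson ε (x - s) * f s := fun x => by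
    rw [hF, cauchyIntegral_eq hf x hε]; simp
  have hnn : ∀ x : ℝ, 0 ≤ (F (x + ε * Complex.I)).re := fun x => (hFre _ (by simpa using hε)).le
  simp only [him] at hle i1
  rw [← ofReal_integral_eq_lintegral_ofReal i1 (Eventually.of_forall fun x => by positivity)]
  refine (ENNReal.ofReal_le_ofReal hle).trans ?_
  rw [ENNReal.ofReal_mul hA, ofReal_integral_eq_lintegral_ofReal i2
    (Eventually.of_forall fun x => Real.rpow_nonneg (hnn x) _), mul_assoc]
  gcongr
  refine le_trans (le_of_eq ?_) (lintegral_poisson_conv_rpow_le hp1 hε hf.1.aemeasurable.ennreal_ofReal)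
  refine lintegral_congr fun x => ?_
  rw [← ENNReal.ofReal_rpow_of_nonneg (hnn x) hp0.le, hre, ofReal_integral_eq_lintegral_ofReal
    (integrable_poisson_mul hf x hε) (Eventually.of_forall fun s => mul_nonneg (poisson_nonneg hε _) (hf0 s))]
  congr 1
  refine lintegral_congr fun s => ?_
  rw [ENNReal.ofReal_mul (poisson_nonneg hε _)]

theorem abs_conjPoisson_le {ε : ℝ} (hε : 0 < ε) (x : ℝ) :
    |conjPoisson ε x| ≤ (1 + 1 / ε) * (1 + |x|)⁻¹ := by
  have h := sq_add_sq_pos hε x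
  rw [conjPoisson, abs_div, abs_of_pos h, ← div_eq_mul_inv, div_le_div_iff₀ h (by positivity)]
  have h1 : 0 ≤ |x| := abs_nonneg x
  rw [← sq_abs x]
  set a := |x|
  have h2 : a ≤ 1 / ε * (a ^ 2 + ε ^ 2) := by
    rw [div_mul_eq_mul_div, le_div_iff₀ hε]
    nlinarith [sq_nonneg (a - ε)]
  nlinarith [sq_nonneg ε]

/-- The kernel decays only like 1/|x|, so q = 1 is excluded. The exponent conjugate to p is allowed,
and convolution with L^p functions converges absolutely. -/
theorem memLp_conjPoisson {ε : ℝ} (hε : 0 < ε) {q : ℝ} (hq : 1 < q) :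
    MemLp (conjPoisson ε) (ENNReal.ofReal q) := by
  have h1 : MemLp (fun x : ℝ => (1 + |x|)⁻¹) (ENNReal.ofReal q) := by
    have hm : AEStronglyMeasurable (fun x : ℝ => (1 + |x|)⁻¹) volume := by
      refine Continuous.aestronglyMeasurable ?_
      exact Continuous.inv₀ (by fun_prop) fun x => by positivity
    rw [← integrable_norm_rpow_iff hm (by simpa using hq.trans' one_pos) ENNReal.ofReal_ne_top,
      ENNReal.toReal_ofReal (by linarith)]
    have := integrable_one_add_norm (E := ℝ) (μ := volume) (r := q) (by simpa using hq)
    refine this.congr (Eventually.of_forall fun x => ?_)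
    have hx : 0 ≤ (1 + |x|)⁻¹ := by positivity
    simp only [Real.norm_eq_abs]
    rw [abs_of_nonneg hx, Real.inv_rpow (by positivity), Real.rpow_neg (by positivity)]
  refine (h1.const_mul (1 + 1 / ε)).mono (continuous_conjPoisson hε).aestronglyMeasurable
    (Eventually.of_forall fun x => ?_)
  rw [Real.norm_eq_abs, Real.norm_of_nonneg (by positivity)]
  exact abs_conjPoisson_le hε x

theorem memLp_conjPoisson_sub {ε : ℝ} (hε : 0 < ε) {q : ℝ} (hq : 1 < q) (x : ℝ) :
    MemLp (fun y => conjPoisson ε (x - y)) (ENNReal.ofReal q) :=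
  (memLp_conjPoisson hε hq).comp_measurePreserving (Measure.measurePreserving_sub_left volume x)

theorem integrable_conjPoisson_smul {E : Type*} [NormedAddCommGroup E] [NormedSpace ℝ E]
    {ε : ℝ} (hε : 0 < ε) {p : ℝ} (hp : 1 < p) {f : ℝ → E}
    (hf : MemLp f (ENNReal.ofReal p)) (x : ℝ) : Integrable fun y => conjPoisson ε (x - y) • f y := by
  have hpq := Real.HolderConjugate.conjExponent hp
  have := hpq.ennrealOfReal
  rw [← memLp_one_iff_integrable]
  exact hf.smul (r := 1) (memLp_conjPoisson_sub hε hpq.symm.lt x)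

theorem aestronglyMeasurable_conjPoisson_conv {ε : ℝ} (hε : 0 < ε) {f : ℝ → ℂ}
    (hf : AEStronglyMeasurable f) :
    AEStronglyMeasurable (fun x => ∫ y, conjPoisson ε (x - y) • f y) volume := by
  have hc := continuous_conjPoisson hε
  have h : AEStronglyMeasurable (fun z : ℝ × ℝ => conjPoisson ε (z.1 - z.2) • f z.2)
      (volume.prod volume) :=
    (by fun_prop : Continuous fun z : ℝ × ℝ => conjPoisson ε (z.1 - z.2)).aestronglyMeasurable.smul
      hf.comp_snd
  exact h.integral_prod_right'

/-- The `L^p` bound for the Hilbert transform of nonnegative functions. -/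
theorem exists_eLpNorm_conjPoisson_le_of_nonneg {p : ℝ} (hp1 : 1 < p) (hp3 : p < 3) :
    ∃ C : ℝ≥0∞, C ≠ ⊤ ∧ ∀ ε : ℝ, 0 < ε → ∀ f : ℝ → ℝ, MemLp f (ENNReal.ofReal p) → (∀ s, 0 ≤ f s) →
      eLpNorm (fun x => ∫ s, conjPoisson ε (x - s) • (f s : ℂ)) (ENNReal.ofReal p)
        ≤ C * eLpNorm f (ENNReal.ofReal p) := by
  obtain ⟨C, hC, h⟩ := exists_lintegral_conjPoisson_le hp1 hp3
  have hp0 : 0 < p := by linarith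
  have hp0' : ENNReal.ofReal p ≠ 0 := by simpa using hp0
  have hp1' : 1 ≤ ENNReal.ofReal p := by simpa using hp1.le
  refine ⟨C ^ (1 / p), ENNReal.rpow_ne_top_of_nonneg (by positivity) hC, ?_⟩
  intro ε hε f hf hf0
  -- Truncation supplies the bounded support needed above. The bound does not see the support, so
  -- Fatou's lemma recovers `f`.
  set g : ℕ → ℝ → ℝ := fun n => indicator (Icc (-(n:ℝ)) n) f with hg
  have hg0 : ∀ n s, 0 ≤ g n s := fun n s => indicator_nonneg (fun s _ => hf0 s) s
  have hgf : ∀ n s, ‖g n s‖ ≤ ‖f s‖ := fun n s => norm_indicator_le_norm_self _ _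
  have hgint : ∀ n, Integrable (g n) := fun n => by
    rw [hg, integrable_indicator_iff measurableSet_Icc]
    exact (hf.restrict _).integrable hp1'
  have hbound : ∀ n, eLpNorm (fun x => ∫ s, conjPoisson ε (x - s) • (g n s : ℂ)) (ENNReal.ofReal p) volume
      ≤ C ^ (1 / p) * eLpNorm f (ENNReal.ofReal p) volume := by
    intro n
    have h1 := h ε hε (g n) n (hgint n) (hg0 n) (fun s hs => by
      rw [hg]; refine indicator_of_notMem ?_ _
      intro h'
      exact absurd (abs_le.mpr h') (not_le.mpr hs))
    rw [eLpNorm_eq_lintegral_rpow_enorm_toReal hp0' ENNReal.ofReal_ne_top,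
      eLpNorm_eq_lintegral_rpow_enorm_toReal hp0' ENNReal.ofReal_ne_top,
      ENNReal.toReal_ofReal hp0.le, ← ENNReal.mul_rpow_of_nonneg _ _ (by positivity)]
    gcongr
    refine le_trans (le_of_eq ?_) (h1.trans ?_)
    · refine lintegral_congr fun x => ?_
      have : ∫ s, conjPoisson ε (x - s) • (g n s : ℂ) = ((∫ s, conjPoisson ε (x - s) * g n s : ℝ) : ℂ) := by
        rw [← integral_complex_ofReal]
        simp
      rw [this, ← ofReal_norm, Complex.norm_real, Real.norm_eq_abs,
        ENNReal.ofReal_rpow_of_nonneg (abs_nonneg _) hp0.le]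
    · gcongr with x
      rw [← ofReal_norm]
      refine ENNReal.ofReal_le_ofReal ((le_abs_self _).trans (hgf n x))
  have hlim : ∀ x, Tendsto (fun n => ∫ s, conjPoisson ε (x - s) • (g n s : ℂ)) atTop
      (𝓝 (∫ s, conjPoisson ε (x - s) • (f s : ℂ))) := by
    intro x
    have hc := continuous_conjPoisson hε
    refine tendsto_integral_of_dominated_convergence (fun s => ‖conjPoisson ε (x - s) • (f s : ℂ)‖)
      (fun n => ?_) ?_ (fun n => Eventually.of_forall fun s => ?_) (Eventually.of_forall fun s => ?_)
    · exact (by fun_prop : Continuous fun s => conjPoisson ε (x - s)).aestronglyMeasurable.smul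
        (hgint n).ofReal.1
    · exact (integrable_conjPoisson_smul hε hp1 (hf.ofReal (K := ℂ)) x).norm
    · rw [norm_smul, norm_smul]
      gcongr
      simpa using hgf n s
    · refine tendsto_const_nhds.congr' ?_
      filter_upwards [eventually_ge_atTop ⌈|s|⌉₊] with n hn
      have : s ∈ Icc (-(n:ℝ)) n := abs_le.mp ((Nat.le_ceil _).trans (by exact_mod_cast hn))
      rw [hg]; simp only [indicator_of_mem this]
  refine (Lp.eLpNorm_lim_le_liminf_eLpNorm
    (fun n => aestronglyMeasurable_conjPoisson_conv hε (hgint n).ofReal.1) _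
    (Eventually.of_forall hlim)).trans ?_
  exact liminf_le_of_frequently_le' (Eventually.of_forall hbound).frequently

/-- The `L^p` bound for the Hilbert transform, regularized by the conjugate Poisson kernel. -/
theorem exists_eLpNorm_conjPoisson_le {p : ℝ} (hp1 : 1 < p) (hp3 : p < 3) :
    ∃ C : ℝ≥0∞, C ≠ ⊤ ∧ ∀ ε : ℝ, 0 < ε → ∀ f : ℝ → ℂ, MemLp f (ENNReal.ofReal p) →
      eLpNorm (fun x => ∫ s, conjPoisson ε (x - s) • f s) (ENNReal.ofReal p)
        ≤ C * eLpNorm f (ENNReal.ofReal p) := by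
  obtain ⟨C, hC, h⟩ := exists_eLpNorm_conjPoisson_le_of_nonneg hp1 hp3
  have hp1' : 1 ≤ ENNReal.ofReal p := by simpa using hp1.le
  -- The 4 counts the positive and negative parts of the real and imaginary parts.
  refine ⟨4 * C, ENNReal.mul_ne_top (by norm_num) hC, fun ε hε f hf => ?_⟩
  have key : ∀ g : ℝ → ℝ, MemLp g (ENNReal.ofReal p) → (∀ s, |g s| ≤ ‖f s‖) →
      MemLp (fun s => max (g s) 0) (ENNReal.ofReal p) ∧
      eLpNorm (fun x => ∫ s, conjPoisson ε (x - s) • ((max (g s) 0 : ℝ) : ℂ)) (ENNReal.ofReal p)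
        ≤ C * eLpNorm f (ENNReal.ofReal p) := by
    intro g hg hgf
    have hm : MemLp (fun s => max (g s) 0) (ENNReal.ofReal p) := hg.pos_part
    refine ⟨hm, (h ε hε _ hm fun s => le_max_right _ _).trans ?_⟩
    gcongr 1
    refine eLpNorm_mono fun s => ?_
    rw [Real.norm_of_nonneg (le_max_right _ _)]
    exact max_le ((le_abs_self _).trans (hgf s)) (norm_nonneg _)
  obtain ⟨m1, b1⟩ := key (fun s => (f s).re) hf.re fun s => Complex.abs_re_le_norm _
  obtain ⟨m2, b2⟩ := key (fun s => -(f s).re) hf.re.neg fun s => by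
    rw [abs_neg]; exact Complex.abs_re_le_norm _
  obtain ⟨m3, b3⟩ := key (fun s => (f s).im) hf.im fun s => Complex.abs_im_le_norm _
  obtain ⟨m4, b4⟩ := key (fun s => -(f s).im) hf.im.neg fun s => by
    rw [abs_neg]; exact Complex.abs_im_le_norm _
  have ii : ∀ g : ℝ → ℝ, MemLp g (ENNReal.ofReal p) → ∀ x,
      Integrable fun s => conjPoisson ε (x - s) • (g s : ℂ) := fun g hg x =>
    integrable_conjPoisson_smul hε hp1 (hg.ofReal (K := ℂ)) x
  have i1 := ii _ m1
  have i2 := ii _ m2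
  have i3 := ii _ m3
  have i4 := ii _ m4
  have hdecomp : (fun x => ∫ s, conjPoisson ε (x - s) • f s)
      = ((fun x => ∫ s, conjPoisson ε (x - s) • ((max (f s).re 0 : ℝ) : ℂ))
        - (fun x => ∫ s, conjPoisson ε (x - s) • ((max (-(f s).re) 0 : ℝ) : ℂ)))
        + Complex.I • ((fun x => ∫ s, conjPoisson ε (x - s) • ((max (f s).im 0 : ℝ) : ℂ))
        - (fun x => ∫ s, conjPoisson ε (x - s) • ((max (-(f s).im) 0 : ℝ) : ℂ))) := by
    ext x
    simp only [Pi.add_apply, Pi.sub_apply, Pi.smul_apply]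
    rw [← integral_sub (i1 x) (i2 x), ← integral_sub (i3 x) (i4 x), ← integral_smul]
    refine Eq.trans ?_ (integral_add ((i1 x).sub (i2 x)) (((i3 x).sub (i4 x)).smul Complex.I))
    refine integral_congr_ae (Eventually.of_forall fun s => ?_)
    have hmax : ∀ a : ℝ, max a 0 - max (-a) 0 = a := fun a => by
      rcases le_total a 0 with h | h
      · rw [max_eq_right h, max_eq_left (by linarith)]; ring
      · rw [max_eq_left h, max_eq_right (by linarith)]; ring
    beta_reduce
    rw [← smul_sub, ← smul_sub, ← Complex.ofReal_sub, ← Complex.ofReal_sub, hmax, hmax,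
      smul_comm Complex.I, ← smul_add, smul_eq_mul, mul_comm Complex.I, Complex.re_add_im]
  have am : ∀ g : ℝ → ℝ, MemLp g (ENNReal.ofReal p) → AEStronglyMeasurable
      (fun x => ∫ s, conjPoisson ε (x - s) • (g s : ℂ)) volume := fun g hg =>
    aestronglyMeasurable_conjPoisson_conv hε (hg.ofReal (K := ℂ)).1
  rw [hdecomp]
  set D := C * eLpNorm f (ENNReal.ofReal p)
  calc _ ≤ (D + D) + (D + D) := by
        refine (eLpNorm_add_le ((am _ m1).sub (am _ m2)) (((am _ m3).sub (am _ m4)).const_smul _) hp1').trans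
          (add_le_add ?_ ?_)
        · exact (eLpNorm_sub_le (am _ m1) (am _ m2) hp1').trans (add_le_add b1 b2)
        · rw [eLpNorm_const_smul]
          simp only [enorm_eq_nnnorm, Complex.nnnorm_I, ENNReal.coe_one, one_mul]
          exact (eLpNorm_sub_le (am _ m3) (am _ m4) hp1').trans (add_le_add b3 b4)
    _ = _ := by ring

/-! ### Hardy-type operators on the half-line. -/

/-- A symmetric kernel on the half-line, homogeneous of degree `-1`, with an integrable singularity
on the diagonal. -/
def homKernel (x y : ℝ) : ℝ := (Real.sqrt ((x + y) * |x - y|))⁻¹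

theorem homKernel_nonneg (x y : ℝ) : 0 ≤ homKernel x y := by unfold homKernel; positivity

theorem homKernel_comm (x y : ℝ) : homKernel x y = homKernel y x := by
  rw [homKernel, homKernel, add_comm, abs_sub_comm]

theorem homKernel_mul {x : ℝ} (hx : 0 < x) (u : ℝ) : homKernel x (x * u) = x⁻¹ * homKernel 1 u := by
  rw [homKernel, homKernel, show x + x * u = x * (1 + u) by ring, show x - x * u = x * (1 - u) by ring,
    abs_mul, abs_of_pos hx, show x * (1 + u) * (x * |1 - u|) = x ^ 2 * ((1 + u) * |1 - u|) by ring,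
    Real.sqrt_mul (by positivity), Real.sqrt_sq hx.le, mul_inv]

theorem measurable_homKernel : Measurable (Function.uncurry homKernel) := by
  unfold homKernel Function.uncurry
  exact ((by fun_prop : Continuous fun a : ℝ × ℝ => (a.1 + a.2) * |a.1 - a.2|).measurable.sqrt).inv

/-- Since |x - y| ≤ x + y, the kernel absorbs every error of size 1/(x+y); its square-root
singularity is there to absorb logarithms on the diagonal. -/
theorem inv_add_le_homKernel {x y : ℝ} (hx : 0 < x) (hy : 0 < y) (hxy : x ≠ y) :
    (x + y)⁻¹ ≤ homKernel x y := by
  have h1 : 0 < |x - y| := abs_pos.mpr (sub_ne_zero.mpr hxy)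
  have h2 : |x - y| ≤ x + y := abs_le.mpr ⟨by linarith, by linarith⟩
  unfold homKernel
  gcongr
  rw [Real.sqrt_le_left (by positivity), sq]
  gcongr

/-- The integrand is of order u^(-a) at 0, |u-1|^(-1/2) at 1 and u^(-1-a) at infinity. The first
needs a < 1, the last a > 0. -/
theorem integrableOn_homKernel_one {a : ℝ} (ha0 : 0 < a) (ha1 : a < 1) :
    IntegrableOn (fun u => homKernel 1 u * u ^ (-a)) (Ioi 0) := by
  have hm : Measurable fun u : ℝ => homKernel 1 u * u ^ (-a) :=
    measurable_homKernel.of_uncurry_left.mul (measurable_id.pow_const _)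
  have i1 : IntegrableOn (fun u => homKernel 1 u * u ^ (-a)) (Ioc 0 (1 / 2)) := by
    have : IntegrableOn (fun u : ℝ => 2 * u ^ (-a)) (Ioc 0 (1 / 2)) := by
      have := intervalIntegral.intervalIntegrable_rpow' (a := 0) (b := 1 / 2) (r := -a) (by linarith)
      rw [intervalIntegrable_iff_integrableOn_Ioc_of_le (by norm_num)] at this
      exact this.const_mul 2
    refine this.mono' hm.aestronglyMeasurable ?_
    filter_upwards [self_mem_ae_restrict measurableSet_Ioc] with u hu
    have hu0 : 0 < u := hu.1
    have hn := homKernel_nonneg 1 u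
    rw [Real.norm_of_nonneg (by positivity)]
    gcongr
    unfold homKernel
    rw [inv_le_comm₀ (Real.sqrt_pos.mpr ?_) two_pos]
    · refine Real.le_sqrt_of_sq_le ?_
      rw [abs_of_nonneg (by linarith [hu.2])]
      nlinarith [hu.2]
    · have : 0 < |1 - u| := by rw [abs_of_pos] <;> linarith [hu.2]
      positivity
  have i2 : IntegrableOn (fun u => homKernel 1 u * u ^ (-a)) (Ioc (1 / 2) 2) := by
    have h1 : IntegrableOn (fun u : ℝ => |u - 1| ^ (-(1 / 2) : ℝ)) (Ioc (1 / 2) 2) := by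
      have h2 : ∀ c d : ℝ, IntervalIntegrable (fun u : ℝ => |u| ^ (-(1 / 2) : ℝ)) volume c d := by
        have h3 : ∀ c : ℝ, 0 ≤ c → IntervalIntegrable (fun u : ℝ => |u| ^ (-(1 / 2) : ℝ)) volume 0 c := by
          intro c hc
          have := intervalIntegral.intervalIntegrable_rpow' (a := 0) (b := c) (r := -(1/2)) (by norm_num)
          refine this.congr (fun u hu => ?_)
          rw [uIoc_of_le hc] at hu
          rw [abs_of_pos hu.1]
        have h4 : ∀ c : ℝ, IntervalIntegrable (fun u : ℝ => |u| ^ (-(1 / 2) : ℝ)) volume 0 c := by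
          intro c
          rcases le_total 0 c with hc | hc
          · exact h3 c hc
          · have := (h3 (-c) (by linarith)).comp_mul_left (c := -1)
            simpa using this
        intro c d
        exact (h4 c).symm.trans (h4 d)
      have := (h2 (-(1/2)) 1).comp_sub_right 1
      rw [intervalIntegrable_iff_integrableOn_Ioc_of_le (by norm_num)] at this
      norm_num at this ⊢
      exact this
    refine (h1.const_mul ((1 / 2 : ℝ) ^ (-a))).mono' hm.aestronglyMeasurable ?_
    filter_upwards [self_mem_ae_restrict measurableSet_Ioc] with u hu
    have hu0 : 0 < u := by linarith [hu.1]
    have hn := homKernel_nonneg 1 u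
    rw [Real.norm_of_nonneg (by positivity), mul_comm]
    refine mul_le_mul (Real.rpow_le_rpow_of_nonpos (by norm_num) hu.1.le (by linarith)) ?_ hn
      (by positivity)
    · unfold homKernel
      rw [Real.rpow_neg (abs_nonneg _), ← Real.sqrt_eq_rpow]
      rcases (abs_nonneg (u - 1)).eq_or_lt with h | h
      · rw [abs_sub_comm 1 u, ← h]; simp
      · gcongr
        rw [abs_sub_comm 1 u]
        nlinarith
  have i3 : IntegrableOn (fun u => homKernel 1 u * u ^ (-a)) (Ioi 2) := by
    have : IntegrableOn (fun u : ℝ => 2 * u ^ (-1 - a)) (Ioi 2) :=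
      (integrableOn_Ioi_rpow_of_lt (by linarith) two_pos).const_mul 2
    refine this.mono' hm.aestronglyMeasurable ?_
    filter_upwards [self_mem_ae_restrict measurableSet_Ioi] with u hu
    have hu2 : 2 < u := hu
    have hu0 : 0 < u := by linarith
    have hn := homKernel_nonneg 1 u
    rw [Real.norm_of_nonneg (by positivity), sub_eq_add_neg, Real.rpow_add hu0, ← mul_assoc]
    gcongr
    unfold homKernel
    rw [Real.rpow_neg_one, ← div_eq_mul_inv, inv_le_comm₀ (Real.sqrt_pos.mpr ?_) (by positivity), inv_div]
    · refine Real.le_sqrt_of_sq_le ?_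
      rw [abs_sub_comm, abs_of_nonneg (by linarith)]
      nlinarith
    · have : 0 < |1 - u| := by rw [abs_sub_comm, abs_of_pos] <;> linarith
      positivity
  have := (i1.union i2).union i3
  rwa [Ioc_union_Ioc_eq_Ioc (by norm_num) (by norm_num), Ioc_union_Ioi_eq_Ioi (by norm_num)] at this

/-- By homogeneity of degree -1 the substitution y = xu scales x out: powers are eigenfunctions,
with the previous integral as eigenvalue. -/
theorem exists_lintegral_homKernel_le {a : ℝ} (ha0 : 0 < a) (ha1 : a < 1) :
    ∃ A : ℝ, 0 ≤ A ∧ ∀ x : ℝ, 0 < x → ∫⁻ y in Ioi 0, ENNReal.ofReal (homKernel x y * y ^ (-a))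
      = ENNReal.ofReal (A * x ^ (-a)) := by
  refine ⟨∫ u in Ioi 0, homKernel 1 u * u ^ (-a), ?_, fun x hx => ?_⟩
  · refine setIntegral_nonneg measurableSet_Ioi fun u hu => ?_
    have := homKernel_nonneg 1 u
    have : (0:ℝ) < u := hu
    positivity
  have hi := integrableOn_homKernel_one ha0 ha1
  have heq : ∀ u ∈ Ioi (0:ℝ), homKernel x (x * u) * (x * u) ^ (-a)
      = (x⁻¹ * x ^ (-a)) * (homKernel 1 u * u ^ (-a)) := fun u hu => by
    rw [homKernel_mul hx, Real.mul_rpow hx.le (le_of_lt hu)]; ring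
  have h1 : IntegrableOn (fun y => homKernel x y * y ^ (-a)) (Ioi 0) := by
    have := (integrableOn_Ioi_comp_mul_left_iff (fun y => homKernel x y * y ^ (-a)) 0 hx).mp ?_
    · simpa using this
    · exact (integrableOn_congr_fun heq measurableSet_Ioi).mpr (hi.const_mul _)
  have h2 := integral_comp_mul_left_Ioi (fun y => homKernel x y * y ^ (-a)) 0 hx
  rw [setIntegral_congr_fun measurableSet_Ioi heq, integral_const_mul, mul_zero, smul_eq_mul] at h2
  rw [← ofReal_integral_eq_lintegral_ofReal h1]
  · congr 1
    have := hx.ne'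
    field_simp at h2
    linarith
  · filter_upwards [self_mem_ae_restrict measurableSet_Ioi] with u hu
    have := homKernel_nonneg x u
    have : (0:ℝ) < u := hu
    simp only [Pi.zero_apply]
    positivity

/-- The `L^p` bound of the Hardy-type operators on the half-line. -/
theorem exists_lintegral_homKernel_rpow_le {p b : ℝ} (hp : 1 < p) (hb0 : 0 ≤ b) (hb : b < 1 / p) :
    ∃ C : ℝ≥0∞, C ≠ ⊤ ∧ ∀ f : ℝ → ℝ≥0∞, AEMeasurable f volPos →
      ∫⁻ x in Ioi 0, (∫⁻ y in Ioi 0, ENNReal.ofReal ((1 + (y / x) ^ b) * homKernel x y) * f y) ^ p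
        ≤ C * ∫⁻ x in Ioi 0, f x ^ p := by
  have hp0 : 0 < p := by linarith
  have hpq := Real.HolderConjugate.conjExponent hp
  set q := p.conjExponent
  have hq0 : 0 < q := hpq.symm.pos
  have hq1 : 1 < q := hpq.symm.lt
  have hpi : 1 / p < 1 := by rw [div_lt_one hp0]; exact hp
  have hqi : 1 / q < 1 := by rw [div_lt_one hq0]; exact hq1
  have hsum : 1 / p + 1 / q = 1 := by simpa using hpq.inv_add_inv_eq_one
  -- The Schur weight w = y^(-1/(pq)) satisfies w^q = y^(-1/p) and w^p = y^(-1/q). The factor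
  -- (y/x)^b shifts these exponents to 1/p - b and 1/q + b, and b < 1/p keeps all four in (0, 1).
  obtain ⟨A1, hA1, e1⟩ := exists_lintegral_homKernel_le (a := 1 / p) (by positivity) hpi
  obtain ⟨A2, hA2, e2⟩ := exists_lintegral_homKernel_le (a := 1 / p - b) (by linarith) (by linarith)
  obtain ⟨B1, hB1, g1⟩ := exists_lintegral_homKernel_le (a := 1 / q) (by positivity) hqi
  obtain ⟨B2, hB2, g2⟩ := exists_lintegral_homKernel_le (a := 1 / q + b) (by positivity) (by linarith)
  have hmk : Measurable (Function.uncurry fun x y : ℝ =>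
      ENNReal.ofReal ((1 + (y / x) ^ b) * homKernel x y)) := by
    have h1 : Measurable fun z : ℝ × ℝ => 1 + (z.2 / z.1) ^ b :=
      ((measurable_snd.div measurable_fst).pow_const b).const_add 1
    exact (h1.mul measurable_homKernel).ennreal_ofReal
  have hw : Measurable fun y : ℝ => ENNReal.ofReal (y ^ (-(1 / (p * q)))) :=
    (measurable_id.pow_const _).ennreal_ofReal
  have hm : ∀ a x : ℝ, Measurable fun y : ℝ => ENNReal.ofReal (homKernel x y * y ^ (-a)) := fun a x =>
    (measurable_homKernel.of_uncurry_left.mul (measurable_id.pow_const _)).ennreal_ofReal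
  have hwp : ∀ r s y : ℝ, 0 < y → 0 ≤ r → 1 / (p * q) * r = s →
      ENNReal.ofReal (y ^ (-(1 / (p * q)))) ^ r = ENNReal.ofReal (y ^ (-s)) := by
    intro r s y hy hr hs
    rw [ENNReal.ofReal_rpow_of_nonneg (by positivity) hr, ← Real.rpow_mul hy.le, neg_mul, hs]
  have hsq : 1 / (p * q) * q = 1 / p := by field_simp
  have hsp : 1 / (p * q) * p = 1 / q := by field_simp
  refine ⟨_, ?_, fun f hf => lintegral_rpow_le_of_schur (μ := volPos) hpq hmk hw ?_ ?_
    (A := ENNReal.ofReal (A1 + A2)) (B := ENNReal.ofReal (B1 + B2)) ?_ ?_ hf⟩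
  · exact ENNReal.mul_ne_top (ENNReal.rpow_ne_top_of_nonneg (by positivity) ENNReal.ofReal_ne_top)
      ENNReal.ofReal_ne_top
  · filter_upwards [self_mem_ae_restrict measurableSet_Ioi] with x hx
    have : (0:ℝ) < x := hx
    exact (ENNReal.ofReal_pos.mpr (by positivity)).ne'
  · exact Eventually.of_forall fun _ => ENNReal.ofReal_ne_top
  · filter_upwards [self_mem_ae_restrict measurableSet_Ioi] with x hx
    have hx0 : (0:ℝ) < x := hx
    rw [hwp q (1 / p) x hx0 hq0.le hsq]
    have : ∫⁻ y in Ioi 0, ENNReal.ofReal ((1 + (y / x) ^ b) * homKernel x y)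
          * ENNReal.ofReal (y ^ (-(1 / (p * q)))) ^ q
        = ∫⁻ y in Ioi 0, (ENNReal.ofReal (homKernel x y * y ^ (-(1 / p)))
          + ENNReal.ofReal (x ^ (-b)) * ENNReal.ofReal (homKernel x y * y ^ (-(1 / p - b)))) := by
      refine setLIntegral_congr_fun measurableSet_Ioi fun y hy => ?_
      have hy0 : (0:ℝ) < y := hy
      have hk := homKernel_nonneg x y
      rw [hwp q (1 / p) y hy0 hq0.le hsq, ← ENNReal.ofReal_mul (by positivity),
        ← ENNReal.ofReal_mul (by positivity), ← ENNReal.ofReal_add (by positivity) (by positivity),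
        Real.div_rpow hy0.le hx0.le, neg_sub, sub_eq_add_neg b, Real.rpow_add hy0, Real.rpow_neg hx0.le b]
      congr 1
      field_simp
    rw [this, lintegral_add_left (hm _ _), lintegral_const_mul _ (hm _ _), e1 x hx0, e2 x hx0,
      ← ENNReal.ofReal_mul (by positivity), ← ENNReal.ofReal_add (by positivity) (by positivity),
      ← ENNReal.ofReal_mul (by positivity), neg_sub, sub_eq_add_neg b, Real.rpow_add hx0,
      Real.rpow_neg hx0.le b]
    refine le_of_eq ?_
    congr 1
    field_simp
  · filter_upwards [self_mem_ae_restrict measurableSet_Ioi] with y hy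
    have hy0 : (0:ℝ) < y := hy
    rw [hwp p (1 / q) y hy0 hp0.le hsp]
    have : ∫⁻ x in Ioi 0, ENNReal.ofReal ((1 + (y / x) ^ b) * homKernel x y)
          * ENNReal.ofReal (x ^ (-(1 / (p * q)))) ^ p
        = ∫⁻ x in Ioi 0, (ENNReal.ofReal (homKernel y x * x ^ (-(1 / q)))
          + ENNReal.ofReal (y ^ b) * ENNReal.ofReal (homKernel y x * x ^ (-(1 / q + b)))) := by
      refine setLIntegral_congr_fun measurableSet_Ioi fun x hx => ?_
      have hx0 : (0:ℝ) < x := hx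
      have hk := homKernel_nonneg x y
      rw [hwp p (1 / q) x hx0 hp0.le hsp, homKernel_comm y x, ← ENNReal.ofReal_mul (by positivity),
        ← ENNReal.ofReal_mul (by positivity), ← ENNReal.ofReal_add (by positivity) (by positivity),
        Real.div_rpow hy0.le hx0.le, neg_add, Real.rpow_add hx0, Real.rpow_neg hx0.le b]
      congr 1
      field_simp
    rw [this, lintegral_add_left (hm _ _), lintegral_const_mul _ (hm _ _), g1 y hy0, g2 y hy0,
      ← ENNReal.ofReal_mul (by positivity), ← ENNReal.ofReal_add (by positivity) (by positivity),
      ← ENNReal.ofReal_mul (by positivity), neg_add, Real.rpow_add hy0, Real.rpow_neg hy0.le b]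
    refine le_of_eq ?_
    congr 1
    field_simp

/-! ### Weighted bounds for perturbations of the Hilbert transform. -/

/-- For |β| ≤ 1 the power lies between z and 1/z. Applied to a ratio of weights at comparable
points, this yields a factor |x-y| that cancels the singularity of the Hilbert kernel. -/
theorem abs_rpow_sub_one_le {z β : ℝ} (hz1 : 1 / 2 ≤ z) (hβ : |β| ≤ 1) :
    |z ^ β - 1| ≤ 2 * |z - 1| := by
  have hz0 : 0 < z := by linarith
  obtain ⟨hβ1, hβ2⟩ := abs_le.mp hβ
  rcases le_total 1 z with h | h
  · have h1 : z ^ β ≤ z := by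
      simpa using Real.rpow_le_rpow_of_exponent_le h hβ2
    have h2 : z⁻¹ ≤ z ^ β := by
      rw [← Real.rpow_neg_one]; exact Real.rpow_le_rpow_of_exponent_le h hβ1
    have h3 : 1 - z⁻¹ ≤ z - 1 := by
      have : 2 ≤ z + z⁻¹ := by
        have : z + z⁻¹ - 2 = (z - 1) ^ 2 / z := by field_simp; ring
        have : 0 ≤ (z - 1) ^ 2 / z := by positivity
        linarith
      linarith
    rw [abs_of_nonneg (by linarith : 0 ≤ z - 1), abs_le]
    constructor <;> linarith
  · have h1 : z ≤ z ^ β := by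
      simpa using Real.rpow_le_rpow_of_exponent_ge hz0 h hβ2
    have h2 : z ^ β ≤ z⁻¹ := by
      rw [← Real.rpow_neg_one]; exact Real.rpow_le_rpow_of_exponent_ge hz0 h hβ1
    have h3 : z⁻¹ - 1 ≤ 2 * (1 - z) := by
      have : 2 * (1 - z) - (z⁻¹ - 1) = (1 - z) * (2 * z - 1) / z := by field_simp
      have : 0 ≤ (1 - z) * (2 * z - 1) / z :=
        div_nonneg (mul_nonneg (by linarith) (by linarith)) hz0.le
      linarith
    rw [abs_of_nonpos (by linarith : z - 1 ≤ 0), abs_le]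
    constructor <;> linarith

theorem abs_conjPoisson_le_inv {ε : ℝ} (hε : 0 < ε) {x : ℝ} (hx : x ≠ 0) :
    |conjPoisson ε x| ≤ |x|⁻¹ := by
  have h := sq_add_sq_pos hε x
  have hx' : 0 < |x| := abs_pos.mpr hx
  rw [conjPoisson, abs_div, abs_of_pos h, ← one_div, div_le_div_iff₀ h hx', ← sq_abs x]
  nlinarith [sq_nonneg ε]

/-- Kernels which, conjugated with the weights `(1 + x) ^ β`, are perturbations of the kernel of the
Hilbert transform by a Hardy-type kernel. -/
structure IsHilbertPerturbation (C ε : ℝ) (k : ℝ → ℝ → ℝ) : Prop where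
  measurable : Measurable (Function.uncurry k)
  below : ∀ x y, 0 < y → 2 * y < x → |k x y| * ((1 + x) / (1 + y)) ≤ C / x
  above : ∀ x y, 0 < x → 2 * x < y → |k x y| ≤ C / y
  near : ∀ x y, 0 < x → 0 < y → y ≤ 2 * x → x ≤ 2 * y → x ≠ y →
    |k x y - conjPoisson ε (x - y)| ≤ C * homKernel x y

/-- Three regions. For x > 2y the weight ratio is at most (1+x)/(1+y), as β ≤ 1, and `below` has
that factor built in. For y > 2x the ratio is at most (y/x)^b, which is why this factor accompanies
the Hardy kernel. For comparable points the ratio differs from 1 by O(|x-y|/(1+y)), which removes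
the singularity. -/
theorem IsHilbertPerturbation.abs_conj_sub_le {C ε : ℝ} {k : ℝ → ℝ → ℝ} (hC : 0 ≤ C) (hε : 0 < ε)
    (hk : IsHilbertPerturbation C ε k) {β b : ℝ} (hβ : |β| ≤ 1) (hb0 : 0 ≤ b) (hb : -β ≤ b)
    {x y : ℝ} (hx : 0 < x) (hy : 0 < y) (hxy : x ≠ y) :
    |((1 + x) / (1 + y)) ^ β * k x y - conjPoisson ε (x - y)|
      ≤ (2 * C + 6) * ((1 + (y / x) ^ b) * homKernel x y) := by
  have hm := inv_add_le_homKernel hx hy hxy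
  have hm0 : 0 < homKernel x y := lt_of_lt_of_le (by positivity) hm
  have hyb : 0 ≤ (y / x) ^ b := by positivity
  have hQ : |conjPoisson ε (x - y)| ≤ |x - y|⁻¹ := abs_conjPoisson_le_inv hε (sub_ne_zero.mpr hxy)
  obtain ⟨hβ1, hβ2⟩ := abs_le.mp hβ
  set z := (1 + x) / (1 + y) with hz
  have hz0 : 0 < z := by positivity
  have hzβ : 0 < z ^ β := by positivity
  rcases lt_or_ge (2 * y) x with h1 | h1
  · have e1 : z ^ β ≤ z := by
      have : 1 ≤ z := by rw [hz, le_div_iff₀ (by positivity)]; linarith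
      simpa using Real.rpow_le_rpow_of_exponent_le this hβ2
    have e2 : |z ^ β * k x y| ≤ C / x := by
      rw [abs_mul, abs_of_pos hzβ, mul_comm]
      exact (mul_le_mul_of_nonneg_left e1 (abs_nonneg _)).trans (hk.below x y hy h1)
    have e3 : |conjPoisson ε (x - y)| ≤ 2 / x := by
      refine hQ.trans ?_
      rw [abs_of_pos (by linarith), ← one_div, div_le_div_iff₀ (by linarith) hx]
      linarith
    have e4 : 1 / x ≤ 2 * (x + y)⁻¹ := by
      rw [← div_eq_mul_inv, div_le_div_iff₀ hx (by positivity)]; linarith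
    calc _ ≤ C / x + 2 / x := (abs_sub _ _).trans (add_le_add e2 e3)
      _ = (C + 2) * (1 / x) := by ring
      _ ≤ (C + 2) * (2 * homKernel x y) := by
        gcongr
        exact e4.trans (by gcongr)
      _ ≤ (2 * C + 6) * (1 * homKernel x y) := by nlinarith
      _ ≤ _ := by gcongr; linarith
  rcases lt_or_ge (2 * x) y with h2 | h2
  · have e1 : z ^ β ≤ 1 + (y / x) ^ b := by
      have hz1 : z ≤ 1 := by rw [hz, div_le_one (by positivity)]; linarith
      calc z ^ β ≤ z ^ (-b) := Real.rpow_le_rpow_of_exponent_ge hz0 hz1 (by linarith)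
        _ = (z⁻¹) ^ b := by rw [Real.rpow_neg hz0.le, Real.inv_rpow hz0.le]
        _ ≤ (y / x) ^ b := by
          refine Real.rpow_le_rpow (by positivity) ?_ hb0
          rw [hz, inv_div, div_le_div_iff₀ (by positivity) hx]
          nlinarith
        _ ≤ _ := by linarith
    have e2 : |z ^ β * k x y| ≤ (1 + (y / x) ^ b) * (C / y) := by
      rw [abs_mul, abs_of_pos hzβ]
      exact mul_le_mul e1 (hk.above x y hx h2) (abs_nonneg _) (by positivity)
    have e3 : |conjPoisson ε (x - y)| ≤ 2 / y := by
      refine hQ.trans ?_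
      rw [abs_sub_comm, abs_of_pos (by linarith), ← one_div, div_le_div_iff₀ (by linarith) hy]
      linarith
    have e4 : 1 / y ≤ 2 * (x + y)⁻¹ := by
      rw [← div_eq_mul_inv, div_le_div_iff₀ hy (by positivity)]; linarith
    calc _ ≤ (1 + (y / x) ^ b) * (C / y) + 1 * (2 / y) :=
          (abs_sub _ _).trans (add_le_add e2 (by rwa [one_mul]))
      _ ≤ (1 + (y / x) ^ b) * (C / y) + (1 + (y / x) ^ b) * (2 / y) := by gcongr; linarith
      _ = (1 + (y / x) ^ b) * ((C + 2) * (1 / y)) := by ring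
      _ ≤ (1 + (y / x) ^ b) * ((C + 2) * (2 * homKernel x y)) := by
        gcongr
        exact e4.trans (by gcongr)
      _ ≤ (1 + (y / x) ^ b) * ((2 * C + 6) * homKernel x y) := by
        gcongr (1 + (y / x) ^ b) * ?_
        nlinarith
      _ = _ := by ring
  · have hz2 : 1 / 2 ≤ z := by rw [hz, div_le_div_iff₀ (by norm_num) (by positivity)]; linarith
    have hz3 : z ≤ 2 := by rw [hz, div_le_iff₀ (by positivity)]; linarith
    have e1 : |z ^ β - 1| ≤ 2 * |z - 1| := abs_rpow_sub_one_le hz2 hβ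
    have e2 : z ^ β ≤ 2 := by
      rcases le_total 1 z with h | h
      · exact (by simpa using Real.rpow_le_rpow_of_exponent_le h hβ2 : z ^ β ≤ z).trans hz3
      · have h3 : z ^ β ≤ z⁻¹ := by
          rw [← Real.rpow_neg_one]; exact Real.rpow_le_rpow_of_exponent_ge hz0 h hβ1
        exact h3.trans ((inv_le_comm₀ hz0 two_pos).mpr (by linarith))
    have hd : 0 < |x - y| := abs_pos.mpr (sub_ne_zero.mpr hxy)
    have e3 : |(z ^ β - 1) * conjPoisson ε (x - y)| ≤ 6 * homKernel x y := by
      rw [abs_mul]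
      have : z - 1 = (x - y) / (1 + y) := by rw [hz]; field_simp; ring
      calc |z ^ β - 1| * |conjPoisson ε (x - y)| ≤ (2 * |z - 1|) * |x - y|⁻¹ := by gcongr
        _ = 2 / (1 + y) := by
          rw [this, abs_div, abs_of_pos (by linarith : 0 < 1 + y)]; field_simp
        _ ≤ 6 * (x + y)⁻¹ := by
          rw [← div_eq_mul_inv, div_le_div_iff₀ (by positivity) (by positivity)]; linarith
        _ ≤ _ := by gcongr
    have e4 : |z ^ β * (k x y - conjPoisson ε (x - y))| ≤ 2 * (C * homKernel x y) := by
      rw [abs_mul, abs_of_pos hzβ]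
      exact mul_le_mul e2 (hk.near x y hx hy h2 h1 hxy) (abs_nonneg _) (by norm_num)
    calc _ = |z ^ β * (k x y - conjPoisson ε (x - y)) + (z ^ β - 1) * conjPoisson ε (x - y)| := by
          congr 1; ring
      _ ≤ 2 * (C * homKernel x y) + 6 * homKernel x y := (abs_add_le _ _).trans (add_le_add e4 e3)
      _ = (2 * C + 6) * (1 * homKernel x y) := by ring
      _ ≤ _ := by gcongr; linarith

/-- Weighted `L^p` bounds on the half-line for perturbations of the Hilbert transform, with weight
`(1 + x) ^ (2 - p)`. -/
theorem exists_eLpNorm_weighted_le {p : ℝ} (hp1 : 1 < p) (hp3 : p < 3) {C : ℝ} (hC : 0 ≤ C) :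
    ∃ D : ℝ≥0∞, D ≠ ⊤ ∧ ∀ (ε : ℝ) (k : ℝ → ℝ → ℝ), 0 < ε → IsHilbertPerturbation C ε k →
      ∀ f : ℝ → ℂ, MemLp (fun y => (1 + y) ^ (2 / p - 1) • f y) (ENNReal.ofReal p) volPos →
        (∀ x, 0 < x → Integrable (fun y => k x y • f y) volPos) →
        eLpNorm (fun x => (1 + x) ^ (2 / p - 1) • ∫ y in Ioi 0, k x y • f y) (ENNReal.ofReal p) volPos
          ≤ D * eLpNorm (fun y => (1 + y) ^ (2 / p - 1) • f y) (ENNReal.ofReal p) volPos := by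
  have hp0 : 0 < p := by linarith
  have hp1' : 1 ≤ ENNReal.ofReal p := by simpa using hp1.le
  have hp0' : ENNReal.ofReal p ≠ 0 := by simpa using hp0
  set β := 2 / p - 1 with hβ
  set b := max 0 (-β)
  have hpi : 1 / p < 1 := by rw [div_lt_one hp0]; exact hp1
  have hpi3 : 1 / 3 < 1 / p := one_div_lt_one_div_of_lt hp0 hp3
  have hβ' : β = 2 * (1 / p) - 1 := by rw [hβ]; ring
  have hβ1 : |β| ≤ 1 := abs_le.mpr ⟨by linarith, by linarith⟩
  -- When β < 0 this reads 1 - 2/p < 1/p, that is, p < 3.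
  have hb : b < 1 / p := max_lt (by positivity) (by linarith)
  obtain ⟨H, hH, hHil⟩ := exists_eLpNorm_conjPoisson_le hp1 hp3
  obtain ⟨S, hS, hSch⟩ := exists_lintegral_homKernel_rpow_le hp1 (le_max_left 0 (-β)) hb
  refine ⟨H + ENNReal.ofReal (2 * C + 6) * S ^ (1 / p), ENNReal.add_ne_top.mpr ⟨hH,
    ENNReal.mul_ne_top ENNReal.ofReal_ne_top (ENNReal.rpow_ne_top_of_nonneg (by positivity) hS)⟩, ?_⟩
  intro ε k hε hk f hf hint
  set F : ℝ → ℂ := indicator (Ioi 0) (fun y => (1 + y) ^ β • f y) with hF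
  have hFm : MemLp F (ENNReal.ofReal p) volume := (memLp_indicator_iff_restrict measurableSet_Ioi).mpr hf
  have hFn : eLpNorm F (ENNReal.ofReal p) volume
      = eLpNorm (fun y => (1 + y) ^ β • f y) (ENNReal.ofReal p) volPos :=
    eLpNorm_indicator_eq_eLpNorm_restrict measurableSet_Ioi
  have hFp : ∀ y, 0 < y → F y = (1 + y) ^ β • f y := fun y hy => indicator_of_mem hy _
  have hFm' : MemLp F (ENNReal.ofReal p) volPos := hFm.restrict _
  have hFn' : eLpNorm F (ENNReal.ofReal p) volPos
      = eLpNorm (fun y => (1 + y) ^ β • f y) (ENNReal.ofReal p) volPos := by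
    refine eLpNorm_congr_ae ?_
    filter_upwards [self_mem_ae_restrict measurableSet_Ioi] with y hy using hFp y hy
  set T1 : ℝ → ℂ := fun x => ∫ y, conjPoisson ε (x - y) • F y with hT1
  -- `T1` carries the regularized Hilbert transform of the weighted function, and `R` is what
  -- conjugating `k` with the weight leaves over, to be bounded by Schur's test.
  set R : ℝ → ℝ → ℝ := fun x y => ((1 + x) / (1 + y)) ^ β * k x y - conjPoisson ε (x - y) with hR
  set T2 : ℝ → ℂ := fun x => ∫ y in Ioi 0, R x y • F y with hT2
  have hT1' : ∀ x, T1 x = ∫ y in Ioi 0, conjPoisson ε (x - y) • F y := by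
    intro x
    rw [hT1, ← integral_indicator measurableSet_Ioi]
    refine integral_congr_ae (Eventually.of_forall fun y => ?_)
    by_cases hy : y ∈ Ioi (0:ℝ)
    · rw [indicator_of_mem hy]
    · rw [indicator_of_notMem hy]; simp [hF, indicator_of_notMem hy]
  have hsplit : ∀ x, 0 < x → (1 + x) ^ β • ∫ y in Ioi 0, k x y • f y = T1 x + T2 x := by
    intro x hx
    have e1 : ∀ y ∈ Ioi (0:ℝ), (1 + x) ^ β • (k x y • f y)
        = (((1 + x) / (1 + y)) ^ β * k x y) • F y := by
      intro y hy
      have hy0 : (0:ℝ) < y := hy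
      have : 0 < (1 + y) ^ β := by positivity
      rw [hFp y hy0, smul_smul, smul_smul, Real.div_rpow (by positivity) (by positivity)]
      congr 1
      field_simp
    have i1 : Integrable (fun y => conjPoisson ε (x - y) • F y) volPos :=
      (integrable_conjPoisson_smul hε hp1 hFm x).restrict
    have i2 : Integrable (fun y => (((1 + x) / (1 + y)) ^ β * k x y) • F y) volPos := by
      refine ((hint x hx).smul ((1 + x) ^ β)).congr ?_
      filter_upwards [self_mem_ae_restrict measurableSet_Ioi] with y hy using e1 y hy
    rw [hT1' x, hT2, ← integral_smul, setIntegral_congr_fun measurableSet_Ioi e1]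
    have : ∀ y, R x y • F y = (((1 + x) / (1 + y)) ^ β * k x y) • F y - conjPoisson ε (x - y) • F y :=
      fun y => by rw [hR]; simp only [sub_smul]
    simp only [this]
    rw [integral_sub i2 i1]
    ring
  have hT1m : AEStronglyMeasurable T1 volPos := (aestronglyMeasurable_conjPoisson_conv hε hFm.1).restrict
  have hT2m : AEStronglyMeasurable T2 volPos := by
    have hRm : Measurable (Function.uncurry R) := by
      have h1 := hk.measurable
      have h2 := (continuous_conjPoisson hε).measurable
      have h3 : Measurable fun z : ℝ × ℝ => ((1 + z.1) / (1 + z.2)) ^ β :=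
        ((measurable_fst.const_add 1).div (measurable_snd.const_add 1)).pow_const β
      exact (h3.mul h1).sub (h2.comp (measurable_fst.sub measurable_snd))
    have : AEStronglyMeasurable (fun z : ℝ × ℝ => R z.1 z.2 • F z.2) (volPos.prod volPos) :=
      hRm.aestronglyMeasurable.smul hFm'.1.comp_snd
    exact this.integral_prod_right'
  have b1 : eLpNorm T1 (ENNReal.ofReal p) volPos ≤ H * eLpNorm F (ENNReal.ofReal p) volPos := by
    rw [hFn', ← hFn]
    exact (eLpNorm_mono_measure _ Measure.restrict_le_self).trans (hHil ε hε F hFm)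
  have b2 : eLpNorm T2 (ENNReal.ofReal p) volPos
      ≤ ENNReal.ofReal (2 * C + 6) * S ^ (1 / p) * eLpNorm F (ENNReal.ofReal p) volPos := by
    rw [eLpNorm_eq_lintegral_rpow_enorm_toReal hp0' ENNReal.ofReal_ne_top,
      eLpNorm_eq_lintegral_rpow_enorm_toReal hp0' ENNReal.ofReal_ne_top,
      ENNReal.toReal_ofReal hp0.le, mul_assoc, ← ENNReal.mul_rpow_of_nonneg _ _ (by positivity)]
    have hpt : ∀ x, 0 < x → ‖T2 x‖ₑ ≤ ENNReal.ofReal (2 * C + 6) *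
        ∫⁻ y in Ioi 0, ENNReal.ofReal ((1 + (y / x) ^ b) * homKernel x y) * ‖F y‖ₑ := by
      intro x hx
      refine (enorm_integral_le_lintegral_enorm _).trans ?_
      rw [← lintegral_const_mul' _ _ ENNReal.ofReal_ne_top]
      refine lintegral_mono_ae ?_
      have hne : ∀ᵐ y ∂volPos, y ≠ x := ae_restrict_of_ae (by simp [ae_iff, measure_singleton])
      filter_upwards [self_mem_ae_restrict measurableSet_Ioi, hne] with y hy hyx
      rw [enorm_smul, ← mul_assoc, ← ENNReal.ofReal_mul (by positivity), ← ofReal_norm]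
      gcongr
      exact hk.abs_conj_sub_le hC hε hβ1 (le_max_left _ _) (le_max_right _ _) hx hy hyx.symm
    calc (∫⁻ x in Ioi 0, ‖T2 x‖ₑ ^ p) ^ (1 / p)
        ≤ (∫⁻ x in Ioi 0, ENNReal.ofReal (2 * C + 6) ^ p * (∫⁻ y in Ioi 0,
          ENNReal.ofReal ((1 + (y / x) ^ b) * homKernel x y) * ‖F y‖ₑ) ^ p) ^ (1 / p) := by
          gcongr 1
          refine setLIntegral_mono_ae' measurableSet_Ioi (Eventually.of_forall fun x hx => ?_)
          rw [← ENNReal.mul_rpow_of_nonneg _ _ hp0.le]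
          gcongr
          exact hpt x hx
      _ = ENNReal.ofReal (2 * C + 6) * (∫⁻ x in Ioi 0, (∫⁻ y in Ioi 0,
          ENNReal.ofReal ((1 + (y / x) ^ b) * homKernel x y) * ‖F y‖ₑ) ^ p) ^ (1 / p) := by
          rw [lintegral_const_mul' _ _ (ENNReal.rpow_ne_top_of_nonneg hp0.le ENNReal.ofReal_ne_top),
            ENNReal.mul_rpow_of_nonneg _ _ (by positivity), ← ENNReal.rpow_mul,
            mul_one_div_cancel hp0.ne', ENNReal.rpow_one]
      _ ≤ _ := by
          gcongr
          exact hSch _ hFm'.1.enorm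
  calc eLpNorm (fun x => (1 + x) ^ β • ∫ y in Ioi 0, k x y • f y) (ENNReal.ofReal p) volPos
      = eLpNorm (T1 + T2) (ENNReal.ofReal p) volPos := by
        refine eLpNorm_congr_ae ?_
        filter_upwards [self_mem_ae_restrict measurableSet_Ioi] with x hx using hsplit x hx
    _ ≤ _ := eLpNorm_add_le hT1m hT2m hp1'
    _ ≤ _ := add_le_add b1 b2
    _ = _ := by rw [← add_mul, hFn']

/-! ### The kernels linking r u' and r (-Δ_D)^(1/2) u. -/

/-- The primitive in `s` of `conjPoisson ε (t - s) + conjPoisson ε (t + s)` that vanishes at `s = 0`. -/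
def logKernel (ε t s : ℝ) : ℝ := 1 / 2 * Real.log (((t + s) ^ 2 + ε ^ 2) / ((t - s) ^ 2 + ε ^ 2))

/-- The kernel mapping `r u'(r)` to `r (-Δ_D)^(1/2) u(r)` in the variables `t = r - 1`,
up to the factor `π`. -/
def gradKernel (ε t s : ℝ) : ℝ :=
  conjPoisson ε (t - s) + conjPoisson ε (t + s) - logKernel ε t s / (1 + s)

section Kernels

variable {ε : ℝ}

theorem conjPoisson_neg (x : ℝ) : conjPoisson ε (-x) = -conjPoisson ε x := by
  rw [conjPoisson, conjPoisson, neg_sq, neg_div]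

theorem logKernel_comm (t s : ℝ) : logKernel ε t s = logKernel ε s t := by
  rw [logKernel, logKernel, add_comm t s, sub_sq_comm t s]

theorem logKernel_zero (t : ℝ) : logKernel ε t 0 = 0 := by
  rw [logKernel, add_zero, sub_zero]
  rcases eq_or_ne (t ^ 2 + ε ^ 2) 0 with h | h
  · rw [h]; simp
  · rw [div_self h]; simp

theorem continuous_logKernel (hε : 0 < ε) : Continuous (Function.uncurry (logKernel ε)) := by
  unfold logKernel Function.uncurry
  refine continuous_const.mul (Continuous.log (Continuous.div (by fun_prop) (by fun_prop) ?_) ?_)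
  · exact fun z => (sq_add_sq_pos hε _).ne'
  · exact fun z => (div_pos (sq_add_sq_pos hε _) (sq_add_sq_pos hε _)).ne'

theorem hasDerivAt_logKernel (hε : 0 < ε) (t s : ℝ) :
    HasDerivAt (logKernel ε t) (conjPoisson ε (t - s) + conjPoisson ε (t + s)) s := by
  have h1 := sq_add_sq_pos hε (t + s)
  have h2 := sq_add_sq_pos hε (t - s)
  have d1 : HasDerivAt (fun s => (t + s) ^ 2 + ε ^ 2) (2 * (t + s)) s := by
    have := (((hasDerivAt_id s).const_add t).pow 2).add_const (ε ^ 2)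
    simpa using this
  have d2 : HasDerivAt (fun s => (t - s) ^ 2 + ε ^ 2) (-(2 * (t - s))) s := by
    have := (((hasDerivAt_id s).const_sub t).pow 2).add_const (ε ^ 2)
    simpa using this
  have e : logKernel ε t = fun s => 1 / 2 * (Real.log ((t + s) ^ 2 + ε ^ 2) - Real.log ((t - s) ^ 2 + ε ^ 2)) := by
    ext s
    rw [logKernel, Real.log_div (sq_add_sq_pos hε _).ne' (sq_add_sq_pos hε _).ne']
  rw [e]
  refine ((((d1.log h1.ne').sub (d2.log h2.ne'))).const_mul (1 / 2)).congr_deriv ?_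
  rw [conjPoisson, conjPoisson]
  ring

theorem logKernel_nonneg (hε : 0 < ε) {t s : ℝ} (ht : 0 ≤ t) (hs : 0 ≤ s) : 0 ≤ logKernel ε t s := by
  rw [logKernel]
  refine mul_nonneg (by norm_num) (Real.log_nonneg ?_)
  rw [le_div_iff₀ (sq_add_sq_pos hε _)]
  nlinarith [mul_nonneg ht hs]

/-- The quotient inside the logarithm is 1 + 4ts/((t-s)²+ε²), and log(1+z) ≤ z. This is the bound
for use away from the diagonal. -/
theorem logKernel_le (hε : 0 < ε) {t s : ℝ} (ht : 0 ≤ t) (hs : 0 ≤ s) (hts : t ≠ s) :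
    logKernel ε t s ≤ 2 * t * s / (t - s) ^ 2 := by
  have h2 := sq_add_sq_pos hε (t - s)
  have h3 : 0 < (t - s) ^ 2 := by have := sub_ne_zero.mpr hts; positivity
  have h4 : ((t + s) ^ 2 + ε ^ 2) / ((t - s) ^ 2 + ε ^ 2) = 1 + 4 * t * s / ((t - s) ^ 2 + ε ^ 2) := by
    field_simp; ring
  rw [logKernel, h4]
  have h5 : 0 ≤ 4 * t * s / ((t - s) ^ 2 + ε ^ 2) := by positivity
  have h6 := Real.log_le_sub_one_of_pos (by positivity : 0 < 1 + 4 * t * s / ((t - s) ^ 2 + ε ^ 2))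
  have h7 : 4 * t * s / ((t - s) ^ 2 + ε ^ 2) ≤ 4 * t * s / (t - s) ^ 2 := by
    gcongr; nlinarith [sq_nonneg ε]
  calc _ ≤ 1 / 2 * (4 * t * s / (t - s) ^ 2) := by gcongr; linarith
    _ = _ := by ring

/-- Near the diagonal the logarithm is traded for a square root through log a² = 4 log √a ≤ 4(√a -
1), which matches the singularity of `homKernel`. -/
theorem logKernel_le_sqrt (hε : 0 < ε) {t s : ℝ} (ht : 0 < t) (hs : 0 < s) (hts : t ≠ s) :
    logKernel ε t s ≤ 2 * Real.sqrt ((t + s) / |t - s|) := by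
  have h2 := sq_add_sq_pos hε (t - s)
  have hd : 0 < |t - s| := abs_pos.mpr (sub_ne_zero.mpr hts)
  have h3 : ((t + s) ^ 2 + ε ^ 2) / ((t - s) ^ 2 + ε ^ 2) ≤ ((t + s) / |t - s|) ^ 2 := by
    rw [div_pow, sq_abs, div_le_div_iff₀ h2 (by rw [← sq_abs]; positivity)]
    have : (t - s) ^ 2 ≤ (t + s) ^ 2 := by nlinarith [mul_pos ht hs]
    nlinarith [sq_nonneg ε]
  have h4 : 0 < (t + s) / |t - s| := by positivity
  have h5 := Real.log_le_log (div_pos (sq_add_sq_pos hε _) h2) h3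
  set a := (t + s) / |t - s|
  have h6 : Real.log (a ^ 2) = 4 * Real.log (Real.sqrt a) := by
    rw [Real.log_pow, Real.log_sqrt h4.le]; push_cast; ring
  have h7 := Real.log_le_sub_one_of_pos (Real.sqrt_pos.mpr h4)
  rw [logKernel]
  linarith

/-- The difference factors through (b-a)(ab-ε²), and its bound is the one that 1/x satisfies,
uniformly in ε. -/
theorem abs_conjPoisson_sub_le (hε : 0 < ε) {a b : ℝ} (ha : a ≠ 0) (hb : b ≠ 0) :
    |conjPoisson ε a - conjPoisson ε b| ≤ |a - b| / (|a| * |b|) := by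
  have h1 := sq_add_sq_pos hε a
  have h2 := sq_add_sq_pos hε b
  have ha' := abs_pos.mpr ha
  have hb' := abs_pos.mpr hb
  have e : conjPoisson ε a - conjPoisson ε b
      = (b - a) * (a * b - ε ^ 2) / ((a ^ 2 + ε ^ 2) * (b ^ 2 + ε ^ 2)) := by
    rw [conjPoisson, conjPoisson]; field_simp; ring
  rw [e, abs_div, abs_mul, abs_sub_comm b a, abs_of_pos (mul_pos h1 h2),
    div_le_div_iff₀ (mul_pos h1 h2) (by positivity), mul_assoc]
  refine mul_le_mul_of_nonneg_left ?_ (abs_nonneg _)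
  have h3 : |a * b - ε ^ 2| ≤ |a| * |b| + ε ^ 2 := by
    refine (abs_sub _ _).trans ?_
    rw [abs_mul, abs_of_nonneg (sq_nonneg ε)]
  rw [← sq_abs a, ← sq_abs b]
  set A := |a|
  set B := |b|
  calc |a * b - ε ^ 2| * (A * B) ≤ (A * B + ε ^ 2) * (A * B) := by gcongr
    _ ≤ _ := by nlinarith [sq_nonneg (A - B), sq_nonneg ε, mul_nonneg (sq_nonneg ε) (sq_nonneg (A - B)),
      mul_nonneg (sq_nonneg ε) (mul_pos ha' hb').le, sq_nonneg (ε ^ 2)]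

theorem abs_conjPoisson_le_one_div (hε : 0 < ε) {x a : ℝ} (ha : 0 < a) (hx : a ≤ |x|) :
    |conjPoisson ε x| ≤ 1 / a := by
  have : x ≠ 0 := abs_pos.mp (ha.trans_le hx)
  refine (abs_conjPoisson_le_inv hε this).trans ?_
  rw [← one_div]
  exact one_div_le_one_div_of_le ha hx

/-- First-order expansion in s: the derivative Q(t-x) + Q(t+x) differs from its value 2Q(t) at x = 0
by at most 3s/t² on [0, s], and the mean value inequality integrates this. -/
theorem abs_logKernel_sub_le (hε : 0 < ε) {t s : ℝ} (hs : 0 < s) (hst : 2 * s < t) :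
    |logKernel ε t s - 2 * s * conjPoisson ε t| ≤ 3 * s ^ 2 / t ^ 2 := by
  have ht : 0 < t := by linarith
  have hd : ∀ x ∈ Icc 0 s, HasDerivWithinAt (fun x => logKernel ε t x - 2 * x * conjPoisson ε t)
      (conjPoisson ε (t - x) + conjPoisson ε (t + x) - 2 * conjPoisson ε t) (Icc 0 s) x := by
    intro x _
    have h2 : HasDerivAt (fun x => 2 * x * conjPoisson ε t) (2 * 1 * conjPoisson ε t) x :=
      ((hasDerivAt_id x).const_mul 2).mul_const (conjPoisson ε t)
    rw [mul_one] at h2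
    exact ((hasDerivAt_logKernel hε t x).sub h2).hasDerivWithinAt
  have hb : ∀ x ∈ Icc 0 s, ‖conjPoisson ε (t - x) + conjPoisson ε (t + x) - 2 * conjPoisson ε t‖
      ≤ 3 * s / t ^ 2 := by
    intro x hx
    have e1 := abs_conjPoisson_sub_le hε (a := t - x) (b := t) (by linarith [hx.2]) ht.ne'
    have e2 := abs_conjPoisson_sub_le hε (a := t + x) (b := t) (by linarith [hx.1]) ht.ne'
    rw [abs_of_pos (by linarith [hx.2] : 0 < t - x), abs_of_pos ht, sub_sub_cancel_left, abs_neg,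
      abs_of_nonneg hx.1] at e1
    rw [abs_of_pos (by linarith [hx.1] : 0 < t + x), abs_of_pos ht, add_sub_cancel_left,
      abs_of_nonneg hx.1] at e2
    have e3 : x / ((t - x) * t) ≤ 2 * s / t ^ 2 := by
      rw [div_le_div_iff₀ (mul_pos (by linarith [hx.2]) ht) (by positivity)]
      have h5 : x * t ≤ s * (2 * (t - x)) :=
        mul_le_mul hx.2 (by linarith [hx.2]) ht.le hs.le
      nlinarith [mul_le_mul_of_nonneg_right h5 ht.le]
    have e4 : x / ((t + x) * t) ≤ s / t ^ 2 := by
      rw [div_le_div_iff₀ (mul_pos (by linarith [hx.1]) ht) (by positivity)]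
      nlinarith [hx.1, hx.2, mul_pos ht ht, mul_nonneg (mul_nonneg hs.le ht.le) hx.1]
    rw [Real.norm_eq_abs]
    calc _ = |(conjPoisson ε (t - x) - conjPoisson ε t) + (conjPoisson ε (t + x) - conjPoisson ε t)| := by
          congr 1; ring
      _ ≤ 2 * s / t ^ 2 + s / t ^ 2 := (abs_add_le _ _).trans (add_le_add (e1.trans e3) (e2.trans e4))
      _ = _ := by ring
  have := (convex_Icc 0 s).norm_image_sub_le_of_norm_hasDerivWithin_le hd hb
    (left_mem_Icc.mpr hs.le) (right_mem_Icc.mpr hs.le)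
  rw [logKernel_zero, Real.norm_eq_abs, Real.norm_eq_abs, sub_zero, abs_of_pos hs] at this
  simp only [mul_zero, zero_mul, sub_zero] at this
  refine this.trans_eq ?_
  ring

theorem logKernel_div_le_homKernel (hε : 0 < ε) {t s : ℝ} (ht : 0 < t) (hs : 0 < s) (hts : t ≠ s)
    (h1 : t ≤ 2 * s) : logKernel ε t s / (1 + s) ≤ 6 * homKernel t s := by
  have hd : 0 < |t - s| := abs_pos.mpr (sub_ne_zero.mpr hts)
  have e1 := logKernel_le_sqrt hε ht hs hts
  have e2 : Real.sqrt ((t + s) / |t - s|) = (t + s) * homKernel t s := by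
    rw [homKernel, Real.sqrt_div (by positivity), Real.sqrt_mul (by positivity)]
    have : Real.sqrt (t + s) * Real.sqrt (t + s) = t + s := Real.mul_self_sqrt (by positivity)
    have h3 : 0 < Real.sqrt (t + s) := Real.sqrt_pos.mpr (by positivity)
    have h4 : 0 < Real.sqrt |t - s| := Real.sqrt_pos.mpr hd
    field_simp
    linarith
  have hm := homKernel_nonneg t s
  rw [div_le_iff₀ (by positivity)]
  rw [e2] at e1
  nlinarith [mul_nonneg hm ht.le, mul_nonneg hm hs.le]

theorem measurable_gradKernel (hε : 0 < ε) : Measurable (Function.uncurry (gradKernel ε)) := by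
  have h1 := (continuous_conjPoisson hε).measurable
  have h2 := (continuous_logKernel hε).measurable
  exact ((h1.comp (measurable_fst.sub measurable_snd)).add
    (h1.comp (measurable_fst.add measurable_snd))).sub (h2.div (measurable_snd.const_add 1))

/-- For large t and fixed s, `gradKernel` behaves like 2/t - 2s/(t(1+s)) = 2/(t(1+s)). That is one
power of t too large for `below`; the subtracted rank-one term cancels it and leaves O((1+s)/t²). -/
theorem isHilbertPerturbation_gradKernel_sub (hε : 0 < ε) (hε1 : ε ≤ 1) :
    IsHilbertPerturbation 18 ε (fun t s => gradKernel ε t s - 2 / ((1 + t) * (1 + s))) where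
  measurable := (measurable_gradKernel hε).sub
    (measurable_const.div ((measurable_fst.const_add 1).mul (measurable_snd.const_add 1)))
  below t s hs hst := by
    have ht : 0 < t := by linarith
    have hl0 := logKernel_nonneg hε ht.le hs.le
    -- For t ≤ 1 no cancellation is needed: the terms add up to 9/t and the weight ratio is at most
    -- 2, whence the constant 18.
    rcases le_total t 1 with h1 | h1
    · have e1 := abs_conjPoisson_le_one_div hε (x := t - s) (a := t / 2) (by positivity)
        (by rw [abs_of_pos] <;> linarith)
      have e2 := abs_conjPoisson_le_one_div hε (x := t + s) (a := t) (by positivity)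
        (by rw [abs_of_pos] <;> linarith)
      have e3 : logKernel ε t s ≤ 4 := by
        refine (logKernel_le hε ht.le hs.le (by linarith)).trans ?_
        rw [div_le_iff₀ (by have : 0 < t - s := by linarith
                            positivity)]
        nlinarith
      have e4 : logKernel ε t s / (1 + s) ≤ 4 := by rw [div_le_iff₀ (by positivity)]; nlinarith
      have e5 : 2 / ((1 + t) * (1 + s)) ≤ 2 := by
        rw [div_le_iff₀ (by positivity)]; nlinarith [mul_pos ht hs]
      have e6 : 0 ≤ logKernel ε t s / (1 + s) := by positivity
      have e7 : 0 ≤ 2 / ((1 + t) * (1 + s)) := by positivity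
      have e8 : (1 + t) / (1 + s) ≤ 2 := by rw [div_le_iff₀ (by positivity)]; linarith
      have e9 : 1 ≤ 1 / t := by rw [le_div_iff₀ ht]; linarith
      have e10 : |gradKernel ε t s - 2 / ((1 + t) * (1 + s))| ≤ 9 / t := by
        rw [gradKernel]
        obtain ⟨a1, a2⟩ := abs_le.mp e1
        obtain ⟨b1, b2⟩ := abs_le.mp e2
        have : 1 / (t / 2) = 2 * (1 / t) := by field_simp
        rw [this] at a1 a2
        rw [abs_le, show 9 / t = 9 * (1 / t) by ring]
        constructor <;> linarith
      calc _ ≤ 9 / t * 2 := by gcongr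
        _ = _ := by ring
    · have e1 := abs_conjPoisson_sub_le hε (a := t - s) (b := t) (by linarith) ht.ne'
      have e2 := abs_conjPoisson_sub_le hε (a := t + s) (b := t) (by linarith) ht.ne'
      rw [abs_of_pos (by linarith : 0 < t - s), abs_of_pos ht, sub_sub_cancel_left, abs_neg,
        abs_of_pos hs] at e1
      rw [abs_of_pos (by linarith : 0 < t + s), abs_of_pos ht, add_sub_cancel_left,
        abs_of_pos hs] at e2
      have e3 : s / ((t - s) * t) ≤ 2 * s / t ^ 2 := by
        rw [div_le_div_iff₀ (mul_pos (by linarith) ht) (by positivity)]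
        nlinarith [mul_pos ht ht, mul_pos hs ht]
      have e4 : s / ((t + s) * t) ≤ s / t ^ 2 := by
        gcongr; nlinarith
      have e5 := abs_logKernel_sub_le hε hs hst
      have e6 : |(logKernel ε t s - 2 * s * conjPoisson ε t) / (1 + s)| ≤ 3 * s / t ^ 2 := by
        rw [abs_div, abs_of_pos (by linarith : 0 < 1 + s), div_le_iff₀ (by positivity)]
        refine e5.trans ?_
        rw [div_mul_eq_mul_div]
        exact div_le_div_of_nonneg_right (by nlinarith) (by positivity)
      -- This is where ε ≤ 1 is used: with t ≥ 1 it gives |t - ε²| ≤ t.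
      have e7 : |2 / (1 + s) * (conjPoisson ε t - 1 / (1 + t))| ≤ 2 / t ^ 2 := by
        have hq := sq_add_sq_pos hε t
        have : conjPoisson ε t - 1 / (1 + t) = (t - ε ^ 2) / ((t ^ 2 + ε ^ 2) * (1 + t)) := by
          rw [conjPoisson]; field_simp; ring
        have h3 : |t - ε ^ 2| ≤ t := by
          rw [abs_le]; constructor <;> nlinarith
        have h4 : |conjPoisson ε t - 1 / (1 + t)| ≤ 1 / t ^ 2 := by
          rw [this, abs_div, abs_of_pos (by positivity : 0 < (t ^ 2 + ε ^ 2) * (1 + t)),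
            div_le_div_iff₀ (by positivity) (by positivity), one_mul]
          have : |t - ε ^ 2| * t ^ 2 ≤ t * t ^ 2 := by gcongr
          nlinarith [sq_nonneg ε, mul_pos ht ht]
        rw [abs_mul, abs_of_pos (by positivity : 0 < 2 / (1 + s))]
        calc 2 / (1 + s) * |conjPoisson ε t - 1 / (1 + t)| ≤ 2 * (1 / t ^ 2) := by
              gcongr; rw [div_le_iff₀ (by positivity)]; linarith
          _ = _ := by ring
      -- Q(t-s) and Q(t+s) are replaced by Q(t), L by 2sQ(t), and finally Q(t) by 1/(1+t). The main
      -- terms then cancel exactly.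
      have key : |gradKernel ε t s - 2 / ((1 + t) * (1 + s))| ≤ 6 * (1 + s) / t ^ 2 := by
        have : gradKernel ε t s - 2 / ((1 + t) * (1 + s))
            = ((conjPoisson ε (t - s) - conjPoisson ε t) + (conjPoisson ε (t + s) - conjPoisson ε t))
              + (-((logKernel ε t s - 2 * s * conjPoisson ε t) / (1 + s))
                + 2 / (1 + s) * (conjPoisson ε t - 1 / (1 + t))) := by
          rw [gradKernel]; field_simp; ring
        rw [this]
        calc _ ≤ (2 * s / t ^ 2 + s / t ^ 2) + (3 * s / t ^ 2 + 2 / t ^ 2) := by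
              refine (abs_add_le _ _).trans (add_le_add ((abs_add_le _ _).trans
                (add_le_add (e1.trans e3) (e2.trans e4))) ((abs_add_le _ _).trans (add_le_add ?_ e7)))
              rwa [abs_neg]
          _ = (6 * s + 2) / t ^ 2 := by ring
          _ ≤ _ := by gcongr; linarith
      calc _ ≤ 6 * (1 + s) / t ^ 2 * ((2 * t) / (1 + s)) := by gcongr; linarith
        _ = 12 / t := by field_simp; ring
        _ ≤ _ := by gcongr; norm_num
  above t s ht hts := by
    have hs : 0 < s := by linarith
    have hl0 := logKernel_nonneg hε ht.le hs.le
    have e1 := abs_conjPoisson_le_one_div hε (x := t - s) (a := s / 2) (by positivity)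
      (by rw [abs_of_neg] <;> linarith)
    have e2 := abs_conjPoisson_le_one_div hε (x := t + s) (a := s) (by positivity)
      (by rw [abs_of_pos] <;> linarith)
    have e3 : logKernel ε t s ≤ 4 := by
      refine (logKernel_le hε ht.le hs.le (by linarith)).trans ?_
      have : 0 < s - t := by linarith
      rw [sub_sq_comm, div_le_iff₀ (by positivity)]
      nlinarith
    have e4 : logKernel ε t s / (1 + s) ≤ 4 * (1 / s) := by
      rw [mul_one_div]
      gcongr; linarith
    have e5 : 2 / ((1 + t) * (1 + s)) ≤ 2 * (1 / s) := by
      rw [mul_one_div]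
      gcongr; nlinarith [mul_pos ht hs]
    have e6 : 0 ≤ logKernel ε t s / (1 + s) := by positivity
    have e7 : 0 ≤ 2 / ((1 + t) * (1 + s)) := by positivity
    have e8 : 0 < 1 / s := by positivity
    rw [gradKernel]
    obtain ⟨a1, a2⟩ := abs_le.mp e1
    obtain ⟨b1, b2⟩ := abs_le.mp e2
    have : 1 / (s / 2) = 2 * (1 / s) := by field_simp
    rw [this] at a1 a2
    rw [abs_le, show 18 / s = 18 * (1 / s) by ring]
    constructor <;> linarith
  near t s ht hs hst hts hne := by
    have hl0 := logKernel_nonneg hε ht.le hs.le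
    have e1 := logKernel_div_le_homKernel hε ht hs hne hts
    have e2 : 0 ≤ logKernel ε t s / (1 + s) := by positivity
    have e3 := inv_add_le_homKernel ht hs hne
    have e4 : |conjPoisson ε (t + s)| ≤ (t + s)⁻¹ := by
      rw [← one_div]
      exact abs_conjPoisson_le_one_div hε (by positivity) (le_abs_self _)
    have e5 : 2 / ((1 + t) * (1 + s)) ≤ 2 * (t + s)⁻¹ := by
      rw [← div_eq_mul_inv]
      gcongr; nlinarith [mul_pos ht hs]
    have e7 : 0 ≤ 2 / ((1 + t) * (1 + s)) := by positivity
    have e8 := homKernel_nonneg t s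
    obtain ⟨b1, b2⟩ := abs_le.mp e4
    rw [gradKernel, abs_le]
    constructor <;> linarith

/-- The minus sign comes from the oddness of Q. For x much larger than y, both Q(x-y) - Q(x+y) and
L/(1+x) are already O(y/x²), and the weight ratio is at most x/y, so no rank-one correction is
required. -/
theorem isHilbertPerturbation_neg_gradKernel_swap (hε : 0 < ε) :
    IsHilbertPerturbation 18 ε (fun x y => -gradKernel ε y x) where
  measurable := ((measurable_gradKernel hε).comp measurable_swap).neg
  below x y hy hyx := by
    have hx : 0 < x := by linarith
    have hl0 := logKernel_nonneg hε hy.le hx.le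
    have e1 := abs_conjPoisson_sub_le hε (a := x - y) (b := y + x) (by linarith) (by linarith)
    rw [abs_of_pos (by linarith : 0 < x - y), abs_of_pos (by linarith : 0 < y + x),
      show x - y - (y + x) = -(2 * y) by ring, abs_neg, abs_of_pos (by linarith : 0 < 2 * y)] at e1
    have e2 : 2 * y / ((x - y) * (y + x)) ≤ 4 * y / x ^ 2 := by
      rw [div_le_div_iff₀ (mul_pos (by linarith) (by linarith)) (by positivity)]
      nlinarith [mul_pos hx hy, mul_pos hy hy, mul_pos (mul_pos hy hy) hx,
        mul_pos hy (by linarith : 0 < x - 2 * y), mul_pos (mul_pos hy (by linarith : 0 < x - 2 * y)) hx,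
        mul_pos (mul_pos hy (by linarith : 0 < x - 2 * y)) hy]
    have e3 : logKernel ε y x / (1 + x) ≤ 8 * y / x ^ 2 := by
      have h1 : logKernel ε y x ≤ 8 * y / x := by
        refine (logKernel_le hε hy.le hx.le (by linarith)).trans ?_
        have : 0 < x - y := by linarith
        rw [sub_sq_comm, div_le_div_iff₀ (by positivity) hx]
        nlinarith [mul_pos hx hy, mul_pos hy (by linarith : 0 < x - 2 * y),
          mul_pos (mul_pos hy (by linarith : 0 < x - 2 * y)) hx,
          mul_pos (mul_pos hy (by linarith : 0 < x - 2 * y)) hy]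
      rw [div_le_iff₀ (by positivity)]
      refine h1.trans ?_
      rw [div_mul_eq_mul_div, div_le_div_iff₀ hx (by positivity)]
      nlinarith [mul_pos hx hy, mul_pos (mul_pos hx hy) hx]
    have e4 : 0 ≤ logKernel ε y x / (1 + x) := by positivity
    have key : |-gradKernel ε y x| ≤ 12 * y / x ^ 2 := by
      have : -gradKernel ε y x = (conjPoisson ε (x - y) - conjPoisson ε (y + x))
          + logKernel ε y x / (1 + x) := by
        rw [gradKernel, ← neg_sub x y, conjPoisson_neg]; ring
      rw [this]
      refine (abs_add_le _ _).trans ((add_le_add (e1.trans e2) ?_).trans_eq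
        (by ring : 4 * y / x ^ 2 + 8 * y / x ^ 2 = 12 * y / x ^ 2))
      rwa [abs_of_nonneg e4]
    have e5 : (1 + x) / (1 + y) ≤ x / y := by
      rw [div_le_div_iff₀ (by positivity) hy]; nlinarith
    calc _ ≤ 12 * y / x ^ 2 * (x / y) := by gcongr
      _ = 12 / x := by field_simp
      _ ≤ _ := by gcongr; norm_num
  above x y hx hxy := by
    have hy : 0 < y := by linarith
    have hl0 := logKernel_nonneg hε hy.le hx.le
    have e1 := abs_conjPoisson_le_one_div hε (x := y - x) (a := y / 2) (by positivity)
      (by rw [abs_of_pos] <;> linarith)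
    have e2 := abs_conjPoisson_le_one_div hε (x := y + x) (a := y) (by positivity)
      (by rw [abs_of_pos] <;> linarith)
    have e3 : logKernel ε y x / (1 + x) ≤ 8 * (1 / y) := by
      have h1 : logKernel ε y x ≤ 8 * x / y := by
        refine (logKernel_le hε hy.le hx.le (by linarith)).trans ?_
        have : 0 < y - x := by linarith
        rw [div_le_div_iff₀ (by positivity) hy]
        nlinarith [mul_pos hx hy, mul_pos hx (by linarith : 0 < y - 2 * x),
          mul_pos (mul_pos hx (by linarith : 0 < y - 2 * x)) hx,
          mul_pos (mul_pos hx (by linarith : 0 < y - 2 * x)) hy]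
      rw [div_le_iff₀ (by positivity)]
      refine h1.trans ?_
      rw [mul_one_div, div_mul_eq_mul_div]
      gcongr
      linarith
    have e6 : 0 ≤ logKernel ε y x / (1 + x) := by positivity
    have e8 : 0 < 1 / y := by positivity
    rw [gradKernel]
    obtain ⟨a1, a2⟩ := abs_le.mp e1
    obtain ⟨b1, b2⟩ := abs_le.mp e2
    have : 1 / (y / 2) = 2 * (1 / y) := by field_simp
    rw [this] at a1 a2
    rw [abs_le, show 18 / y = 18 * (1 / y) by ring]
    constructor <;> linarith
  near x y hx hy hyx hxy hne := by
    have hl0 := logKernel_nonneg hε hy.le hx.le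
    have e1 := logKernel_div_le_homKernel hε hy hx hne.symm hyx
    rw [homKernel_comm] at e1
    have e2 : 0 ≤ logKernel ε y x / (1 + x) := by positivity
    have e3 := inv_add_le_homKernel hx hy hne
    have e4 : |conjPoisson ε (y + x)| ≤ (x + y)⁻¹ := by
      rw [← one_div, add_comm y x]
      exact abs_conjPoisson_le_one_div hε (by positivity) (le_abs_self _)
    have e8 := homKernel_nonneg x y
    obtain ⟨b1, b2⟩ := abs_le.mp e4
    rw [gradKernel, ← neg_sub x y, conjPoisson_neg, abs_le]
    constructor <;> linarith

end Kernels

/-! ### Abel regularization of the composed transforms. -/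

/-- The factor of Abel summation. -/
def damp (ε ξ : ℝ) : ℝ := Real.exp (-(2 * Real.pi * ε) * ξ)

section Damp

variable {ε : ℝ}

theorem continuous_damp : Continuous (damp ε) := by unfold damp; fun_prop

theorem damp_pos (ξ : ℝ) : 0 < damp ε ξ := Real.exp_pos _

theorem damp_le_one (hε : 0 < ε) {ξ : ℝ} (hξ : 0 < ξ) : damp ε ξ ≤ 1 := by
  rw [damp, Real.exp_le_one_iff]
  have := Real.pi_pos
  have : 0 < 2 * Real.pi * ε * ξ := by positivity
  linarith

theorem integrable_damp (hε : 0 < ε) : Integrable (damp ε) volPos :=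
  exp_neg_integrableOn_Ioi 0 (by have := Real.pi_pos; positivity)

theorem memLp_two_damp (hε : 0 < ε) : MemLp (damp ε) 2 volPos := by
  rw [memLp_two_iff_integrable_sq continuous_damp.aestronglyMeasurable]
  have : (fun x => damp ε x ^ 2) = damp (2 * ε) := by
    ext x
    rw [damp, damp, ← Real.exp_nat_mul]
    congr 1; push_cast; ring
  rw [this]
  exact integrable_damp (by linarith)

theorem integrable_mul_damp (hε : 0 < ε) {e : ℝ → ℝ} (he : Continuous e) (heb : ∀ x, |e x| ≤ 2) :
    Integrable (fun ξ => ((e ξ * damp ε ξ : ℝ) : ℂ)) volPos := by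
  refine Integrable.ofReal ?_
  exact (integrable_damp hε).bdd_mul (c := 2) he.aestronglyMeasurable (Eventually.of_forall heb)

theorem memLp_two_mul_damp (hε : 0 < ε) {e : ℝ → ℝ} (he : Continuous e) (heb : ∀ x, |e x| ≤ 2) :
    MemLp (fun ξ => ((e ξ * damp ε ξ : ℝ) : ℂ)) 2 volPos := by
  refine ((memLp_two_damp hε).const_mul 2).mono
    (Complex.continuous_ofReal.comp (he.mul continuous_damp)).aestronglyMeasurable
    (Eventually.of_forall fun ξ => ?_)
  rw [Complex.norm_real, norm_mul, norm_mul]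
  gcongr
  simpa using heb ξ

/-- The integral is the imaginary part of ∫ exp(aξ) dξ = -1/a with a = -2πε + 2πbi. -/
theorem integral_sin_mul_damp (hε : 0 < ε) (b : ℝ) :
    ∫ ξ in Ioi 0, Real.sin (2 * Real.pi * b * ξ) * damp ε ξ = conjPoisson ε b / (2 * Real.pi) := by
  have hpi := Real.pi_pos
  set a : ℂ := -(2 * Real.pi * ε) + (2 * Real.pi * b) * Complex.I with ha
  have hre : a.re < 0 := by
    have : a.re = -(2 * Real.pi * ε) := by simp [ha]
    rw [this]; have : 0 < 2 * Real.pi * ε := by positivity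
    linarith
  have h1 := integral_exp_mul_complex_Ioi hre 0
  have h2 : ∀ ξ : ℝ, Real.sin (2 * Real.pi * b * ξ) * damp ε ξ = (Complex.exp (a * ξ)).im := by
    intro ξ
    have : a * ξ = ((-(2 * Real.pi * ε) * ξ : ℝ) : ℂ) + ((2 * Real.pi * b * ξ : ℝ) : ℂ) * Complex.I := by
      rw [ha]; push_cast; ring
    rw [this, Complex.exp_add, ← Complex.ofReal_exp, Complex.im_ofReal_mul, Complex.exp_ofReal_mul_I_im,
      damp, mul_comm]
  have h3 : Integrable (fun ξ : ℝ => Complex.exp (a * ξ)) volPos :=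
    integrableOn_exp_mul_complex_Ioi hre 0
  simp_rw [h2]
  have h4 := integral_im h3
  simp only [RCLike.im_eq_complex_im] at h4
  rw [h4, h1]
  simp only [Complex.ofReal_zero, mul_zero, Complex.exp_zero]
  have hn : Complex.normSq a = (2 * Real.pi) ^ 2 * (b ^ 2 + ε ^ 2) := by
    rw [Complex.normSq_apply, ha]; simp; ring
  rw [Complex.div_im, hn]
  have h5 := sq_add_sq_pos hε b
  have him : a.im = 2 * Real.pi * b := by simp [ha]
  rw [him, conjPoisson]
  simp
  field_simp

end Damp

/-- The kernel of the Abel-regularized composition of the sine and the cosine transform. -/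
def regKernel (ε t s : ℝ) : ℝ := (conjPoisson ε (t - s) + conjPoisson ε (t + s)) / Real.pi

theorem integral_sin_mul_cos_mul_damp {ε : ℝ} (hε : 0 < ε) (t s : ℝ) :
    ∫ ξ in Ioi 0, (2 * Real.sin (2 * Real.pi * ξ * t)) * (2 * Real.cos (2 * Real.pi * ξ * s)) * damp ε ξ
      = regKernel ε t s := by
  have hpi := Real.pi_pos
  have hi : ∀ b : ℝ, Integrable (fun ξ => Real.sin (2 * Real.pi * b * ξ) * damp ε ξ) volPos := fun b =>
    (integrable_damp hε).bdd_mul (c := 1) (by fun_prop)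
      (Eventually.of_forall fun x => by simpa using Real.abs_sin_le_one _)
  have : ∀ ξ : ℝ, (2 * Real.sin (2 * Real.pi * ξ * t)) * (2 * Real.cos (2 * Real.pi * ξ * s)) * damp ε ξ
      = 2 * (Real.sin (2 * Real.pi * (t - s) * ξ) * damp ε ξ)
        + 2 * (Real.sin (2 * Real.pi * (t + s) * ξ) * damp ε ξ) := by
    intro ξ
    rw [show 2 * Real.pi * (t - s) * ξ = 2 * Real.pi * ξ * t - 2 * Real.pi * ξ * s by ring,
      show 2 * Real.pi * (t + s) * ξ = 2 * Real.pi * ξ * t + 2 * Real.pi * ξ * s by ring,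
      Real.sin_sub, Real.sin_add]
    ring
  simp_rw [this]
  rw [integral_add ((hi _).const_mul 2) ((hi _).const_mul 2), integral_const_mul, integral_const_mul,
    integral_sin_mul_damp hε, integral_sin_mul_damp hε, regKernel]
  field_simp

theorem halfTransform_cos_sin_mul_damp {ε : ℝ} (hε : 0 < ε) (t s : ℝ) :
    halfTransform (fun θ => 2 * Real.cos θ)
      (fun ξ => ((2 * Real.sin (2 * Real.pi * ξ * t) * damp ε ξ : ℝ) : ℂ)) s = regKernel ε t s := by
  rw [halfTransform, ← integral_sin_mul_cos_mul_damp hε, ← integral_complex_ofReal]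
  refine integral_congr_ae (Eventually.of_forall fun ξ => ?_)
  push_cast
  ring

theorem halfTransform_sin_cos_mul_damp {ε : ℝ} (hε : 0 < ε) (t s : ℝ) :
    halfTransform (fun θ => 2 * Real.sin θ)
      (fun ξ => ((2 * Real.cos (2 * Real.pi * ξ * s) * damp ε ξ : ℝ) : ℂ)) t = regKernel ε t s := by
  rw [halfTransform, ← integral_sin_mul_cos_mul_damp hε, ← integral_complex_ofReal]
  refine integral_congr_ae (Eventually.of_forall fun ξ => ?_)
  push_cast
  ring

section Regularization

variable {e₁ e₂ : ℝ → ℝ} {c₁ σ₁ c₂ σ₂ : ℂ}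

theorem memLp_damp_mul {ε : ℝ} (hε : 0 < ε) {κ : ℝ → ℂ} (hκ : MemLp κ 2 volPos) :
    MemLp (fun ξ => (damp ε ξ : ℂ) * κ ξ) 2 volPos := by
  refine hκ.mono ((Complex.continuous_ofReal.comp continuous_damp).aestronglyMeasurable.mul hκ.1) ?_
  filter_upwards [self_mem_ae_restrict measurableSet_Ioi] with ξ hξ
  rw [norm_mul, Complex.norm_real, Real.norm_of_nonneg (damp_pos _).le]
  exact mul_le_of_le_one_left (norm_nonneg _) (damp_le_one hε hξ)

/-- The purpose of the damping: by Cauchy–Schwarz a damped L² function is integrable, so its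
transform is an honest integral. -/
theorem integrable_damp_mul {ε : ℝ} (hε : 0 < ε) {κ : ℝ → ℂ} (hκ : MemLp κ 2 volPos) :
    Integrable (fun ξ => (damp ε ξ : ℂ) * κ ξ) volPos :=
  MemLp.integrable_mul (p := 2) (q := 2) (memLp_two_damp hε).ofReal hκ

theorem tendsto_damp_mul {κ : Lp ℂ 2 volPos} {ε : ℕ → ℝ} (hε : ∀ n, 0 < ε n)
    (hlim : Tendsto ε atTop (𝓝 0)) :
    Tendsto (fun n => (memLp_damp_mul (hε n) (Lp.memLp κ)).toLp _) atTop (𝓝 κ) := by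
  rw [Lp.tendsto_Lp_iff_tendsto_eLpNorm']
  have h0 : ∀ n, eLpNorm (⇑((memLp_damp_mul (hε n) (Lp.memLp κ)).toLp _) - ⇑κ) 2 volPos
      = (∫⁻ ξ in Ioi 0, ‖((damp (ε n) ξ : ℂ) - 1) * κ ξ‖ₑ ^ (2:ℝ)) ^ (1 / 2 : ℝ) := by
    intro n
    rw [eLpNorm_eq_lintegral_rpow_enorm_toReal (by norm_num) (by norm_num), ENNReal.toReal_ofNat]
    congr 1
    refine lintegral_congr_ae ?_
    filter_upwards [(memLp_damp_mul (hε n) (Lp.memLp κ)).coeFn_toLp] with ξ hξ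
    rw [Pi.sub_apply, hξ]
    congr 2
    ring
  simp_rw [h0]
  have hfin : ∫⁻ ξ in Ioi 0, ‖κ ξ‖ₑ ^ (2:ℝ) ≠ ⊤ := by
    have := lintegral_rpow_enorm_lt_top_of_eLpNorm_lt_top (by norm_num) (by norm_num) (Lp.memLp κ).2
    simpa using this.ne
  have h1 : Tendsto (fun n => ∫⁻ ξ in Ioi 0, ‖((damp (ε n) ξ : ℂ) - 1) * κ ξ‖ₑ ^ (2:ℝ)) atTop
      (𝓝 (∫⁻ _ in Ioi (0:ℝ), 0)) := by
    refine tendsto_lintegral_of_dominated_convergence' (fun ξ => ‖κ ξ‖ₑ ^ (2:ℝ)) ?_ ?_ hfin ?_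
    · intro n
      refine (AEStronglyMeasurable.enorm ?_).pow_const _
      exact ((Complex.continuous_ofReal.comp continuous_damp).sub
        continuous_const).aestronglyMeasurable.mul (Lp.memLp κ).1
    · intro n
      filter_upwards [self_mem_ae_restrict measurableSet_Ioi] with ξ hξ
      gcongr
      rw [← ofReal_norm, ← ofReal_norm]
      refine ENNReal.ofReal_le_ofReal ?_
      rw [norm_mul]
      refine mul_le_of_le_one_left (norm_nonneg _) ?_
      rw [← Complex.ofReal_one, ← Complex.ofReal_sub, Complex.norm_real, Real.norm_eq_abs, abs_le]
      have h1 := damp_pos (ε := ε n) ξ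
      have h2 := damp_le_one (hε n) hξ
      constructor <;> linarith
    · refine Eventually.of_forall fun ξ => ?_
      have h2 : Tendsto (fun n => ((damp (ε n) ξ : ℂ) - 1) * κ ξ) atTop (𝓝 ((((damp 0 ξ : ℝ) : ℂ) - 1) * κ ξ)) := by
        have hc : Continuous fun a : ℝ => ((damp a ξ : ℂ) - 1) * κ ξ := by unfold damp; fun_prop
        exact (hc.tendsto 0).comp hlim
      have h3 := (h2.enorm).ennrpow_const (2:ℝ)
      simpa [damp] using h3
  rw [lintegral_zero] at h1
  have := h1.ennrpow_const (1 / 2 : ℝ)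
  simpa using this

/-- The composition of two half-line transforms is the limit of its Abel regularizations. -/
theorem exists_tendsto_regularization (h₁ : IsTrigKernel e₁ c₁ σ₁) (h₂ : IsTrigKernel e₂ c₂ σ₂)
    {k : ℝ → ℝ → ℝ → ℝ}
    (hk : ∀ ε, 0 < ε → ∀ t s,
      halfTransform e₁ (fun ξ => ((e₂ (2 * Real.pi * ξ * t) * damp ε ξ : ℝ) : ℂ)) s = (k ε t s : ℂ))
    (V : Lp ℂ 2 volPos) {ε : ℕ → ℝ} (hε : ∀ n, 0 < ε n) (hlim : Tendsto ε atTop (𝓝 0)) :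
    ∃ g : ℕ → Lp ℂ 2 volPos, (∀ n, g n =ᵐ[volPos] fun t => ∫ s in Ioi 0, k (ε n) t s • V s) ∧
      Tendsto g atTop (𝓝 (halfOp h₂ (halfOp h₁ V))) := by
  refine ⟨fun n => halfOp h₂ ((memLp_damp_mul (hε n) (Lp.memLp (halfOp h₁ V))).toLp _), fun n => ?_,
    ((halfOp h₂).continuous.tendsto _).comp (tendsto_damp_mul hε hlim)⟩
  have hn := hε n
  beta_reduce
  rw [halfOp_toLp h₂ (integrable_damp_mul hn (Lp.memLp _)) (memLp_damp_mul hn (Lp.memLp _))]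
  refine (MemLp.coeFn_toLp _).trans (Eventually.of_forall fun t => ?_)
  have hc₂ := h₂.continuous
  have hcont : Continuous fun ξ : ℝ => e₂ (2 * Real.pi * ξ * t) := by fun_prop
  have ha1 := integrable_mul_damp hn hcont fun x => h₂.abs_le _
  have ha2 := memLp_two_mul_damp hn hcont fun x => h₂.abs_le _
  -- The value at t is a pairing of `halfOp h₁ V` with a damped trigonometric function. Symmetry
  -- moves `halfOp h₁` onto that function, where the transform is explicit.
  calc halfTransform e₂ (fun ξ => (damp (ε n) ξ : ℂ) * halfOp h₁ V ξ) t
      = inner ℂ (ha2.toLp _) (halfOp h₁ V) := by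
        rw [L2.inner_def, halfTransform]
        refine integral_congr_ae ?_
        filter_upwards [ha2.coeFn_toLp] with ξ hξ
        rw [hξ, RCLike.inner_apply, Complex.conj_ofReal]
        push_cast; ring
    _ = inner ℂ (halfOp h₁ (ha2.toLp _)) V := (inner_halfOp h₁ _ _).symm
    _ = ∫ s in Ioi 0, k (ε n) t s • V s := by
        rw [halfOp_toLp h₁ ha1 ha2, L2.inner_def]
        refine integral_congr_ae ?_
        filter_upwards [(memLp_halfTransform h₁ ha1 ha2).coeFn_toLp] with s hs
        rw [hs, hk _ hn, RCLike.inner_apply, Complex.conj_ofReal, Complex.real_smul, mul_comm]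

end Regularization

/-- The cosine transform of `L²(0, ∞)`. -/
def cosOp : Lp ℂ 2 volPos →L[ℂ] Lp ℂ 2 volPos := halfOp isTrigKernel_cos

/-- The sine transform of `L²(0, ∞)`. -/
def sinOp : Lp ℂ 2 volPos →L[ℂ] Lp ℂ 2 volPos := halfOp isTrigKernel_sin

theorem exists_tendsto_sinOp_cosOp (V : Lp ℂ 2 volPos) {ε : ℕ → ℝ} (hε : ∀ n, 0 < ε n)
    (hlim : Tendsto ε atTop (𝓝 0)) :
    ∃ g : ℕ → Lp ℂ 2 volPos, (∀ n, g n =ᵐ[volPos] fun t => ∫ s in Ioi 0, regKernel (ε n) t s • V s) ∧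
      Tendsto g atTop (𝓝 (sinOp (cosOp V))) :=
  exists_tendsto_regularization isTrigKernel_cos isTrigKernel_sin (k := regKernel)
    (fun _ hε t s => halfTransform_cos_sin_mul_damp hε t s) V hε hlim

theorem exists_tendsto_cosOp_sinOp (h : Lp ℂ 2 volPos) {ε : ℕ → ℝ} (hε : ∀ n, 0 < ε n)
    (hlim : Tendsto ε atTop (𝓝 0)) :
    ∃ g : ℕ → Lp ℂ 2 volPos, (∀ n, g n =ᵐ[volPos] fun s => ∫ t in Ioi 0, regKernel (ε n) t s • h t) ∧
      Tendsto g atTop (𝓝 (cosOp (sinOp h))) :=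
  exists_tendsto_regularization isTrigKernel_sin isTrigKernel_cos (k := fun ε s t => regKernel ε t s)
    (fun _ hε s t => halfTransform_sin_cos_mul_damp hε t s) h hε hlim

/-! ### Kernels as square-integrable functions of one variable. -/

section KernelL2

variable {ε : ℝ}

/-- Pairing with a fixed L² kernel is continuous; identities for test profiles pass to L² limits
this way. -/
theorem tendsto_integral_smul_of_tendsto {a : ℝ → ℝ} (ha : MemLp a 2 volPos) {ι : Type*}
    {l : Filter ι} {f : ι → Lp ℂ 2 volPos} {g : Lp ℂ 2 volPos} (h : Tendsto f l (𝓝 g)) :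
    Tendsto (fun i => ∫ s in Ioi 0, a s • f i s) l (𝓝 (∫ s in Ioi 0, a s • g s)) := by
  have ha' : MemLp (fun s => (a s : ℂ)) 2 volPos := ha.ofReal
  have key : ∀ f : Lp ℂ 2 volPos, ∫ s in Ioi 0, a s • f s = inner ℂ (ha'.toLp _) f := by
    intro f
    rw [L2.inner_def]
    refine integral_congr_ae ?_
    filter_upwards [ha'.coeFn_toLp] with s hs
    rw [hs, RCLike.inner_apply, Complex.conj_ofReal, Complex.real_smul, mul_comm]
  simp_rw [key]
  exact ((continuous_const.inner continuous_id).tendsto g).comp h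

theorem integrable_smul_of_memLp_two {a : ℝ → ℝ} (ha : MemLp a 2 volPos) (f : Lp ℂ 2 volPos) :
    Integrable (fun s => a s • f s) volPos := by
  rw [← memLp_one_iff_integrable]
  exact (Lp.memLp f).smul (r := 1) ha

theorem memLp_two_conjPoisson (hε : 0 < ε) : MemLp (conjPoisson ε) 2 volume := by
  have := memLp_conjPoisson hε (q := 2) (by norm_num)
  simpa using this

theorem memLp_two_poisson (hε : 0 < ε) : MemLp (poisson ε) 2 volume := by
  have hc := (continuous_poisson hε).aestronglyMeasurable (μ := volume)
  rw [memLp_two_iff_integrable_sq hc]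
  refine ((integrable_poisson hε).const_mul ε⁻¹).mono' (hc.pow 2) (Eventually.of_forall fun x => ?_)
  have h0 := poisson_nonneg hε x
  have h1 : poisson ε x ≤ ε⁻¹ := by
    rw [poisson_eq hε]
    refine mul_le_of_le_one_right (by positivity) ?_
    exact inv_le_one_of_one_le₀ (by nlinarith [sq_nonneg (x / ε)])
  rw [Real.norm_of_nonneg (by positivity), sq]
  gcongr

theorem memLp_two_conjPoisson_sub (hε : 0 < ε) (t : ℝ) :
    MemLp (fun s => conjPoisson ε (t - s)) 2 volPos :=
  ((memLp_two_conjPoisson hε).comp_measurePreserving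
    (Measure.measurePreserving_sub_left volume t)).restrict _

theorem memLp_two_conjPoisson_add (hε : 0 < ε) (t : ℝ) :
    MemLp (fun s => conjPoisson ε (t + s)) 2 volPos :=
  ((memLp_two_conjPoisson hε).comp_measurePreserving
    (measurePreserving_add_left volume t)).restrict _

theorem memLp_two_regKernel (hε : 0 < ε) (t : ℝ) : MemLp (regKernel ε t) 2 volPos := by
  have := ((memLp_two_conjPoisson_sub hε t).add (memLp_two_conjPoisson_add hε t)).const_mul Real.pi⁻¹
  refine this.ae_eq (Eventually.of_forall fun s => ?_)
  simp only [Pi.add_apply, regKernel]; ring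

theorem continuous_regKernel (hε : 0 < ε) : Continuous (Function.uncurry (regKernel ε)) := by
  have := continuous_conjPoisson hε
  unfold regKernel Function.uncurry
  fun_prop

/-- From log(1+z) ≤ z and ts = t² + t(s-t), the kernel is dominated by a multiple of the Poisson
kernel plus a multiple of the absolute conjugate kernel, both in L². -/
theorem memLp_two_logKernel (hε : 0 < ε) {t : ℝ} (ht : 0 < t) : MemLp (logKernel ε t) 2 volPos := by
  have h1 : MemLp (fun s => poisson ε (t - s)) 2 volPos :=
    ((memLp_two_poisson hε).comp_measurePreserving
      (Measure.measurePreserving_sub_left volume t)).restrict _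
  refine ((h1.const_mul (2 * t ^ 2 / ε)).add
    ((memLp_two_conjPoisson_sub hε t).norm.const_mul (2 * t))).mono
    ((continuous_logKernel hε).comp (by fun_prop : Continuous fun s => (t, s))).aestronglyMeasurable ?_
  filter_upwards [self_mem_ae_restrict measurableSet_Ioi] with s hs
  have hs0 : (0:ℝ) < s := hs
  have h2 := sq_add_sq_pos hε (t - s)
  have h4 : ((t + s) ^ 2 + ε ^ 2) / ((t - s) ^ 2 + ε ^ 2) = 1 + 4 * t * s / ((t - s) ^ 2 + ε ^ 2) := by
    field_simp; ring
  have h6 := Real.log_le_sub_one_of_pos (by positivity : 0 < 1 + 4 * t * s / ((t - s) ^ 2 + ε ^ 2))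
  rw [Real.norm_of_nonneg (logKernel_nonneg hε ht.le hs0.le), logKernel, h4]
  refine le_trans ?_ (le_abs_self _)
  have e1 : 2 * t ^ 2 / ε * poisson ε (t - s) = 2 * t * t / ((t - s) ^ 2 + ε ^ 2) := by
    rw [poisson]; field_simp
  have e2 : 2 * t * (s - t) / ((t - s) ^ 2 + ε ^ 2) ≤ 2 * t * ‖conjPoisson ε (t - s)‖ := by
    rw [mul_div_assoc]
    gcongr
    refine le_trans (le_of_eq ?_) (neg_abs_le _ |> neg_le.mp)
    rw [conjPoisson]; ring
  simp only [Pi.add_apply]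
  rw [e1]
  calc _ ≤ 1 / 2 * (4 * t * s / ((t - s) ^ 2 + ε ^ 2)) := by gcongr; linarith
    _ = 2 * t * t / ((t - s) ^ 2 + ε ^ 2) + 2 * t * (s - t) / ((t - s) ^ 2 + ε ^ 2) := by ring
    _ ≤ _ := by gcongr

theorem memLp_two_inv_one_add : MemLp (fun s : ℝ => (1 + s)⁻¹) 2 volPos := by
  have hm : Measurable fun s : ℝ => (1 + s)⁻¹ := (measurable_id.const_add 1).inv
  rw [memLp_two_iff_integrable_sq hm.aestronglyMeasurable]
  have := integrable_one_add_norm (E := ℝ) (μ := volume) (r := 2) (by simp)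
  refine (this.restrict (s := Ioi 0)).congr ?_
  filter_upwards [self_mem_ae_restrict measurableSet_Ioi] with s hs
  have hs0 : (0:ℝ) < s := hs
  rw [Real.norm_of_nonneg hs0.le, Real.rpow_neg (by positivity), inv_pow]
  norm_cast

theorem memLp_two_gradKernel (hε : 0 < ε) {t : ℝ} (ht : 0 < t) : MemLp (gradKernel ε t) 2 volPos := by
  have h1 : MemLp (fun s => logKernel ε t s / (1 + s)) 2 volPos := by
    refine (memLp_two_logKernel hε ht).mono ?_ ?_
    · exact (((continuous_logKernel hε).comp
        (by fun_prop : Continuous fun s => (t, s))).measurable.div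
          (measurable_id.const_add 1)).aestronglyMeasurable
    · filter_upwards [self_mem_ae_restrict measurableSet_Ioi] with s hs
      have hs0 : (0:ℝ) < s := hs
      rw [norm_div]
      refine div_le_self (norm_nonneg _) ?_
      rw [Real.norm_of_nonneg (by positivity)]; linarith
  exact ((memLp_two_conjPoisson_sub hε t).add (memLp_two_conjPoisson_add hε t)).sub h1

theorem memLp_two_gradKernel_left (hε : 0 < ε) {s : ℝ} (hs : 0 < s) :
    MemLp (fun t => gradKernel ε t s) 2 volPos := by
  have h1 := (memLp_two_logKernel hε hs).const_mul (1 + s)⁻¹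
  have := ((memLp_two_conjPoisson_add hε s).sub (memLp_two_conjPoisson_sub hε s)).sub h1
  refine this.ae_eq (Eventually.of_forall fun t => ?_)
  simp only [Pi.sub_apply, gradKernel]
  rw [logKernel_comm t s, ← neg_sub s t, conjPoisson_neg, add_comm t s]
  ring

end KernelL2

/-! ### Identities for test profiles. -/

namespace IsTestProfile

variable {u : ℝ → ℂ}

theorem eq_zero (hu : IsTestProfile u) {r : ℝ} (hr : r ≤ 1) : u r = 0 :=
  image_eq_zero_of_notMem_tsupport fun h => absurd (hu.tsupport_subset h) (not_lt.mpr hr)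

theorem deriv_eq_zero (hu : IsTestProfile u) {r : ℝ} (hr : r ≤ 1) : deriv u r = 0 :=
  image_eq_zero_of_notMem_tsupport fun h =>
    absurd (hu.tsupport_subset (tsupport_deriv_subset h)) (not_lt.mpr hr)

theorem contDiff_deriv (hu : IsTestProfile u) : ContDiff ℝ ∞ (deriv u) :=
  (contDiff_infty_iff_deriv.mp hu.contDiff).2

theorem hasDerivAt (hu : IsTestProfile u) (r : ℝ) : HasDerivAt u (deriv u r) r :=
  (hu.contDiff.differentiable (by simp) r).hasDerivAt

theorem hasDerivAt_one_add (hu : IsTestProfile u) (t : ℝ) :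
    HasDerivAt (fun t => u (1 + t)) (deriv u (1 + t)) t :=
  (hu.hasDerivAt (1 + t)).comp_const_add 1 t

end IsTestProfile

/-- `t ↦ (1 + t) u(1 + t)`. -/
def shiftMul (u : ℝ → ℂ) (t : ℝ) : ℂ := (1 + t) • u (1 + t)

/-- The derivative of `shiftMul u`. -/
def shiftMulDeriv (u : ℝ → ℂ) (t : ℝ) : ℂ := u (1 + t) + (1 + t) • deriv u (1 + t)

section Profile

variable {u : ℝ → ℂ}

theorem hasCompactSupport_comp_one_add {E : Type*} [Zero E] {f : ℝ → E} (hf : HasCompactSupport f) :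
    HasCompactSupport fun t => f (1 + t) :=
  hf.comp_homeomorph (Homeomorph.addLeft 1)

theorem hasCompactSupport_of_imp {E F : Type*} [Zero E] [Zero F] {f : ℝ → E} {g : ℝ → F}
    (hf : HasCompactSupport f) (h : ∀ t, f t = 0 → g t = 0) : HasCompactSupport g :=
  hf.mono fun t ht h0 => ht (h t h0)

theorem hasDerivAt_shiftMul (hu : IsTestProfile u) (t : ℝ) :
    HasDerivAt (shiftMul u) (shiftMulDeriv u t) t := by
  have h1 := hu.hasDerivAt_one_add t
  have h2 : HasDerivAt (fun t : ℝ => 1 + t) 1 t := (hasDerivAt_id t).const_add 1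
  refine (h2.smul h1).congr_deriv ?_
  rw [shiftMulDeriv, one_smul, add_comm]

theorem continuous_shiftMul (hu : IsTestProfile u) : Continuous (shiftMul u) := by
  have := hu.contDiff.continuous
  unfold shiftMul; fun_prop

theorem continuous_shiftMul_deriv (hu : IsTestProfile u) : Continuous (shiftMul (deriv u)) := by
  have := hu.contDiff_deriv.continuous
  unfold shiftMul; fun_prop

theorem continuous_shiftMulDeriv (hu : IsTestProfile u) : Continuous (shiftMulDeriv u) := by
  have h1 := hu.contDiff.continuous
  have h2 := hu.contDiff_deriv.continuous
  unfold shiftMulDeriv; fun_prop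

theorem hasCompactSupport_shiftMul {u : ℝ → ℂ} (hu : HasCompactSupport u) :
    HasCompactSupport (shiftMul u) :=
  hasCompactSupport_of_imp (hasCompactSupport_comp_one_add hu) fun t h => by rw [shiftMul, h, smul_zero]

theorem hasCompactSupport_shiftMulDeriv (hu : IsTestProfile u) : HasCompactSupport (shiftMulDeriv u) :=
  (hasCompactSupport_comp_one_add hu.hasCompactSupport).add
    (hasCompactSupport_shiftMul hu.hasCompactSupport.deriv)

theorem memLp_two_shiftMul (hu : IsTestProfile u) : MemLp (shiftMul u) 2 volPos :=
  (continuous_shiftMul hu).memLp_of_hasCompactSupport (hasCompactSupport_shiftMul hu.hasCompactSupport)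

theorem memLp_two_shiftMul_deriv (hu : IsTestProfile u) : MemLp (shiftMul (deriv u)) 2 volPos :=
  (continuous_shiftMul_deriv hu).memLp_of_hasCompactSupport
    (hasCompactSupport_shiftMul hu.hasCompactSupport.deriv)

theorem memLp_two_shiftMulDeriv (hu : IsTestProfile u) : MemLp (shiftMulDeriv u) 2 volPos :=
  (continuous_shiftMulDeriv hu).memLp_of_hasCompactSupport (hasCompactSupport_shiftMulDeriv hu)

theorem integrable_shiftMul (hu : IsTestProfile u) : Integrable (shiftMul u) volPos :=
  ((continuous_shiftMul hu).integrable_of_hasCompactSupport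
    (hasCompactSupport_shiftMul hu.hasCompactSupport)).restrict

theorem integrable_shiftMulDeriv (hu : IsTestProfile u) : Integrable (shiftMulDeriv u) volPos :=
  ((continuous_shiftMulDeriv hu).integrable_of_hasCompactSupport
    (hasCompactSupport_shiftMulDeriv hu)).restrict

theorem shiftMul_eq_zero (hu : IsTestProfile u) {t : ℝ} (ht : t ≤ 0) : shiftMul u t = 0 := by
  rw [shiftMul, hu.eq_zero (by linarith), smul_zero]

theorem shiftMulDeriv_eq_zero (hu : IsTestProfile u) {t : ℝ} (ht : t ≤ 0) : shiftMulDeriv u t = 0 := by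
  rw [shiftMulDeriv, hu.eq_zero (by linarith), hu.deriv_eq_zero (by linarith), smul_zero, add_zero]

/-- The integral over the half-line of the derivative of a function with compact support in it. -/
theorem integral_Ioi_deriv_eq_zero {E : Type*} [NormedAddCommGroup E] [NormedSpace ℝ E]
    [CompleteSpace E] {F F' : ℝ → E} (hF : ∀ t, HasDerivAt F (F' t) t) (hF' : Continuous F')
    (hc : HasCompactSupport F) (hc' : HasCompactSupport F') (h0 : ∀ t, t ≤ 0 → F' t = 0) :
    ∫ t in Ioi 0, F' t = 0 := by
  rw [setIntegral_eq_integral_of_forall_compl_eq_zero fun t (ht : t ∉ Ioi (0:ℝ)) => h0 t (not_lt.mp ht)]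
  have hFc : Continuous F := continuous_iff_continuousAt.mpr fun t => (hF t).continuousAt
  exact integral_eq_zero_of_hasDerivAt_of_integrable hF (hF'.integrable_of_hasCompactSupport hc')
    (hFc.integrable_of_hasCompactSupport hc)

/-- Hardy's identity. -/
theorem eLpNorm_shiftMulDeriv (hu : IsTestProfile u) :
    eLpNorm (shiftMulDeriv u) 2 volPos = eLpNorm (shiftMul (deriv u)) 2 volPos := by
  have i1 : Integrable (fun t => ‖shiftMulDeriv u t‖ ^ 2) volPos :=
    (memLp_two_iff_integrable_sq_norm (memLp_two_shiftMulDeriv hu).1).mp (memLp_two_shiftMulDeriv hu)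
  have i2 : Integrable (fun t => ‖shiftMul (deriv u) t‖ ^ 2) volPos :=
    (memLp_two_iff_integrable_sq_norm (memLp_two_shiftMul_deriv hu).1).mp (memLp_two_shiftMul_deriv hu)
  have hc1 := continuous_shiftMulDeriv hu
  have hc2 := continuous_shiftMul_deriv hu
  -- With r = 1 + t, |u + ru'|² - |ru'|² is the derivative of r|u|², which has compact support.
  have hd : ∀ t, HasDerivAt (fun t : ℝ => (1 + t) * ‖u (1 + t)‖ ^ 2)
      (‖shiftMulDeriv u t‖ ^ 2 - ‖shiftMul (deriv u) t‖ ^ 2) t := by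
    intro t
    have h1 := hu.hasDerivAt_one_add t
    have h2 : HasDerivAt (fun t : ℝ => 1 + t) 1 t := (hasDerivAt_id t).const_add 1
    refine (h2.mul h1.norm_sq).congr_deriv ?_
    rw [shiftMulDeriv, shiftMul, norm_add_sq_real, real_inner_smul_right]
    ring
  have h0 : ∫ t in Ioi 0, (‖shiftMulDeriv u t‖ ^ 2 - ‖shiftMul (deriv u) t‖ ^ 2) = 0 := by
    refine integral_Ioi_deriv_eq_zero hd (by fun_prop) ?_ ?_ ?_
    · exact hasCompactSupport_of_imp (hasCompactSupport_comp_one_add hu.hasCompactSupport)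
        fun t h => by rw [h]; simp
    · have c1 := (hasCompactSupport_shiftMulDeriv hu).comp_left (g := fun z => ‖z‖ ^ 2) (by simp)
      have c2 := (hasCompactSupport_shiftMul hu.hasCompactSupport.deriv).comp_left
        (g := fun z => ‖z‖ ^ 2) (by simp)
      exact c1.sub c2
    · intro t ht
      rw [shiftMulDeriv_eq_zero hu ht, shiftMul, hu.deriv_eq_zero (by linarith)]
      simp
  rw [integral_sub i1 i2, sub_eq_zero] at h0
  have key : ∀ f : ℝ → ℂ, Integrable (fun t => ‖f t‖ ^ 2) volPos →
      eLpNorm f 2 volPos = (ENNReal.ofReal (∫ t in Ioi 0, ‖f t‖ ^ 2)) ^ (1 / 2 : ℝ) := by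
    intro f hf
    rw [eLpNorm_eq_lintegral_rpow_enorm_toReal (by norm_num) (by norm_num), ENNReal.toReal_ofNat,
      ofReal_integral_eq_lintegral_ofReal hf (Eventually.of_forall fun t => by positivity)]
    congr 1
    refine lintegral_congr fun t => ?_
    rw [← ofReal_norm, ENNReal.ofReal_rpow_of_nonneg (norm_nonneg _) (by norm_num)]
    norm_cast
  rw [key _ i1, key _ i2, h0]

/-- Integration by parts; the cosine does not vanish at t = 0, but the profile does. -/
theorem halfTransform_cos_shiftMulDeriv (hu : IsTestProfile u) (ξ : ℝ) :
    halfTransform (fun θ => 2 * Real.cos θ) (shiftMulDeriv u) ξ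
      = (2 * Real.pi * ξ : ℝ) * halfTransform (fun θ => 2 * Real.sin θ) (shiftMul u) ξ := by
  have hd : ∀ t, HasDerivAt (fun t : ℝ => ((2 * Real.cos (2 * Real.pi * t * ξ) : ℝ) : ℂ) * shiftMul u t)
      (((2 * Real.cos (2 * Real.pi * t * ξ) : ℝ) : ℂ) * shiftMulDeriv u t
        - (2 * Real.pi * ξ : ℝ) * (((2 * Real.sin (2 * Real.pi * t * ξ) : ℝ) : ℂ) * shiftMul u t)) t := by
    intro t
    have h1 : HasDerivAt (fun t : ℝ => 2 * Real.pi * t * ξ) (2 * Real.pi * ξ) t := by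
      have := ((hasDerivAt_id t).const_mul (2 * Real.pi)).mul_const ξ
      simpa using this
    have h2 := (h1.cos.const_mul 2).ofReal_comp
    refine (h2.mul (hasDerivAt_shiftMul hu t)).congr_deriv ?_
    push_cast; ring
  have hc1 := continuous_shiftMul hu
  have hc2 := continuous_shiftMulDeriv hu
  have hs := hasCompactSupport_shiftMul hu.hasCompactSupport
  have h0 := integral_Ioi_deriv_eq_zero hd (by fun_prop)
    (hasCompactSupport_of_imp hs fun t h => by rw [h, mul_zero])
    ((hasCompactSupport_of_imp (hasCompactSupport_shiftMulDeriv hu) fun t h => by rw [h, mul_zero]).sub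
      (hasCompactSupport_of_imp hs fun t h => by rw [h, mul_zero, mul_zero])) (fun t ht => by
      rw [shiftMul_eq_zero hu ht, shiftMulDeriv_eq_zero hu ht]; simp)
  rw [integral_sub (integrable_trig_mul isTrigKernel_cos (integrable_shiftMulDeriv hu) ξ)
    ((integrable_trig_mul isTrigKernel_sin (integrable_shiftMul hu) ξ).const_mul _),
    integral_const_mul, sub_eq_zero] at h0
  exact h0

/-- The factors 1/s and s² combine to s, so that s u(s) remains. The rest is the shift s = 1 + t and
the change of frequency l = 2πξ. -/
theorem radialTransform_eq (u : ℝ → ℂ) (l : ℝ) :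
    radialTransform u l = (Real.sqrt (2 / Real.pi) / 2 : ℝ)
      * halfTransform (fun θ => 2 * Real.sin θ) (shiftMul u) (l / (2 * Real.pi)) := by
  have hpi := Real.pi_pos
  have h1 : ∫ s in Ioi (1:ℝ), ((Real.sin (l * (s - 1)) / s : ℝ) : ℂ) * u s * ((s ^ 2 : ℝ) : ℂ)
      = ∫ t in Ioi (0:ℝ), ((Real.sin (l * ((1 + t) - 1)) / (1 + t) : ℝ) : ℂ) * u (1 + t) * (((1 + t) ^ 2 : ℝ) : ℂ) := by
    have hmp : MeasurePreserving (fun t : ℝ => 1 + t) volPos (volume.restrict (Ioi 1)) := by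
      have := (measurePreserving_add_left (volume : Measure ℝ) 1).restrict_preimage
        (measurableSet_Ioi (a := (1 : ℝ)))
      simpa using this
    exact (hmp.integral_comp (measurableEmbedding_addLeft 1) (fun s : ℝ =>
      ((Real.sin (l * (s - 1)) / s : ℝ) : ℂ) * u s * ((s ^ 2 : ℝ) : ℂ))).symm
  rw [radialTransform, h1, halfTransform]
  push_cast
  rw [div_mul_eq_mul_div, mul_div_assoc, ← integral_div]
  congr 1
  refine setIntegral_congr_fun measurableSet_Ioi fun t ht => ?_
  have ht0 : (0:ℝ) < t := ht
  have h3 : (1 + t : ℂ) ≠ 0 := by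
    have : (1 + t : ℝ) ≠ 0 := by positivity
    exact_mod_cast this
  have h2 : 2 * (Real.pi:ℂ) * t * (l / (2 * Real.pi)) = l * (1 + t - 1) := by
    have : (Real.pi : ℂ) ≠ 0 := by exact_mod_cast hpi.ne'
    field_simp; ring
  simp only [h2, shiftMul, Complex.real_smul]
  push_cast
  field_simp

theorem mul_radialTransform_eq (hu : IsTestProfile u) (l : ℝ) :
    l * radialTransform u l = (Real.sqrt (2 / Real.pi) / 2 : ℝ)
      * halfTransform (fun θ => 2 * Real.cos θ) (shiftMulDeriv u) (l / (2 * Real.pi)) := by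
  rw [halfTransform_cos_shiftMulDeriv hu, radialTransform_eq]
  have : 2 * Real.pi * (l / (2 * Real.pi)) = l := by
    have := Real.pi_pos
    field_simp
  rw [this]; ring

/-- The integrand is u', and u vanishes at both ends. This moment condition is what makes the
rank-one correction of the kernel free. -/
theorem integral_shiftMul_deriv_div (hu : IsTestProfile u) :
    ∫ t in Ioi 0, (1 + t)⁻¹ • shiftMul (deriv u) t = 0 := by
  have h : ∀ t ∈ Ioi (0:ℝ), (1 + t)⁻¹ • shiftMul (deriv u) t = deriv u (1 + t) := fun t ht => by
    have ht0 : (0:ℝ) < t := ht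
    rw [shiftMul, smul_smul, inv_mul_cancel₀ (by positivity), one_smul]
  rw [setIntegral_congr_fun measurableSet_Ioi h]
  have hc := hu.contDiff_deriv.continuous
  exact integral_Ioi_deriv_eq_zero (F := fun t => u (1 + t)) hu.hasDerivAt_one_add (by fun_prop)
    (hasCompactSupport_comp_one_add hu.hasCompactSupport)
    (hasCompactSupport_comp_one_add hu.hasCompactSupport.deriv)
    (fun t ht => hu.deriv_eq_zero (by linarith))

/-- In (ru)' = u + ru' the term u is integrated by parts against the primitive `logKernel`. This
puts u' = (1+s)⁻¹ · ru' in its place and produces `gradKernel`. The subtracted term contributes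
nothing. -/
theorem integral_regKernel_shiftMulDeriv (hu : IsTestProfile u) {ε : ℝ} (hε : 0 < ε) {t : ℝ} (ht : 0 < t) :
    ∫ s in Ioi 0, regKernel ε t s • shiftMulDeriv u s
      = Real.pi⁻¹ • ∫ s in Ioi 0, (gradKernel ε t s - 2 / ((1 + t) * (1 + s))) • shiftMul (deriv u) s := by
  have hpi := Real.pi_pos
  have hcq := continuous_conjPoisson hε
  have hcl : Continuous (logKernel ε t) :=
    (continuous_logKernel hε).comp (by fun_prop : Continuous fun s => (t, s))
  have hc1 := hu.contDiff.continuous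
  have hc2 := hu.contDiff_deriv.continuous
  have hs1 := hasCompactSupport_comp_one_add hu.hasCompactSupport
  have hs2 := hasCompactSupport_comp_one_add hu.hasCompactSupport.deriv
  have hL := continuous_shiftMul_deriv hu
  have hsL := hasCompactSupport_shiftMul hu.hasCompactSupport.deriv
  set q : ℝ → ℝ := fun s => conjPoisson ε (t - s) + conjPoisson ε (t + s) with hq
  have hqc : Continuous q := by fun_prop
  have hd : ∀ s, HasDerivAt (fun s => logKernel ε t s • u (1 + s))
      (logKernel ε t s • deriv u (1 + s) + q s • u (1 + s)) s := by
    intro s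
    exact (hasDerivAt_logKernel hε t s).smul (hu.hasDerivAt_one_add s)
  have k1 : HasCompactSupport fun s => logKernel ε t s • u (1 + s) :=
    hasCompactSupport_of_imp hs1 fun s h => by rw [h, smul_zero]
  have k2 : HasCompactSupport fun s => logKernel ε t s • deriv u (1 + s) :=
    hasCompactSupport_of_imp hs2 fun s h => by rw [h, smul_zero]
  have k3 : HasCompactSupport fun s => q s • u (1 + s) :=
    hasCompactSupport_of_imp hs1 fun s h => by rw [h, smul_zero]
  have k4 : HasCompactSupport fun s => q s • shiftMul (deriv u) s :=
    hasCompactSupport_of_imp hsL fun s h => by rw [h, smul_zero]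
  have h0 := integral_Ioi_deriv_eq_zero hd (by fun_prop) k1 (k2.add k3) (fun s hs => by
      rw [hu.eq_zero (by linarith), hu.deriv_eq_zero (by linarith)]; simp)
  have ii : ∀ f : ℝ → ℂ, Continuous f → HasCompactSupport f → Integrable f volPos := fun f h1 h2 =>
    (h1.integrable_of_hasCompactSupport h2).restrict
  have i1 := ii (fun s => logKernel ε t s • deriv u (1 + s)) (by fun_prop) k2
  have i2 := ii (fun s => q s • u (1 + s)) (by fun_prop) k3
  have i3 := ii (fun s => q s • shiftMul (deriv u) s) (by fun_prop) k4
  have i4 : Integrable (fun s => (2 / (1 + t)) • ((1 + s)⁻¹ • shiftMul (deriv u) s)) volPos := by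
    refine ((ii (fun s => deriv u (1 + s)) (by fun_prop) hs2).smul (2 / (1 + t))).congr ?_
    filter_upwards [self_mem_ae_restrict measurableSet_Ioi] with s hs
    have hs0 : (0:ℝ) < s := hs
    rw [Pi.smul_apply, shiftMul, smul_smul (1 + s)⁻¹, inv_mul_cancel₀ (by positivity), one_smul]
  rw [integral_add i1 i2] at h0
  have e1 : ∫ s in Ioi 0, regKernel ε t s • shiftMulDeriv u s
      = Real.pi⁻¹ • ((∫ s in Ioi 0, q s • u (1 + s)) + ∫ s in Ioi 0, q s • shiftMul (deriv u) s) := by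
    rw [← integral_add i2 i3, ← integral_smul]
    refine integral_congr_ae (Eventually.of_forall fun s => ?_)
    simp only [regKernel, shiftMulDeriv, shiftMul, hq]
    module
  have e2 : ∀ s ∈ Ioi (0:ℝ), (gradKernel ε t s - 2 / ((1 + t) * (1 + s))) • shiftMul (deriv u) s
      = (q s • shiftMul (deriv u) s - logKernel ε t s • deriv u (1 + s))
        - (2 / (1 + t)) • ((1 + s)⁻¹ • shiftMul (deriv u) s) := by
    intro s hs
    have hs0 : (0:ℝ) < s := hs
    rw [shiftMul, gradKernel]
    simp only [smul_smul, ← sub_smul]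
    congr 1
    field_simp
    simp only [hq]
    ring
  have i31 : Integrable (fun s => q s • shiftMul (deriv u) s - logKernel ε t s • deriv u (1 + s)) volPos :=
    i3.sub i1
  rw [e1, setIntegral_congr_fun measurableSet_Ioi e2, integral_sub i31 i4, integral_sub i3 i1,
    integral_smul, integral_shiftMul_deriv_div hu, smul_zero, sub_zero]
  congr 1
  rw [eq_sub_iff_add_eq]
  linear_combination h0

/-- The left side is -u(1+s), and (1+s) u(1+s) is recovered from its derivative by integrating from
0. The indicator presents that integral as an L² pairing, which is stable under limits. -/
theorem shiftMul_deriv_eq (hu : IsTestProfile u) {s : ℝ} (hs : 0 < s) :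
    shiftMul (deriv u) s - shiftMulDeriv u s
      = -((1 + s)⁻¹ • ∫ x in Ioi 0, indicator (Ioc 0 s) (fun _ => (1:ℝ)) x • shiftMulDeriv u x) := by
  have h1 : ∫ x in Ioi 0, indicator (Ioc 0 s) (fun _ => (1:ℝ)) x • shiftMulDeriv u x
      = ∫ x in (0)..s, shiftMulDeriv u x := by
    rw [intervalIntegral.integral_of_le hs.le, ← integral_indicator measurableSet_Ioi,
      ← integral_indicator measurableSet_Ioc]
    refine integral_congr_ae (Eventually.of_forall fun x => ?_)
    by_cases hx : x ∈ Ioc 0 s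
    · have hx' : x ∈ Ioi (0:ℝ) := hx.1
      simp [indicator_of_mem hx, indicator_of_mem hx']
    · by_cases hx' : x ∈ Ioi (0:ℝ)
      · simp [indicator_of_notMem hx, indicator_of_mem hx']
      · simp [indicator_of_notMem hx, indicator_of_notMem hx']
  rw [h1, intervalIntegral.integral_eq_sub_of_hasDerivAt (fun x _ => hasDerivAt_shiftMul hu x)
    ((continuous_shiftMulDeriv hu).intervalIntegrable _ _), shiftMul_eq_zero hu le_rfl, sub_zero,
    shiftMul, shiftMul, shiftMulDeriv, smul_smul, inv_mul_cancel₀ (by positivity), one_smul]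
  ring

end Profile

/-! ### Limits of test profiles and the two weighted estimates. -/

theorem exists_seq_ae_tendsto {g : ℕ → Lp ℂ 2 volPos} {h : Lp ℂ 2 volPos}
    (hg : Tendsto g atTop (𝓝 h)) :
    ∃ ns : ℕ → ℕ, StrictMono ns ∧ ∀ᵐ t ∂volPos, Tendsto (fun i => g (ns i) t) atTop (𝓝 (h t)) :=
  (tendstoInMeasure_of_tendsto_Lp hg).exists_seq_tendsto_ae

/-- Fatou's lemma for weighted `L^p` norms. -/
theorem eLpNorm_smul_le_of_ae_tendsto {g : ℕ → ℝ → ℂ} {h : ℝ → ℂ} {w : ℝ → ℝ} {q B : ℝ≥0∞}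
    (hg : ∀ n, AEStronglyMeasurable (g n) volPos) (hw : Measurable w)
    (hlim : ∀ᵐ t ∂volPos, Tendsto (fun i => g i t) atTop (𝓝 (h t)))
    (hB : ∀ n, eLpNorm (fun t => w t • g n t) q volPos ≤ B) :
    eLpNorm (fun t => w t • h t) q volPos ≤ B := by
  refine (Lp.eLpNorm_lim_le_liminf_eLpNorm (f := fun n t => w t • g n t)
    (fun n => hw.aestronglyMeasurable.smul (hg n)) _ ?_).trans ?_
  · filter_upwards [hlim] with t ht
    exact ht.const_smul _
  · exact liminf_le_of_le (by isBoundedDefault) fun b hb => by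
      obtain ⟨n, hn⟩ := hb.exists
      exact hn.trans (hB n)

theorem memLp_two_indicator_Ioc (s : ℝ) :
    MemLp (indicator (Ioc 0 s) fun _ => (1:ℝ)) 2 volPos :=
  memLp_indicator_const 2 measurableSet_Ioc 1
    (Or.inr (((Measure.restrict_apply_le _ _).trans_lt (by simp)).ne))

/-- `φ` and `V` are the `L²` limits of `(1 + t) uₙ'(1 + t)` and `((1 + t) uₙ(1 + t))'` for some
sequence `uₙ` of test profiles. -/
def IsGradPair (φ V : Lp ℂ 2 volPos) : Prop :=
  ∃ (u : ℕ → ℝ → ℂ) (hu : ∀ n, IsTestProfile (u n)),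
    Tendsto (fun n => (memLp_two_shiftMul_deriv (hu n)).toLp _) atTop (𝓝 φ) ∧
      Tendsto (fun n => (memLp_two_shiftMulDeriv (hu n)).toLp _) atTop (𝓝 V)

theorem integral_smul_toLp {a : ℝ → ℝ} {f : ℝ → ℂ} (hf : MemLp f 2 volPos) :
    ∫ s in Ioi 0, a s • (hf.toLp f) s = ∫ s in Ioi 0, a s • f s := by
  refine integral_congr_ae ?_
  filter_upwards [hf.coeFn_toLp] with s hs
  rw [hs]

variable {φ V : Lp ℂ 2 volPos}

theorem memLp_two_gradKernel_sub {ε : ℝ} (hε : 0 < ε) {t : ℝ} (ht : 0 < t) :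
    MemLp (fun s => gradKernel ε t s - 2 / ((1 + t) * (1 + s))) 2 volPos := by
  refine ((memLp_two_gradKernel hε ht).sub (memLp_two_inv_one_add.const_mul (2 / (1 + t)))).ae_eq
    (Eventually.of_forall fun s => ?_)
  simp only [Pi.sub_apply]
  rw [div_mul_eq_div_div, div_eq_mul_inv _ (1 + s)]

theorem IsGradPair.integral_regKernel (h : IsGradPair φ V) {ε : ℝ} (hε : 0 < ε) {t : ℝ} (ht : 0 < t) :
    ∫ s in Ioi 0, regKernel ε t s • V s
      = Real.pi⁻¹ • ∫ s in Ioi 0, (gradKernel ε t s - 2 / ((1 + t) * (1 + s))) • φ s := by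
  obtain ⟨u, hu, h1, h2⟩ := h
  have l1 := tendsto_integral_smul_of_tendsto (memLp_two_regKernel hε t) h2
  have l2 := (tendsto_integral_smul_of_tendsto (memLp_two_gradKernel_sub hε ht) h1).const_smul Real.pi⁻¹
  refine tendsto_nhds_unique (l1.congr fun n => ?_) l2
  rw [integral_smul_toLp, integral_smul_toLp, integral_regKernel_shiftMulDeriv (hu n) hε ht]

theorem IsGradPair.ae_eq_sub (h : IsGradPair φ V) :
    ∀ᵐ s ∂volPos, φ s - V s
      = -((1 + s)⁻¹ • ∫ x in Ioi 0, indicator (Ioc 0 s) (fun _ => (1:ℝ)) x • V x) := by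
  obtain ⟨u, hu, h1, h2⟩ := h
  obtain ⟨ns, hns, hae⟩ := exists_seq_ae_tendsto (h1.sub h2)
  have hall : ∀ᵐ s ∂volPos, ∀ n, ((memLp_two_shiftMul_deriv (hu n)).toLp _
      - (memLp_two_shiftMulDeriv (hu n)).toLp _ : Lp ℂ 2 volPos) s
      = shiftMul (deriv (u n)) s - shiftMulDeriv (u n) s := by
    refine ae_all_iff.mpr fun n => ?_
    filter_upwards [Lp.coeFn_sub ((memLp_two_shiftMul_deriv (hu n)).toLp _)
      ((memLp_two_shiftMulDeriv (hu n)).toLp _), (memLp_two_shiftMul_deriv (hu n)).coeFn_toLp,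
      (memLp_two_shiftMulDeriv (hu n)).coeFn_toLp] with s a b c
    rw [a, Pi.sub_apply, b, c]
  filter_upwards [hae, hall, self_mem_ae_restrict measurableSet_Ioi, Lp.coeFn_sub φ V] with s a b hs c
  rw [c, Pi.sub_apply] at a
  refine tendsto_nhds_unique a ?_
  have l2 := ((tendsto_integral_smul_of_tendsto (memLp_two_indicator_Ioc s) h2).const_smul (1 + s)⁻¹).neg
  refine (l2.comp hns.tendsto_atTop).congr fun n => ?_
  simp only [Function.comp_apply]
  rw [b, shiftMul_deriv_eq (hu _) hs, integral_smul_toLp]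

/-- A majorant square-integrable in t and independent of x ≤ s, which justifies Fubini in the
average over (0, s]. -/
theorem abs_regKernel_le {ε : ℝ} (hε : 0 < ε) {t x s : ℝ} (ht : 0 < t) (hx : 0 < x) (hxs : x ≤ s) :
    |regKernel ε t x| ≤ 2 * (1 + 1 / ε) * (1 + s) * (1 + t)⁻¹ := by
  have h1 : |conjPoisson ε (t - x)| ≤ (1 + 1 / ε) * ((1 + s) * (1 + t)⁻¹) := by
    refine (abs_conjPoisson_le hε _).trans ?_
    gcongr
    rw [inv_le_iff_one_le_mul₀ (by positivity), mul_right_comm, ← div_eq_mul_inv,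
      one_le_div (by positivity)]
    have := le_abs_self (t - x)
    nlinarith [abs_nonneg (t - x)]
  have h2 : |conjPoisson ε (t + x)| ≤ (1 + 1 / ε) * ((1 + s) * (1 + t)⁻¹) := by
    refine (abs_conjPoisson_le hε _).trans ?_
    gcongr
    rw [abs_of_pos (by positivity), inv_le_iff_one_le_mul₀ (by positivity), mul_right_comm,
      ← div_eq_mul_inv, one_le_div (by positivity)]
    nlinarith
  have hpi : 1 ≤ Real.pi := by linarith [Real.pi_gt_three]
  rw [regKernel, abs_div, abs_of_pos Real.pi_pos]
  refine (div_le_self (abs_nonneg _) hpi).trans ((abs_add_le _ _).trans ?_)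
  linarith

theorem integral_Ioc_regKernel {ε : ℝ} (hε : 0 < ε) {s : ℝ} (hs : 0 < s) (t : ℝ) :
    ∫ x in Ioi 0, indicator (Ioc 0 s) (fun _ => (1:ℝ)) x * regKernel ε t x
      = Real.pi⁻¹ * logKernel ε t s := by
  have hc := continuous_conjPoisson hε
  have h1 : ∫ x in Ioi 0, indicator (Ioc 0 s) (fun _ => (1:ℝ)) x * regKernel ε t x
      = ∫ x in (0)..s, regKernel ε t x := by
    rw [intervalIntegral.integral_of_le hs.le, ← integral_indicator measurableSet_Ioi,
      ← integral_indicator measurableSet_Ioc]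
    refine integral_congr_ae (Eventually.of_forall fun x => ?_)
    by_cases hx : x ∈ Ioc 0 s
    · have hx' : x ∈ Ioi (0:ℝ) := hx.1
      simp [indicator_of_mem hx, indicator_of_mem hx']
    · by_cases hx' : x ∈ Ioi (0:ℝ)
      · simp [indicator_of_notMem hx, indicator_of_mem hx']
      · simp [indicator_of_notMem hx, indicator_of_notMem hx']
  have h2 := intervalIntegral.integral_eq_sub_of_hasDerivAt (a := 0) (b := s)
    (fun x _ => hasDerivAt_logKernel hε t x)
    (Continuous.intervalIntegrable (by fun_prop) _ _)
  rw [logKernel_zero, sub_zero] at h2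
  rw [h1, ← h2, ← intervalIntegral.integral_const_mul]
  congr 1
  ext x
  rw [regKernel]; ring

theorem integral_Ioc_integral_regKernel {ε : ℝ} (hε : 0 < ε) {s : ℝ} (hs : 0 < s) (h : Lp ℂ 2 volPos) :
    ∫ x in Ioi 0, indicator (Ioc 0 s) (fun _ => (1:ℝ)) x • ∫ t in Ioi 0, regKernel ε t x • h t
      = Real.pi⁻¹ • ∫ t in Ioi 0, logKernel ε t s • h t := by
  have hint : Integrable (Function.uncurry fun x t =>
      (indicator (Ioc 0 s) (fun _ => (1:ℝ)) x * regKernel ε t x) • h t) (volPos.prod volPos) := by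
    have i1 : Integrable (indicator (Ioc 0 s) fun _ => (1:ℝ)) volPos :=
      (integrable_indicator_iff measurableSet_Ioc).mpr (integrableOn_const
        (((Measure.restrict_apply_le _ _).trans_lt (by simp)).ne))
    have i2 := (i1.const_mul (2 * (1 + 1 / ε) * (1 + s))).mul_prod
      (integrable_smul_of_memLp_two memLp_two_inv_one_add h).norm
    refine i2.mono' ?_ ?_
    · have hm : Measurable fun z : ℝ × ℝ =>
          indicator (Ioc 0 s) (fun _ => (1:ℝ)) z.1 * regKernel ε z.2 z.1 :=
        ((measurable_const.indicator measurableSet_Ioc).comp measurable_fst).mul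
          ((continuous_regKernel hε).comp continuous_swap).measurable
      have hh : AEStronglyMeasurable (fun z : ℝ × ℝ => h z.2) (volPos.prod volPos) :=
        (Lp.aestronglyMeasurable h).comp_snd
      exact hm.aestronglyMeasurable.smul hh
    · rw [Measure.prod_restrict]
      filter_upwards [self_mem_ae_restrict (measurableSet_Ioi.prod measurableSet_Ioi)] with z hz
      obtain ⟨x, t⟩ := z
      have hx : 0 < x := hz.1
      have ht : 0 < t := hz.2
      simp only [Function.uncurry_apply_pair]
      by_cases hxs : x ∈ Ioc 0 s
      · rw [indicator_of_mem hxs, one_mul, norm_smul, norm_smul, mul_one, ← mul_assoc]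
        gcongr
        rw [Real.norm_of_nonneg (by positivity : 0 ≤ (1 + t)⁻¹)]
        exact abs_regKernel_le hε ht hx hxs.2
      · rw [indicator_of_notMem hxs]; simp
  have e1 : ∀ x, indicator (Ioc 0 s) (fun _ => (1:ℝ)) x • ∫ t in Ioi 0, regKernel ε t x • h t
      = ∫ t in Ioi 0, (indicator (Ioc 0 s) (fun _ => (1:ℝ)) x * regKernel ε t x) • h t := by
    intro x
    rw [← integral_smul]
    simp only [smul_smul]
  simp_rw [e1]
  rw [integral_integral_swap hint, ← integral_smul]
  congr 1
  ext t
  rw [integral_smul_const, integral_Ioc_regKernel hε hs, mul_smul]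

/-- The weight `(1 + t)^(2/p - 1)`. -/
def weight (p t : ℝ) : ℝ := (1 + t) ^ (2 / p - 1)

theorem measurable_weight (p : ℝ) : Measurable (weight p) :=
  (measurable_id.const_add 1).pow_const _

/-- There is a vanishing sequence of regularization parameters in `(0, 1]`. -/
theorem exists_regularization_sequence :
    ∃ ε : ℕ → ℝ, (∀ n, 0 < ε n) ∧ (∀ n, ε n ≤ 1) ∧ Tendsto ε atTop (𝓝 0) :=
  ⟨fun n => 1 / ((n:ℝ) + 1), fun n => by positivity,
    fun n => (div_le_one (by positivity)).mpr (by linarith [Nat.cast_nonneg (α := ℝ) n]),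
    tendsto_one_div_add_atTop_nhds_zero_nat⟩

theorem eLpNorm_weight_inv_pi_smul_le {p : ℝ} {D B : ℝ≥0∞} {f : ℝ → ℂ} {q : ℝ≥0∞}
    (h : eLpNorm (fun x => (1 + x) ^ (2 / p - 1) • f x) q volPos ≤ D * B) :
    eLpNorm (fun x => weight p x • Real.pi⁻¹ • f x) q volPos ≤ D * B := by
  refine le_trans (eLpNorm_mono fun x => ?_) h
  have hpi : Real.pi⁻¹ ≤ 1 := inv_le_one_of_one_le₀ (by linarith [Real.pi_gt_three])
  rw [norm_smul, norm_smul, norm_smul, weight, Real.norm_of_nonneg (inv_nonneg.mpr Real.pi_pos.le)]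
  gcongr
  exact mul_le_of_le_one_left (norm_nonneg _) hpi

/-- The Abel regularizations of `sinOp (cosOp V)` are integral operators in φ whose weighted bounds
do not depend on ε. A subsequence converges almost everywhere, and Fatou's lemma concludes. -/
theorem exists_eLpNorm_sinOp_cosOp_le {p : ℝ} (hp1 : 1 < p) (hp3 : p < 3) :
    ∃ D : ℝ≥0∞, D ≠ ⊤ ∧ ∀ φ V : Lp ℂ 2 volPos, IsGradPair φ V →
      eLpNorm (fun t => weight p t • sinOp (cosOp V) t) (ENNReal.ofReal p) volPos
        ≤ D * eLpNorm (fun t => weight p t • φ t) (ENNReal.ofReal p) volPos := by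
  obtain ⟨D, hD, hbd⟩ := exists_eLpNorm_weighted_le hp1 hp3 (C := 18) (by norm_num)
  -- Adding 1 keeps the constant nonzero, so an infinite norm on the right makes the claim trivial
  -- even if D = 0.
  refine ⟨D + 1, by finiteness, fun φ V h => ?_⟩
  by_cases hfin : eLpNorm (fun t => weight p t • φ t) (ENNReal.ofReal p) volPos = ⊤
  · rw [hfin, ENNReal.mul_top (by simp)]; exact le_top
  have hmem : MemLp (fun t => weight p t • φ t) (ENNReal.ofReal p) volPos :=
    ⟨(measurable_weight p).aestronglyMeasurable.smul (Lp.aestronglyMeasurable φ), Ne.lt_top hfin⟩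
  obtain ⟨ε, hε, hε1, hlim⟩ := exists_regularization_sequence
  obtain ⟨g, hg, hgl⟩ := exists_tendsto_sinOp_cosOp V hε hlim
  obtain ⟨ns, -, hae⟩ := exists_seq_ae_tendsto hgl
  refine eLpNorm_smul_le_of_ae_tendsto (fun n => Lp.aestronglyMeasurable (g (ns n)))
    (measurable_weight p) hae fun n => ?_
  have hk := hbd (ε (ns n)) _ (hε _) (isHilbertPerturbation_gradKernel_sub (hε _) (hε1 _)) φ hmem
    fun t ht => integrable_smul_of_memLp_two (memLp_two_gradKernel_sub (hε _) ht) φ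
  refine le_trans (le_of_eq (eLpNorm_congr_ae ?_))
    ((eLpNorm_weight_inv_pi_smul_le hk).trans (by gcongr; exacts [le_self_add, le_rfl]))
  filter_upwards [hg (ns n), self_mem_ae_restrict measurableSet_Ioi] with t ht ht0
  rw [ht, h.integral_regKernel (hε _) ht0]

theorem exists_eLpNorm_gradPair_le {p : ℝ} (hp1 : 1 < p) (hp3 : p < 3) :
    ∃ D : ℝ≥0∞, D ≠ ⊤ ∧ ∀ φ V : Lp ℂ 2 volPos, IsGradPair φ V →
      eLpNorm (fun t => weight p t • φ t) (ENNReal.ofReal p) volPos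
        ≤ D * eLpNorm (fun t => weight p t • sinOp (cosOp V) t) (ENNReal.ofReal p) volPos := by
  obtain ⟨D, hD, hbd⟩ := exists_eLpNorm_weighted_le hp1 hp3 (C := 18) (by norm_num)
  refine ⟨D + 1, by finiteness, fun φ V hφ => ?_⟩
  set h := sinOp (cosOp V) with hh
  -- Both transforms are involutions, so V is recovered from h by applying them in the opposite
  -- order.
  have hV : cosOp (sinOp h) = V := by
    rw [hh, sinOp, cosOp, halfOp_halfOp, halfOp_halfOp]
  by_cases hfin : eLpNorm (fun t => weight p t • h t) (ENNReal.ofReal p) volPos = ⊤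
  · rw [hfin, ENNReal.mul_top (by simp)]; exact le_top
  have hmem : MemLp (fun t => weight p t • h t) (ENNReal.ofReal p) volPos :=
    ⟨(measurable_weight p).aestronglyMeasurable.smul (Lp.aestronglyMeasurable h), Ne.lt_top hfin⟩
  obtain ⟨ε, hε, hε1, hlim⟩ := exists_regularization_sequence
  obtain ⟨g, hg, hgl⟩ := exists_tendsto_cosOp_sinOp h hε hlim
  rw [hV] at hgl
  obtain ⟨ns, hns, hae⟩ := exists_seq_ae_tendsto hgl
  -- The Q terms give π `g n`, and the logarithmic term gives its average, `logKernel` being the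
  -- integral of the Q terms over (0, s]. As n grows the right side tends to π(V - (1+s)⁻¹ ∫₀ˢ V) =
  -- πφ along the subsequence.
  have hfg : ∀ n, (fun s => ∫ t in Ioi 0, gradKernel (ε n) t s • h t)
      =ᵐ[volPos] fun s => Real.pi • (g n s
        - (1 + s)⁻¹ • ∫ x in Ioi 0, indicator (Ioc 0 s) (fun _ => (1:ℝ)) x • g n x) := by
    intro n
    filter_upwards [hg n, self_mem_ae_restrict measurableSet_Ioi] with s hs hs0
    have e1 : ∫ x in Ioi 0, indicator (Ioc 0 s) (fun _ => (1:ℝ)) x • g n x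
        = Real.pi⁻¹ • ∫ t in Ioi 0, logKernel (ε n) t s • h t := by
      rw [← integral_Ioc_integral_regKernel (hε n) hs0 h]
      refine integral_congr_ae ?_
      filter_upwards [hg n] with x hx
      rw [hx]
    have m1 : MemLp (fun t => regKernel (ε n) t s) 2 volPos := by
      have := ((memLp_two_conjPoisson_add (hε n) s).sub
        (memLp_two_conjPoisson_sub (hε n) s)).const_mul Real.pi⁻¹
      refine this.ae_eq (Eventually.of_forall fun t => ?_)
      simp only [Pi.sub_apply, regKernel]
      rw [← neg_sub s t, conjPoisson_neg, add_comm t s]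
      ring
    have m2 : MemLp (fun t => logKernel (ε n) t s) 2 volPos := by
      simp_rw [logKernel_comm _ s]
      exact memLp_two_logKernel (hε n) hs0
    have i1 := (integrable_smul_of_memLp_two m1 h).smul Real.pi
    have i2 := (integrable_smul_of_memLp_two m2 h).smul (1 + s)⁻¹
    have hpi := Real.pi_ne_zero
    rw [hs, e1, smul_sub, smul_comm (1 + s)⁻¹ Real.pi⁻¹, smul_smul, mul_inv_cancel₀ hpi, one_smul,
      ← integral_smul, ← integral_smul]
    refine Eq.trans ?_ (integral_sub i1 i2)
    congr 1
    ext t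
    simp only [gradKernel, regKernel, smul_smul, ← sub_smul]
    congr 1
    field_simp
  refine eLpNorm_smul_le_of_ae_tendsto
    (g := fun n s => Real.pi⁻¹ • ∫ t in Ioi 0, gradKernel (ε (ns n)) t s • h t) (fun n => ?_)
    (measurable_weight p) ?_ fun n => ?_
  · have hm : AEStronglyMeasurable (Function.uncurry fun s t => gradKernel (ε (ns n)) t s • h t)
        (volPos.prod volPos) :=
      (((measurable_gradKernel (hε (ns n))).comp measurable_swap).aestronglyMeasurable).smul
        (Lp.aestronglyMeasurable h).comp_snd
    exact hm.integral_prod_right'.const_smul Real.pi⁻¹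
  · filter_upwards [hae, hφ.ae_eq_sub, ae_all_iff.mpr hfg] with s h1 h2 h3
    have l2 := (tendsto_integral_smul_of_tendsto (memLp_two_indicator_Ioc s) hgl).const_smul (1 + s)⁻¹
    have l3 := h1.sub (l2.comp hns.tendsto_atTop)
    have h4 : φ s = V s - (1 + s)⁻¹ • ∫ x in Ioi 0, indicator (Ioc 0 s) (fun _ => (1:ℝ)) x • V x := by
      rw [sub_eq_iff_eq_add.mp h2, sub_eq_add_neg, add_comm]
    rw [h4]
    refine l3.congr fun n => ?_
    rw [h3, smul_smul, inv_mul_cancel₀ Real.pi_ne_zero, one_smul]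
    rfl
  · have hk := hbd (ε (ns n)) _ (hε _) (isHilbertPerturbation_neg_gradKernel_swap (hε _)) h hmem
      fun s hs => integrable_smul_of_memLp_two (memLp_two_gradKernel_left (hε _) hs).neg h
    refine (eLpNorm_weight_inv_pi_smul_le (le_of_eq_of_le (eLpNorm_congr_norm_ae ?_) hk)).trans
      (by gcongr; exacts [le_self_add, le_rfl])
    refine Eventually.of_forall fun s => ?_
    simp only [neg_smul, integral_neg, norm_smul, norm_neg]

/-! ### Polar coordinates on Ω. -/

/-- Integration in polar coordinates of a radial function. -/
theorem lintegral_fun_norm {F : ℝ → ℝ≥0∞} (hF : Measurable F) :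
    ∫⁻ x : E3, F ‖x‖ = (volume : Measure E3).toSphere univ
      * ∫⁻ r in Ioi (0:ℝ), ENNReal.ofReal (r ^ 2) * F r := by
  have hmp := (volume : Measure E3).measurePreserving_homeomorphUnitSphereProd
  have hd : Module.finrank ℝ E3 - 1 = 2 := by simp
  rw [hd] at hmp
  have hF2 : Measurable fun z : Metric.sphere (0:E3) 1 × Ioi (0:ℝ) => F z.2 := by fun_prop
  calc ∫⁻ x : E3, F ‖x‖ = ∫⁻ x in ({0}ᶜ : Set E3), F ‖x‖ := by rw [restrict_compl_singleton]
    _ = ∫⁻ x : ({0}ᶜ : Set E3), F ‖x.1‖ ∂((volume : Measure E3).comap (↑)) :=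
        (lintegral_subtype_comap (measurableSet_singleton _).compl _).symm
    _ = ∫⁻ z, F z.2 ∂((volume : Measure E3).toSphere.prod (Measure.volumeIoiPow 2)) := by
        rw [← hmp.lintegral_comp hF2]
        simp
    _ = (volume : Measure E3).toSphere univ * ∫⁻ r, F r ∂(Measure.volumeIoiPow 2) := by
        rw [lintegral_prod _ hF2.aemeasurable]
        simp only [lintegral_const]
        rw [mul_comm]
    _ = _ := by
        rw [Measure.volumeIoiPow, lintegral_withDensity_eq_lintegral_mul₀ (by fun_prop) (by fun_prop)]
        congr 1
        exact lintegral_subtype_comap measurableSet_Ioi fun r : ℝ => ENNReal.ofReal (r ^ 2) * F r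

/-- The area of the unit sphere. -/
def sphereArea : ℝ≥0∞ := (volume : Measure E3).toSphere univ

theorem sphereArea_ne_zero : sphereArea ≠ 0 := by
  rw [sphereArea, Measure.measure_univ_ne_zero]
  exact Measure.toSphere_ne_zero _

theorem sphereArea_ne_top : sphereArea ≠ ⊤ := measure_ne_top _ _

theorem measurableSet_Omega : MeasurableSet Omega := Metric.isClosed_closedBall.measurableSet.compl

theorem isOpen_Omega : IsOpen Omega := Metric.isClosed_closedBall.isOpen_compl

theorem mem_Omega {x : E3} : x ∈ Omega ↔ 1 < ‖x‖ := by
  simp [Omega]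

theorem lintegral_norm_sub_one {F : ℝ → ℝ≥0∞} (hF : Measurable F) :
    ∫⁻ x, F (‖x‖ - 1) ∂volOmega
      = sphereArea * ∫⁻ t, ENNReal.ofReal ((1 + t) ^ 2) * F t ∂volPos := by
  have h1 : ∫⁻ x, F (‖x‖ - 1) ∂volOmega
      = ∫⁻ x : E3, (Ioi (1:ℝ)).indicator (fun r => F (r - 1)) ‖x‖ := by
    rw [volOmega, ← lintegral_indicator measurableSet_Omega]
    refine lintegral_congr fun x => ?_
    by_cases hx : x ∈ Omega
    · have hx' : ‖x‖ ∈ Ioi (1:ℝ) := mem_Omega.mp hx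
      rw [indicator_of_mem hx, indicator_of_mem hx']
    · have hx' : ‖x‖ ∉ Ioi (1:ℝ) := fun h => hx (mem_Omega.mpr h)
      rw [indicator_of_notMem hx, indicator_of_notMem hx']
  have hm : Measurable ((Ioi (1:ℝ)).indicator fun r => F (r - 1)) :=
    (hF.comp (measurable_id.sub_const 1)).indicator measurableSet_Ioi
  rw [h1, lintegral_fun_norm hm, sphereArea]
  congr 1
  have h2 : ∀ r, ENNReal.ofReal (r ^ 2) * (Ioi (1:ℝ)).indicator (fun r => F (r - 1)) r
      = (Ioi (1:ℝ)).indicator (fun r => ENNReal.ofReal (r ^ 2) * F (r - 1)) r := by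
    intro r
    by_cases hr : r ∈ Ioi (1:ℝ)
    · rw [indicator_of_mem hr, indicator_of_mem hr]
    · rw [indicator_of_notMem hr, indicator_of_notMem hr, mul_zero]
  simp_rw [h2]
  rw [lintegral_indicator measurableSet_Ioi, Measure.restrict_restrict measurableSet_Ioi,
    Ioi_inter_Ioi, sup_of_le_left zero_le_one]
  have hmp : MeasurePreserving (fun t : ℝ => 1 + t) volPos (volume.restrict (Ioi 1)) := by
    have := (measurePreserving_add_left (volume : Measure ℝ) 1).restrict_preimage
      (measurableSet_Ioi (a := (1 : ℝ)))
    simpa using this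
  rw [← hmp.lintegral_comp_emb (measurableEmbedding_addLeft 1)]
  simp

/-- Null sets of radii pull back to null sets of Ω, so a profile known only almost everywhere
determines a radial function almost everywhere. -/
theorem quasiMeasurePreserving_norm_sub_one :
    Measure.QuasiMeasurePreserving (fun x : E3 => ‖x‖ - 1) volOmega volPos := by
  have hm : Measurable fun x : E3 => ‖x‖ - 1 := measurable_norm.sub_const 1
  refine ⟨hm, Measure.AbsolutelyContinuous.mk fun s hs h0 => ?_⟩
  rw [Measure.map_apply hm hs, ← lintegral_indicator_one (hm hs)]
  have h1 := lintegral_norm_sub_one (F := s.indicator 1) (measurable_one.indicator hs)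
  refine Eq.trans (lintegral_congr fun x => ?_) (h1.trans ?_)
  · rfl
  · rw [mul_eq_zero]
    right
    rw [← lintegral_zero (μ := volPos)]
    refine lintegral_congr_ae ?_
    filter_upwards [measure_eq_zero_iff_ae_notMem.mp h0] with t ht
    rw [indicator_of_notMem ht, mul_zero]

/-- The `L^p(Ω)` norm of a function with `|F(x)| = |H(|x| - 1)| / |x|`. -/
theorem eLpNorm_eq_of_norm_eq {E : Type*} [NormedAddCommGroup E] {F : E3 → E} {H : ℝ → ℂ} {p : ℝ}
    (hp : 0 < p) (hH : AEStronglyMeasurable H volPos)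
    (h : ∀ x ∈ Omega, ‖F x‖ = ‖x‖⁻¹ * ‖H (‖x‖ - 1)‖) :
    eLpNorm F (ENNReal.ofReal p) volOmega = sphereArea ^ (1 / p)
      * eLpNorm (fun t => weight p t • H t) (ENNReal.ofReal p) volPos := by
  have hp0 : ENNReal.ofReal p ≠ 0 := by simpa using hp
  have hae : ∀ᵐ x ∂volOmega, x ∈ Omega := self_mem_ae_restrict measurableSet_Omega
  set H' := hH.mk H with hH'
  have hm : Measurable H' := hH.stronglyMeasurable_mk.measurable
  have hHae : H =ᵐ[volPos] H' := hH.ae_eq_mk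
  rw [eLpNorm_eq_lintegral_rpow_enorm_toReal hp0 (by simp), eLpNorm_eq_lintegral_rpow_enorm_toReal hp0 (by simp),
    ENNReal.toReal_ofReal hp.le, ← ENNReal.mul_rpow_of_nonneg _ _ (by positivity)]
  congr 1
  have e1 : ∫⁻ x, ‖F x‖ₑ ^ p ∂volOmega
      = ∫⁻ x, (fun t => ENNReal.ofReal (((1 + t)⁻¹ * ‖H' t‖) ^ p)) (‖x‖ - 1) ∂volOmega := by
    refine lintegral_congr_ae ?_
    filter_upwards [hae, quasiMeasurePreserving_norm_sub_one.ae hHae] with x hx hx2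
    have : 1 < ‖x‖ := mem_Omega.mp hx
    rw [← hx2, ← ofReal_norm, h x hx, ENNReal.ofReal_rpow_of_nonneg (by positivity) hp.le]
    congr 4
    ring
  rw [e1, lintegral_norm_sub_one (F := fun t => ENNReal.ofReal (((1 + t)⁻¹ * ‖H' t‖) ^ p)) (by fun_prop)]
  congr 1
  refine lintegral_congr_ae ?_
  filter_upwards [hHae, self_mem_ae_restrict measurableSet_Ioi] with t ht ht0
  have ht1 : (0:ℝ) < t := ht0
  have h1 : (0:ℝ) < 1 + t := by positivity
  rw [ht, ← ENNReal.ofReal_mul (by positivity), ← ofReal_norm,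
    ENNReal.ofReal_rpow_of_nonneg (norm_nonneg _) hp.le, norm_smul, weight,
    Real.norm_of_nonneg (by positivity), Real.mul_rpow (by positivity) (norm_nonneg _),
    Real.mul_rpow (by positivity) (norm_nonneg _), ← mul_assoc, ← Real.rpow_mul h1.le,
    Real.inv_rpow h1.le, ← Real.rpow_neg h1.le, ← Real.rpow_natCast, ← Real.rpow_add h1]
  -- The powers of 1 + t agree because 2 - p = (2/p - 1) p; this is the origin of the weight.
  congr 3
  push_cast
  field_simp
  ring

/-- The radial function on `Ω` with profile `r ↦ H(r - 1) / r`. -/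
def radialMap (H : ℝ → ℂ) (x : E3) : ℂ := ‖x‖⁻¹ • H (‖x‖ - 1)

/-- The radial vector field on `Ω` with profile `r ↦ H(r - 1) / r`. -/
def radialField (H : ℝ → ℂ) (x : E3) : EuclideanSpace ℂ (Fin 3) :=
  radialMap H x • WithLp.toLp 2 fun i => ((‖x‖⁻¹ * x i : ℝ) : ℂ)

theorem norm_radialMap (H : ℝ → ℂ) (x : E3) : ‖radialMap H x‖ = ‖x‖⁻¹ * ‖H (‖x‖ - 1)‖ := by
  rw [radialMap, norm_smul, norm_inv, norm_norm]

theorem norm_radialField (H : ℝ → ℂ) {x : E3} (hx : x ∈ Omega) :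
    ‖radialField H x‖ = ‖x‖⁻¹ * ‖H (‖x‖ - 1)‖ := by
  have h1 : 0 < ‖x‖ := zero_lt_one.trans (mem_Omega.mp hx)
  have h2 : ‖(WithLp.toLp 2 fun i => ((‖x‖⁻¹ * x i : ℝ) : ℂ) : EuclideanSpace ℂ (Fin 3))‖ = 1 := by
    have h3 : ∑ i, x i ^ 2 = ‖x‖ ^ 2 := by
      rw [EuclideanSpace.norm_sq_eq]; simp
    rw [EuclideanSpace.norm_eq, Real.sqrt_eq_one]
    simp only [Complex.norm_real, Real.norm_eq_abs, sq_abs, mul_pow]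
    rw [← Finset.mul_sum, h3]
    field_simp
  rw [radialField, norm_smul, h2, mul_one, norm_radialMap]

theorem radialMap_shiftMul (u : ℝ → ℂ) {x : E3} (hx : x ∈ Omega) :
    radialMap (shiftMul u) x = lift u x := by
  have h1 : ‖x‖ ≠ 0 := (zero_lt_one.trans (mem_Omega.mp hx)).ne'
  rw [radialMap, shiftMul, lift, add_sub_cancel, smul_smul, inv_mul_cancel₀ h1, one_smul]

theorem radialField_shiftMul_deriv {u : ℝ → ℂ} (hu : IsTestProfile u) {x : E3} (hx : x ∈ Omega) :
    radialField (shiftMul (deriv u)) x = grad (lift u) x := by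
  have h1 : x ≠ 0 := norm_pos_iff.mp (zero_lt_one.trans (mem_Omega.mp hx))
  have hn : HasFDerivAt (fun x : E3 => ‖x‖) (‖x‖⁻¹ • innerSL ℝ x) x := by
    have h2 := (hasStrictFDerivAt_norm_sq x).hasFDerivAt.sqrt (by positivity)
    simp only [Real.sqrt_sq (norm_nonneg _)] at h2
    refine h2.congr_fderiv ?_
    ext y
    simp
    ring
  have hf : HasFDerivAt (lift u) _ x := (hu.hasDerivAt ‖x‖).hasFDerivAt.comp x hn
  rw [radialField, radialMap_shiftMul _ hx, grad, hf.fderiv]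
  ext i
  simp [lift, mul_comm, EuclideanSpace.inner_single_right]
  ring

theorem aestronglyMeasurable_radialMap {H : ℝ → ℂ} (hH : AEStronglyMeasurable H volPos) :
    AEStronglyMeasurable (radialMap H) volOmega :=
  (measurable_norm.inv.aestronglyMeasurable).smul
    (hH.comp_quasiMeasurePreserving quasiMeasurePreserving_norm_sub_one)

theorem aestronglyMeasurable_radialField {H : ℝ → ℂ} (hH : AEStronglyMeasurable H volPos) :
    AEStronglyMeasurable (radialField H) volOmega := by
  refine (aestronglyMeasurable_radialMap hH).smul (Measurable.aestronglyMeasurable ?_)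
  fun_prop

theorem radialMap_sub (f g : ℝ → ℂ) (x : E3) :
    radialMap (f - g) x = radialMap f x - radialMap g x := by
  rw [radialMap, Pi.sub_apply, smul_sub]; rfl

theorem radialField_sub (f g : ℝ → ℂ) (x : E3) :
    radialField (f - g) x = radialField f x - radialField g x := by
  rw [radialField, radialMap_sub, sub_smul]; rfl

/-! ### Transfer of L² limits between the half-line, Ω and the frequency side. -/

/-- Operators from functions on the half-line which multiply `L²` norms by a constant. -/
structure IsScaledIsometry {X E : Type*} [MeasurableSpace X] [NormedAddCommGroup E] (μ : Measure X)
    (J : (ℝ → ℂ) → X → E) (C : ℝ≥0∞) : Prop where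
  ne_zero : C ≠ 0
  ne_top : C ≠ ⊤
  sub : ∀ f g x, J (f - g) x = J f x - J g x
  aestronglyMeasurable : ∀ f, AEStronglyMeasurable f volPos → AEStronglyMeasurable (J f) μ
  eLpNorm_eq : ∀ f, AEStronglyMeasurable f volPos → eLpNorm (J f) 2 μ = C * eLpNorm f 2 volPos

namespace IsScaledIsometry

variable {X E : Type*} [MeasurableSpace X] [NormedAddCommGroup E] {μ : Measure X}
    {J : (ℝ → ℂ) → X → E} {C : ℝ≥0∞}

theorem memLp (h : IsScaledIsometry μ J C) {f : ℝ → ℂ} (hf : MemLp f 2 volPos) : MemLp (J f) 2 μ :=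
  ⟨h.aestronglyMeasurable f hf.1, by
    rw [h.eLpNorm_eq f hf.1]; exact ENNReal.mul_lt_top h.ne_top.lt_top hf.2⟩

theorem eLpNorm_sub (h : IsScaledIsometry μ J C) {f g : ℝ → ℂ} (hf : AEStronglyMeasurable f volPos)
    (hg : AEStronglyMeasurable g volPos) :
    eLpNorm (fun x => J f x - J g x) 2 μ = C * eLpNorm (f - g) 2 volPos := by
  rw [← h.eLpNorm_eq _ (hf.sub hg)]
  simp_rw [← h.sub]

theorem tendsto (h : IsScaledIsometry μ J C) {f : ℕ → ℝ → ℂ} (hf : ∀ n, MemLp (f n) 2 volPos)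
    {g : Lp ℂ 2 volPos} (hlim : Tendsto (fun n => (hf n).toLp (f n)) atTop (𝓝 g)) :
    Tendsto (fun n => eLpNorm (fun x => J (f n) x - J g x) 2 μ) atTop (𝓝 0) := by
  rw [Lp.tendsto_Lp_iff_tendsto_eLpNorm'] at hlim
  have h1 := ENNReal.Tendsto.const_mul hlim (Or.inr h.ne_top)
  rw [mul_zero] at h1
  refine h1.congr fun n => ?_
  rw [h.eLpNorm_sub (hf n).1 (Lp.aestronglyMeasurable g)]
  congr 1
  refine eLpNorm_congr_ae ?_
  filter_upwards [(hf n).coeFn_toLp] with x hx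
  simp [hx]

theorem ae_eq_of_tendsto (h : IsScaledIsometry μ J C) {f : ℕ → ℝ → ℂ} (hf : ∀ n, MemLp (f n) 2 volPos)
    {g : Lp ℂ 2 volPos} (hlim : Tendsto (fun n => (hf n).toLp (f n)) atTop (𝓝 g)) {G : X → E}
    (hG : AEStronglyMeasurable G μ)
    (hlim2 : Tendsto (fun n => eLpNorm (fun x => J (f n) x - G x) 2 μ) atTop (𝓝 0)) :
    G =ᵐ[μ] J g := by
  have hJg := h.aestronglyMeasurable g (Lp.aestronglyMeasurable g)
  have h3 : eLpNorm (G - J g) 2 μ = 0 := by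
    have h4 := hlim2.add (h.tendsto hf hlim)
    rw [add_zero] at h4
    refine le_antisymm (ge_of_tendsto' h4 fun n => ?_) zero_le
    have hJn := h.aestronglyMeasurable (f n) (hf n).1
    refine le_trans (le_of_eq ?_) ((eLpNorm_sub_le (f := fun x => J (f n) x - J g x)
      (g := fun x => J (f n) x - G x) (hJn.sub hJg) (hJn.sub hG) (by norm_num)).trans
      (le_of_eq (add_comm _ _)))
    congr 1
    ext x
    simp
  filter_upwards [(eLpNorm_eq_zero_iff (hG.sub hJg) (by norm_num)).mp h3] with x hx
  exact sub_eq_zero.mp hx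

/-- A nonzero multiple of an isometry reflects Cauchy sequences, so by completeness its range is
closed: a limit of radial functions again has a profile. -/
theorem exists_tendsto (h : IsScaledIsometry μ J C) {f : ℕ → ℝ → ℂ} (hf : ∀ n, MemLp (f n) 2 volPos)
    {G : X → E} (hG : AEStronglyMeasurable G μ)
    (hlim : Tendsto (fun n => eLpNorm (fun x => J (f n) x - G x) 2 μ) atTop (𝓝 0)) :
    ∃ g : Lp ℂ 2 volPos, Tendsto (fun n => (hf n).toLp (f n)) atTop (𝓝 g) ∧ G =ᵐ[μ] J g := by
  have hc : CauchySeq fun n => (hf n).toLp (f n) := by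
    rw [EMetric.cauchySeq_iff]
    intro δ hδ
    have hδ' : 0 < C * δ / 2 :=
      ENNReal.div_pos (mul_ne_zero h.ne_zero hδ.ne') (by norm_num)
    obtain ⟨N, hN⟩ := eventually_atTop.mp (hlim.eventually_lt_const hδ')
    refine ⟨N, fun m hm n hn => ?_⟩
    rw [Lp.edist_toLp_toLp]
    have hJm := h.aestronglyMeasurable (f m) (hf m).1
    have hJn := h.aestronglyMeasurable (f n) (hf n).1
    have h1 := eLpNorm_sub_le (f := fun x => J (f m) x - G x) (g := fun x => J (f n) x - G x)
      (hJm.sub hG) (hJn.sub hG) (p := 2) (by norm_num)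
    have h2 : ((fun x => J (f m) x - G x) - fun x => J (f n) x - G x) = fun x => J (f m) x - J (f n) x := by
      ext x; simp
    rw [h2, h.eLpNorm_sub (hf m).1 (hf n).1] at h1
    have h3 := h1.trans_lt (ENNReal.add_lt_add (hN m hm) (hN n hn))
    rw [ENNReal.add_halves] at h3
    exact (ENNReal.mul_lt_mul_iff_right h.ne_zero h.ne_top).mp h3
  obtain ⟨g, hg⟩ := cauchySeq_tendsto_of_complete hc
  exact ⟨g, hg, h.ae_eq_of_tendsto hf hg hG hlim⟩

end IsScaledIsometry

theorem weight_two (t : ℝ) : weight 2 t = 1 := by simp [weight]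

theorem isScaledIsometry_radialMap :
    IsScaledIsometry volOmega radialMap (sphereArea ^ (1 / 2 : ℝ)) where
  ne_zero := by simp [sphereArea_ne_zero, sphereArea_ne_top]
  ne_top := ENNReal.rpow_ne_top_of_nonneg (by norm_num) sphereArea_ne_top
  sub := radialMap_sub
  aestronglyMeasurable _ := aestronglyMeasurable_radialMap
  eLpNorm_eq f hf := by
    have := eLpNorm_eq_of_norm_eq (p := 2) (by norm_num) hf fun x _ => norm_radialMap f x
    simpa [weight_two] using this

theorem isScaledIsometry_radialField :
    IsScaledIsometry volOmega radialField (sphereArea ^ (1 / 2 : ℝ)) where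
  ne_zero := by simp [sphereArea_ne_zero, sphereArea_ne_top]
  ne_top := ENNReal.rpow_ne_top_of_nonneg (by norm_num) sphereArea_ne_top
  sub := radialField_sub
  aestronglyMeasurable _ := aestronglyMeasurable_radialField
  eLpNorm_eq f hf := by
    have := eLpNorm_eq_of_norm_eq (p := 2) (by norm_num) hf fun x hx => norm_radialField f hx
    simpa [weight_two] using this

theorem IsScaledIsometry.eq_of_ae_eq {X E : Type*} [MeasurableSpace X] [NormedAddCommGroup E]
    {μ : Measure X} {J : (ℝ → ℂ) → X → E} {C : ℝ≥0∞} (h : IsScaledIsometry μ J C)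
    {f g : Lp ℂ 2 volPos} (hfg : J f =ᵐ[μ] J g) : f = g := by
  have hf := Lp.aestronglyMeasurable f
  have hg := Lp.aestronglyMeasurable g
  have h1 : eLpNorm (fun x => J f x - J g x) 2 μ = 0 := by
    rw [← eLpNorm_zero (α := X) (ε := E) (p := 2) (μ := μ)]
    refine eLpNorm_congr_ae ?_
    filter_upwards [hfg] with x hx
    simp [hx]
  rw [h.eLpNorm_sub hf hg, mul_eq_zero, or_iff_right h.ne_zero,
    eLpNorm_eq_zero_iff (hf.sub hg) (by norm_num)] at h1
  refine Lp.ext ?_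
  filter_upwards [h1] with x hx
  exact sub_eq_zero.mp hx

/-- Rescaling of the frequency variable. -/
def freqScale (F : ℝ → ℂ) (l : ℝ) : ℂ := (Real.sqrt (2 / Real.pi) / 2 : ℝ) * F (l / (2 * Real.pi))

theorem map_div_two_pi_volPos :
    Measure.map (fun l => l / (2 * Real.pi)) volPos = ENNReal.ofReal (2 * Real.pi) • volPos := by
  have hpi := Real.two_pi_pos
  have h1 := Real.map_volume_mul_left (inv_ne_zero hpi.ne')
  have h2 : (fun l : ℝ => l / (2 * Real.pi)) = fun l => (2 * Real.pi)⁻¹ * l := by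
    ext l; rw [div_eq_inv_mul]
  have h3 : (fun l => (2 * Real.pi)⁻¹ * l) ⁻¹' Ioi (0:ℝ) = Ioi 0 := by
    ext l
    simp only [mem_preimage, mem_Ioi]
    exact mul_pos_iff_of_pos_left (inv_pos.mpr hpi)
  rw [h2]
  nth_rewrite 1 [volPos]
  rw [← h3, ← Measure.restrict_map (by fun_prop) measurableSet_Ioi, h1, Measure.restrict_smul, inv_inv,
    abs_of_pos hpi]

/-- The normalization √(2/π)/2 is exactly compensated by the factor √(2π) from the change of
variable. -/
theorem isScaledIsometry_freqScale : IsScaledIsometry volPos freqScale 1 where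
  ne_zero := one_ne_zero
  ne_top := ENNReal.one_ne_top
  sub f g l := by rw [freqScale, Pi.sub_apply, mul_sub]; rfl
  aestronglyMeasurable f hf := by
    have hf' : AEStronglyMeasurable f (Measure.map (fun l => l / (2 * Real.pi)) volPos) := by
      rw [map_div_two_pi_volPos]; exact hf.smul_measure _
    exact (hf'.comp_measurable (by fun_prop)).const_mul _
  eLpNorm_eq f hf := by
    have hpi := Real.pi_pos
    have hf' : AEStronglyMeasurable f (Measure.map (fun l => l / (2 * Real.pi)) volPos) := by
      rw [map_div_two_pi_volPos]; exact hf.smul_measure _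
    have h1 := eLpNorm_map_measure (p := 2) hf' (by fun_prop)
    rw [map_div_two_pi_volPos, eLpNorm_smul_measure_of_ne_top (by norm_num)] at h1
    have h2 : freqScale f = ((Real.sqrt (2 / Real.pi) / 2 : ℝ) : ℂ) • (f ∘ fun l => l / (2 * Real.pi)) := rfl
    rw [h2, eLpNorm_const_smul, ← h1, smul_eq_mul, ← mul_assoc]
    congr 1
    rw [← ofReal_norm, Complex.norm_real, Real.norm_of_nonneg (by positivity),
      ENNReal.ofReal_rpow_of_nonneg (by positivity) (by simp), ← ENNReal.ofReal_mul (by positivity),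
      ← ENNReal.ofReal_one]
    congr 1
    have h3 : (ENNReal.ofReal 1 / 2).toReal = 1 / 2 := by simp
    rw [h3, ← Real.sqrt_eq_rpow, div_mul_eq_mul_div, ← Real.sqrt_mul (by positivity)]
    have h4 : 2 / Real.pi * (2 * Real.pi) = 2 ^ 2 := by field_simp
    rw [h4, Real.sqrt_sq (by norm_num), div_self (by norm_num)]

/-! ### Weak gradients, the closure of the test profiles, and density. -/

section WeakGrad

variable {f : E3 → ℂ} {G G' : E3 → EuclideanSpace ℂ (Fin 3)}

theorem locallyIntegrableOn_apply (hG : LocallyIntegrableOn G Omega volume) (i : Fin 3) :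
    LocallyIntegrableOn (fun x => G x i) Omega volume := fun x hx =>
  let ⟨t, ht, hi⟩ := hG x hx
  ⟨t, ht, (EuclideanSpace.proj (𝕜 := ℂ) i).integrable_comp hi⟩

theorem integrable_smul_of_locallyIntegrableOn {g : E3 → ℂ} (hg : LocallyIntegrableOn g Omega volume)
    {ψ : E3 → ℝ} (hψ : Continuous ψ) (hc : HasCompactSupport ψ) (hs : tsupport ψ ⊆ Omega) :
    Integrable (fun x => ψ x • g x) volume := by
  have h1 := (hg.integrableOn_compact_subset hs hc).continuousOn_smul hψ.continuousOn hc
  refine (integrableOn_iff_integrable_of_support_subset fun x hx => ?_).mp h1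
  by_contra hx'
  exact hx (by simp only; rw [image_eq_zero_of_notMem_tsupport hx', zero_smul])

/-- The weak gradient is unique. -/
theorem HasWeakGrad.ae_eq (h : HasWeakGrad f G) (h' : HasWeakGrad f G') : G' =ᵐ[volOmega] G := by
  have key : ∀ i, ∀ᵐ x ∂volOmega, G' x i - G x i = 0 := by
    intro i
    have l1 := locallyIntegrableOn_apply h.locallyIntegrableOn_grad i
    have l2 := locallyIntegrableOn_apply h'.locallyIntegrableOn_grad i
    refine (ae_restrict_iff' measurableSet_Omega).mpr
      (isOpen_Omega.ae_eq_zero_of_integral_contDiff_smul_eq_zero (l2.sub l1) fun ψ h1 h2 h3 => ?_)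
    have i1 := integrable_smul_of_locallyIntegrableOn l1 h1.continuous h2 h3
    have i2 := integrable_smul_of_locallyIntegrableOn l2 h1.continuous h2 h3
    have e1 := h.integral_eq ψ h1 h2 h3 i
    rw [h'.integral_eq ψ h1 h2 h3 i, neg_inj] at e1
    have h0 : ∀ x ∉ Omega, ∀ z : ℂ, ψ x • z = 0 := fun x hx z => by
      rw [image_eq_zero_of_notMem_tsupport fun hx' => hx (h3 hx'), zero_smul]
    rw [setIntegral_eq_integral_of_forall_compl_eq_zero fun x hx => h0 x hx _,
      setIntegral_eq_integral_of_forall_compl_eq_zero fun x hx => h0 x hx _] at e1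
    simp only [smul_sub]
    rw [integral_sub i2 i1, e1, sub_self]
  filter_upwards [ae_all_iff.mpr key] with x hx
  ext i
  exact sub_eq_zero.mp (hx i)

theorem HasWeakGrad.congr (h : HasWeakGrad f G) (hG : G' =ᵐ[volOmega] G) : HasWeakGrad f G' where
  locallyIntegrableOn := h.locallyIntegrableOn
  locallyIntegrableOn_grad := h.locallyIntegrableOn_grad.congr hG.symm
  integral_eq ψ h1 h2 h3 i := by
    rw [h.integral_eq ψ h1 h2 h3 i]
    congr 1
    refine integral_congr_ae ?_
    filter_upwards [hG] with x hx
    rw [hx]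

end WeakGrad

namespace IsTestProfile

variable {u w : ℝ → ℂ}

theorem add (hu : IsTestProfile u) (hw : IsTestProfile w) : IsTestProfile (u + w) where
  contDiff := hu.contDiff.add hw.contDiff
  hasCompactSupport := hu.hasCompactSupport.add hw.hasCompactSupport
  tsupport_subset := (tsupport_add u w).trans (union_subset hu.tsupport_subset hw.tsupport_subset)

theorem const_smul (c : ℂ) (hu : IsTestProfile u) : IsTestProfile (c • u) where
  contDiff := hu.contDiff.const_smul c
  hasCompactSupport := hasCompactSupport_of_imp hu.hasCompactSupport fun t h => by simp [h]
  tsupport_subset := (closure_mono (Function.support_const_smul_subset c u)).trans hu.tsupport_subset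

theorem sub (hu : IsTestProfile u) (hw : IsTestProfile w) : IsTestProfile (u - w) := by
  have := hu.add (hw.const_smul (-1))
  rwa [neg_one_smul, ← sub_eq_add_neg] at this

theorem deriv_sub (hu : IsTestProfile u) (hw : IsTestProfile w) :
    deriv (u - w) = deriv u - deriv w := by
  ext r
  exact ((hu.hasDerivAt r).sub (hw.hasDerivAt r)).deriv

theorem zero : IsTestProfile 0 where
  contDiff := contDiff_const
  hasCompactSupport := HasCompactSupport.zero
  tsupport_subset := by simp [tsupport]

end IsTestProfile

theorem edist_toLp_shiftMulDeriv {u w : ℝ → ℂ} (hu : IsTestProfile u) (hw : IsTestProfile w) :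
    edist ((memLp_two_shiftMulDeriv hu).toLp _) ((memLp_two_shiftMulDeriv hw).toLp _)
      = edist ((memLp_two_shiftMul_deriv hu).toLp _) ((memLp_two_shiftMul_deriv hw).toLp _) := by
  rw [Lp.edist_toLp_toLp, Lp.edist_toLp_toLp]
  have h1 : shiftMulDeriv u - shiftMulDeriv w = shiftMulDeriv (u - w) := by
    ext t
    simp only [shiftMulDeriv, hu.deriv_sub hw, Pi.sub_apply]
    module
  have h2 : shiftMul (deriv u) - shiftMul (deriv w) = shiftMul (deriv (u - w)) := by
    ext t
    simp only [shiftMul, hu.deriv_sub hw, Pi.sub_apply]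
    module
  rw [h1, h2, eLpNorm_shiftMulDeriv (hu.sub hw)]

/-- Hardy's identity for differences of profiles makes (ru)' Cauchy as soon as ru' is. -/
theorem exists_tendsto_shiftMulDeriv {u : ℕ → ℝ → ℂ} (hu : ∀ n, IsTestProfile (u n)) {φ : Lp ℂ 2 volPos}
    (h : Tendsto (fun n => (memLp_two_shiftMul_deriv (hu n)).toLp _) atTop (𝓝 φ)) :
    ∃ V, Tendsto (fun n => (memLp_two_shiftMulDeriv (hu n)).toLp _) atTop (𝓝 V) := by
  have hc := h.cauchySeq
  rw [EMetric.cauchySeq_iff] at hc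
  refine cauchySeq_tendsto_of_complete (EMetric.cauchySeq_iff.mpr fun δ hδ => ?_)
  obtain ⟨N, hN⟩ := hc δ hδ
  exact ⟨N, fun m hm n hn => by rw [edist_toLp_shiftMulDeriv (hu m) (hu n)]; exact hN m hm n hn⟩

theorem IsGradPair.unique {φ V V' : Lp ℂ 2 volPos} (h : IsGradPair φ V) (h' : IsGradPair φ V') :
    V = V' := by
  obtain ⟨u, hu, h1, h2⟩ := h
  obtain ⟨u', hu', h1', h2'⟩ := h'
  have l1 := h2.edist h2'
  have l2 := h1.edist h1'
  rw [edist_self] at l2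
  exact edist_eq_zero.mp (tendsto_nhds_unique l1
    (l2.congr fun n => (edist_toLp_shiftMulDeriv (hu n) (hu' n)).symm))

theorem ae_mem_Omega : ∀ᵐ x ∂volOmega, x ∈ Omega := self_mem_ae_restrict measurableSet_Omega

theorem TendstoGrad.exists_isGradPair {u : ℕ → ℝ → ℂ} (hu : ∀ n, IsTestProfile (u n)) {f : E3 → ℂ}
    (h : TendstoGrad u f) {G : E3 → EuclideanSpace ℂ (Fin 3)} (hG : HasWeakGrad f G) :
    ∃ φ V, Tendsto (fun n => (memLp_two_shiftMul_deriv (hu n)).toLp _) atTop (𝓝 φ) ∧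
      Tendsto (fun n => (memLp_two_shiftMulDeriv (hu n)).toLp _) atTop (𝓝 V) ∧
      G =ᵐ[volOmega] radialField φ := by
  obtain ⟨G', hG', hlim⟩ := h
  have hlim' : Tendsto (fun n => eLpNorm (fun x => radialField (shiftMul (deriv (u n))) x - G x) 2 volOmega)
      atTop (𝓝 0) := by
    refine hlim.congr fun n => eLpNorm_congr_ae ?_
    filter_upwards [hG.ae_eq hG', ae_mem_Omega] with x hx hxo
    rw [hx, radialField_shiftMul_deriv (hu n) hxo]
  obtain ⟨φ, hφ, hφG⟩ := isScaledIsometry_radialField.exists_tendsto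
    (fun n => memLp_two_shiftMul_deriv (hu n)) hG.locallyIntegrableOn_grad.aestronglyMeasurable hlim'
  obtain ⟨V, hV⟩ := exists_tendsto_shiftMulDeriv hu hφ
  exact ⟨φ, V, hφ, hV, hφG⟩

theorem toLp_shiftMul_add {u w : ℝ → ℂ} (hu : IsTestProfile u) (hw : IsTestProfile w) :
    (memLp_two_shiftMul (hu.add hw)).toLp _
      = (memLp_two_shiftMul hu).toLp _ + (memLp_two_shiftMul hw).toLp _ := by
  refine Lp.ext ?_
  filter_upwards [(memLp_two_shiftMul (hu.add hw)).coeFn_toLp, (memLp_two_shiftMul hu).coeFn_toLp,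
    (memLp_two_shiftMul hw).coeFn_toLp, Lp.coeFn_add ((memLp_two_shiftMul hu).toLp _)
      ((memLp_two_shiftMul hw).toLp _)] with t h1 h2 h3 h4
  rw [h1, h4, Pi.add_apply, h2, h3, shiftMul, Pi.add_apply, smul_add]
  rfl

theorem toLp_shiftMul_const_smul {u : ℝ → ℂ} (c : ℂ) (hu : IsTestProfile u) :
    (memLp_two_shiftMul (hu.const_smul c)).toLp _ = c • (memLp_two_shiftMul hu).toLp _ := by
  refine Lp.ext ?_
  filter_upwards [(memLp_two_shiftMul (hu.const_smul c)).coeFn_toLp, (memLp_two_shiftMul hu).coeFn_toLp,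
    Lp.coeFn_smul c ((memLp_two_shiftMul hu).toLp _)] with t h1 h2 h3
  rw [h1, h3, Pi.smul_apply, h2, shiftMul, Pi.smul_apply, smul_comm]
  rfl

theorem toLp_shiftMul_zero : (memLp_two_shiftMul IsTestProfile.zero).toLp _ = 0 := by
  refine Lp.ext ?_
  filter_upwards [(memLp_two_shiftMul IsTestProfile.zero).coeFn_toLp, Lp.coeFn_zero ℂ 2 volPos]
    with t h1 h2
  rw [h1, h2, shiftMul, Pi.zero_apply, smul_zero]
  rfl

/-- The functions `shiftMul u` with `u` a test profile. -/
def shiftMulSubmodule : Submodule ℂ (Lp ℂ 2 volPos) where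
  carrier := {f | ∃ (u : ℝ → ℂ) (hu : IsTestProfile u), (memLp_two_shiftMul hu).toLp _ = f}
  add_mem' := fun ⟨u, hu, h⟩ ⟨w, hw, h'⟩ =>
    ⟨u + w, hu.add hw, by rw [toLp_shiftMul_add hu hw, h, h']⟩
  zero_mem' := ⟨0, IsTestProfile.zero, toLp_shiftMul_zero⟩
  smul_mem' := fun c _ ⟨u, hu, h⟩ => ⟨c • u, hu.const_smul c, by rw [toLp_shiftMul_const_smul c hu, h]⟩

/-- Orthogonality to (1+t)ψ(t) for all real bump functions ψ on (0, ∞) forces (1+t) g(t) to vanish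
almost everywhere. This gives the density of the profiles r u(r) in L²(0, ∞). -/
theorem shiftMulSubmodule_orthogonal : shiftMulSubmodule.orthogonal = ⊥ := by
  rw [Submodule.eq_bot_iff]
  intro g hg
  have hloc : LocallyIntegrableOn (fun t : ℝ => (1 + t) • g t) (Ioi 0) volume :=
    (locallyIntegrableOn_of_locallyIntegrable_restrict
      ((Lp.memLp g).locallyIntegrable (by norm_num))).continuousOn_smul
      isOpen_Ioi.isLocallyClosed (by fun_prop)
  have h0 := isOpen_Ioi.ae_eq_zero_of_integral_contDiff_smul_eq_zero hloc fun ψ h1 h2 h3 => by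
    have hu : IsTestProfile fun r => ((ψ (r - 1) : ℝ) : ℂ) := by
      have hc : HasCompactSupport fun r => ψ (r - 1) := h2.comp_homeomorph (Homeomorph.subRight 1)
      refine ⟨Complex.ofRealCLM.contDiff.comp (h1.comp (contDiff_id.sub contDiff_const)),
        hasCompactSupport_of_imp hc fun t h => by simp [h], ?_⟩
      have h4 : tsupport (fun r => ((ψ (r - 1) : ℝ) : ℂ)) ⊆ (fun r => r - 1) ⁻¹' tsupport ψ := by
        refine closure_minimal (fun r hr => subset_tsupport _ fun h => hr ?_)
          ((isClosed_tsupport ψ).preimage (by fun_prop))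
        simp [h]
      intro r hr
      have := h3 (h4 hr)
      simp only [mem_Ioi] at this ⊢
      linarith
    have h5 := (Submodule.mem_orthogonal _ _).mp hg _ ⟨_, hu, rfl⟩
    rw [L2.inner_def] at h5
    rw [← setIntegral_eq_integral_of_forall_compl_eq_zero (s := Ioi 0) fun t ht => by
      rw [image_eq_zero_of_notMem_tsupport fun h => ht (h3 h), zero_smul]]
    refine Eq.trans (integral_congr_ae ?_) h5
    filter_upwards [(memLp_two_shiftMul hu).coeFn_toLp] with t ht
    rw [ht, RCLike.inner_apply, shiftMul]
    simp
    ring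
  refine Lp.ext ?_
  have h1 : ∀ᵐ t ∂volPos, (1 + t) • g t = 0 := (ae_restrict_iff' measurableSet_Ioi).mpr h0
  filter_upwards [h1, self_mem_ae_restrict measurableSet_Ioi,
    Lp.coeFn_zero ℂ 2 volPos] with t ht ht0 hz
  have ht1 : (0:ℝ) < t := ht0
  rw [hz]
  exact (smul_eq_zero.mp ht).resolve_left (by positivity)

theorem exists_tendsto_shiftMul (h : Lp ℂ 2 volPos) :
    ∃ (u : ℕ → ℝ → ℂ) (hu : ∀ n, IsTestProfile (u n)),
      Tendsto (fun n => (memLp_two_shiftMul (hu n)).toLp _) atTop (𝓝 h) := by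
  have h1 : h ∈ shiftMulSubmodule.topologicalClosure := by
    rw [Submodule.topologicalClosure_eq_top_iff.mpr shiftMulSubmodule_orthogonal]
    trivial
  obtain ⟨x, hx, hlim⟩ := mem_closure_iff_seq_limit.mp h1
  choose u hu hux using hx
  exact ⟨u, hu, by simpa only [hux] using hlim⟩

/-! ### The square root of the Dirichlet Laplacian on the half-line. -/

section Transform

variable {u : ℕ → ℝ → ℂ}

theorem memLp_cos (hu : ∀ n, IsTestProfile (u n)) (n : ℕ) : MemLp (halfTransform (fun θ => 2 * Real.cos θ) (shiftMulDeriv (u n))) 2 volPos :=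
  memLp_halfTransform isTrigKernel_cos (integrable_shiftMulDeriv (hu n)) (memLp_two_shiftMulDeriv (hu n))

theorem memLp_sin (hu : ∀ n, IsTestProfile (u n)) (n : ℕ) : MemLp (halfTransform (fun θ => 2 * Real.sin θ) (shiftMul (u n))) 2 volPos :=
  memLp_halfTransform isTrigKernel_sin (integrable_shiftMul (hu n)) (memLp_two_shiftMul (hu n))

theorem tendsto_cos (hu : ∀ n, IsTestProfile (u n)) {V : Lp ℂ 2 volPos}
    (hV : Tendsto (fun n => (memLp_two_shiftMulDeriv (hu n)).toLp _) atTop (𝓝 V)) :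
    Tendsto (fun n => (memLp_cos hu n).toLp _) atTop (𝓝 (cosOp V)) := by
  refine ((cosOp.continuous.tendsto V).comp hV).congr fun n => ?_
  exact halfOp_toLp isTrigKernel_cos (integrable_shiftMulDeriv (hu n)) (memLp_two_shiftMulDeriv (hu n))

theorem tendsto_sin (hu : ∀ n, IsTestProfile (u n)) {h : Lp ℂ 2 volPos}
    (hh : Tendsto (fun n => (memLp_two_shiftMul (hu n)).toLp _) atTop (𝓝 h)) :
    Tendsto (fun n => (memLp_sin hu n).toLp _) atTop (𝓝 (sinOp h)) := by
  refine ((sinOp.continuous.tendsto h).comp hh).congr fun n => ?_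
  exact halfOp_toLp isTrigKernel_sin (integrable_shiftMul (hu n)) (memLp_two_shiftMul (hu n))

theorem freqScale_cos {u : ℝ → ℂ} (hu : IsTestProfile u) (l : ℝ) :
    freqScale (halfTransform (fun θ => 2 * Real.cos θ) (shiftMulDeriv u)) l = l * radialTransform u l :=
  (mul_radialTransform_eq hu l).symm

theorem freqScale_sin (u : ℝ → ℂ) (l : ℝ) :
    freqScale (halfTransform (fun θ => 2 * Real.sin θ) (shiftMul u)) l = radialTransform u l :=
  (radialTransform_eq u l).symm

end Transform

/-- The square root of the Dirichlet Laplacian acts as `sinOp ∘ cosOp` on `(r u(r))'`. -/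
theorem isSqrtDirichletLaplacian_iff {f : E3 → ℂ} (hf : MemRadialH10 f) {u : ℕ → ℝ → ℂ}
    (hu : ∀ n, IsTestProfile (u n)) (huf : TendstoGrad u f)
    {G : E3 → EuclideanSpace ℂ (Fin 3)} (hG : HasWeakGrad f G) {φ V : Lp ℂ 2 volPos}
    (hφ : Tendsto (fun n => (memLp_two_shiftMul_deriv (hu n)).toLp _) atTop (𝓝 φ))
    (hV : Tendsto (fun n => (memLp_two_shiftMulDeriv (hu n)).toLp _) atTop (𝓝 V))
    (hGφ : G =ᵐ[volOmega] radialField φ) (g : E3 → ℂ) :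
    IsSqrtDirichletLaplacian f g ↔ g =ᵐ[volOmega] radialMap (sinOp (cosOp V)) := by
  have hpos : ∀ᵐ l ∂volPos, l ∈ Ioi (0:ℝ) := self_mem_ae_restrict measurableSet_Ioi
  constructor
  · rintro ⟨k, ⟨-, hk2, w, hw, hwf, hwk⟩, hg2, -, z, hz, hzg, hzk⟩
    -- The transform of `f` may be realized along a sequence other than `u`. Both limits are
    -- nevertheless the same: φ is determined by the weak gradient, and V by φ.
    obtain ⟨φ', V', hφ', hV', hGφ'⟩ := hwf.exists_isGradPair hw hG
    have e1 : φ' = φ := isScaledIsometry_radialField.eq_of_ae_eq (hGφ'.symm.trans hGφ)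
    subst e1
    have e2 : V' = V := IsGradPair.unique ⟨w, hw, hφ', hV'⟩ ⟨u, hu, hφ, hV⟩
    subst e2
    have e3 := isScaledIsometry_freqScale.ae_eq_of_tendsto (memLp_cos hw) (tendsto_cos hw hV') hk2.1
      (hwk.congr fun n => by
        congr 1
        ext l
        rw [freqScale_cos (hw n), mul_sub])
    obtain ⟨h, hh, hgh⟩ := isScaledIsometry_radialMap.exists_tendsto
      (fun n => memLp_two_shiftMul (hz n)) hg2.1 (hzg.congr fun n => eLpNorm_congr_ae (by
        filter_upwards [ae_mem_Omega] with x hx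
        rw [radialMap_shiftMul _ hx]))
    have e4 := isScaledIsometry_freqScale.ae_eq_of_tendsto (memLp_sin hz) (tendsto_sin hz hh) hk2.1
      (by simpa only [freqScale_sin] using hzk)
    -- The sine transform of the profile of `g` equals the cosine transform of V', and inverting the
    -- sine transform identifies `g`.
    have e5 : sinOp h = cosOp V' := isScaledIsometry_freqScale.eq_of_ae_eq (e4.symm.trans e3)
    rwa [← e5, sinOp, halfOp_halfOp]
  · intro hg
    have hk : ∀ᵐ l : ℝ ∂volPos, (l : ℂ) * ((l : ℂ)⁻¹ * freqScale (cosOp V) l) = freqScale (cosOp V) l := by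
      filter_upwards [hpos] with l hl
      have : (l : ℂ) ≠ 0 := Complex.ofReal_ne_zero.mpr (ne_of_gt hl)
      rw [mul_inv_cancel_left₀ this]
    have hk2 : MemLp (fun l : ℝ => (l : ℂ) * ((l : ℂ)⁻¹ * freqScale (cosOp V) l)) 2 volPos :=
      (memLp_congr_ae hk).mpr (isScaledIsometry_freqScale.memLp (Lp.memLp _))
    refine ⟨fun l => (l : ℂ)⁻¹ * freqScale (cosOp V) l, ⟨hf, hk2, u, hu, huf, ?_⟩, ?_, hk2, ?_⟩
    · refine (isScaledIsometry_freqScale.tendsto (memLp_cos hu) (tendsto_cos hu hV)).congr fun n =>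
        eLpNorm_congr_ae ?_
      filter_upwards [hk] with l hl
      rw [mul_sub, hl, freqScale_cos (hu n)]
    · exact (memLp_congr_ae hg).mpr (isScaledIsometry_radialMap.memLp (Lp.memLp _))
    -- The sequence approximating `g` in L²(Ω) is unrelated to `u`; it comes from density.
    · obtain ⟨z, hz, hzh⟩ := exists_tendsto_shiftMul (sinOp (cosOp V))
      refine ⟨z, hz, ?_, ?_⟩
      · refine (isScaledIsometry_radialMap.tendsto _ hzh).congr fun n => eLpNorm_congr_ae ?_
        filter_upwards [hg, ae_mem_Omega] with x hx hxo
        rw [hx, radialMap_shiftMul _ hxo]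
      · have h1 := tendsto_sin hz hzh
        rw [sinOp, halfOp_halfOp] at h1
        refine (isScaledIsometry_freqScale.tendsto _ h1).congr fun n => eLpNorm_congr_ae ?_
        filter_upwards [hk] with l hl
        rw [hl, freqScale_sin]

end ExteriorBall

end

theorem proposition2p4 (p : ℝ) (hp1 : 1 < p) (hp3 : p < 3) :
    ∃ C : ℝ, 0 < C ∧ ∀ f : ExteriorBall.E3 → ℂ, ExteriorBall.MemRadialH10 f →
      ∃ (G : ExteriorBall.E3 → EuclideanSpace ℂ (Fin 3)) (g : ExteriorBall.E3 → ℂ),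
        -- `G = ∇f` and `g = (-Δ_D)^(1/2) f`, both well defined up to null sets
        (∀ G', ExteriorBall.HasWeakGrad f G' ↔ G' =ᵐ[ExteriorBall.volOmega] G) ∧
        (∀ g', ExteriorBall.IsSqrtDirichletLaplacian f g' ↔ g' =ᵐ[ExteriorBall.volOmega] g) ∧
        MemLp G 2 ExteriorBall.volOmega ∧ MemLp g 2 ExteriorBall.volOmega ∧
        ENNReal.ofReal C⁻¹ * eLpNorm G (ENNReal.ofReal p) ExteriorBall.volOmega
          ≤ eLpNorm g (ENNReal.ofReal p) ExteriorBall.volOmega ∧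
        eLpNorm g (ENNReal.ofReal p) ExteriorBall.volOmega
          ≤ ENNReal.ofReal C * eLpNorm G (ENNReal.ofReal p) ExteriorBall.volOmega := by
  open ExteriorBall in
  have hp0 : 0 < p := zero_lt_one.trans hp1
  obtain ⟨D₁, hD₁, h₁⟩ := exists_eLpNorm_sinOp_cosOp_le hp1 hp3
  obtain ⟨D₂, hD₂, h₂⟩ := exists_eLpNorm_gradPair_le hp1 hp3
  -- One constant dominating those of both directions; the 1 makes it positive, so that its inverse
  -- is meaningful.
  set C : ℝ := D₁.toReal + D₂.toReal + 1 with hC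
  have hC0 : 0 < C := by positivity
  have hC₁ : D₁ ≤ ENNReal.ofReal C :=
    ENNReal.le_ofReal_iff_toReal_le hD₁ hC0.le |>.mpr (by linarith [D₂.toReal_nonneg])
  have hC₂ : D₂ ≤ ENNReal.ofReal C :=
    ENNReal.le_ofReal_iff_toReal_le hD₂ hC0.le |>.mpr (by linarith [D₁.toReal_nonneg])
  refine ⟨C, hC0, fun f hf => ?_⟩
  obtain ⟨u, hu, huf⟩ := hf.2
  obtain ⟨G, hG, -⟩ := id huf
  obtain ⟨φ, V, hφ, hV, hGφ⟩ := huf.exists_isGradPair hu hG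
  have hpair : IsGradPair φ V := ⟨u, hu, hφ, hV⟩
  have nG : eLpNorm G (ENNReal.ofReal p) volOmega = sphereArea ^ (1 / p)
      * eLpNorm (fun t => weight p t • φ t) (ENNReal.ofReal p) volPos := by
    rw [eLpNorm_congr_ae hGφ]
    exact eLpNorm_eq_of_norm_eq hp0 (Lp.aestronglyMeasurable φ) fun x hx => norm_radialField φ hx
  have ng : eLpNorm (radialMap (sinOp (cosOp V))) (ENNReal.ofReal p) volOmega = sphereArea ^ (1 / p)
      * eLpNorm (fun t => weight p t • sinOp (cosOp V) t) (ENNReal.ofReal p) volPos :=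
    eLpNorm_eq_of_norm_eq hp0 (Lp.aestronglyMeasurable _) fun x _ => norm_radialMap _ x
  refine ⟨G, radialMap (sinOp (cosOp V)), fun G' => ⟨hG.ae_eq, hG.congr⟩,
    isSqrtDirichletLaplacian_iff hf hu huf hG hφ hV hGφ,
    (memLp_congr_ae hGφ).mpr (isScaledIsometry_radialField.memLp (Lp.memLp φ)),
    isScaledIsometry_radialMap.memLp (Lp.memLp _), ?_, ?_⟩
  · rw [ENNReal.ofReal_inv_of_pos hC0, ENNReal.inv_mul_le_iff (by simpa using hC0) (by simp), nG, ng,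
      mul_left_comm]
    gcongr
    exact (h₂ φ V hpair).trans (by gcongr)
  · rw [nG, ng, mul_left_comm]
    gcongr
    exact (h₁ φ V hpair).trans (by gcongr)
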